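/- Let $D\subset\mathbb R^2$ be the closed unit disk. An admissible graph $C\subset D$ consists of finitely many vertices and smooth embedded curves, disjoint except at the vertices, such that three curves meet at every vertex in the interior of $D$, exactly one curve meets $\partial D$ at every vertex on $\partial D$, and $C$ decomposes the open disk into $n$ regions $R_1,\dots,R_n$ (possibly disconnected), each curve separating two different regions. Write $C_{ij}$ for the union of the curves separating $R_i$ and $R_j$, $N_{ij}$ for its unit normal pointing into $R_i$, and $h_{ij}$ for its geodesic curvature with respect to $N_{ij}$. The graph $C$ is stationary if the first derivative of its length vanishes for every smooth variation of $C$ in $D$ (mapping $\partial D$ to $\partial D$) which keeps the areas of all the regions constant. For a stationary graph, an admissible function $u$ is a family $u_{ij}=-u_{ji}\in W^{1,2}(C_{ij})$ with $u_{ij}(p)+u_{jk}(p)+u_{ki}(p)=0$ at every interior vertex $p$, where $R_i,R_j,R_k$ are the regions meeting at $p$. The index form is $$Q(u,v)=\frac12\sum_{i\ne j}\Big\{\int_{C_{ij}}\big(u_{ij}'v_{ij}'-h_{ij}^2u_{ij}v_{ij}\big)+\sum_{p\in\partial C_{ij}\cap \mathrm{int}\,D}(q_{ij}u_{ij}v_{ij})(p)-\sum_{p\in\partial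 C_{ij}\cap\partial D}(u_{ij}v_{ij})(p)\Big\},$$ where $q_{ij}(p)=(h_{ki}+h_{kj})(p)/\sqrt3$ and $R_k$ is the third region touching $p$. The stationary graph $C$ is stable if $Q(u,u)\ge0$ for every admissible $u$ with $\sum_{j}\int_{C_{ij}}u_{ij}=0$ for all $i$, and unstable otherwise. A boundary 3-component is a connected component of a region whose boundary is a curvilinear triangle formed by three edges: two curves of $C$ issuing from a common interior vertex and ending on $\partial D$, and the arc of $\partial D$ between their end points. Proposition. Let $C\subset D$ be a stationary graph in which some region has two different boundary 3-components $\Omega_1$, $\Omega_2$. Suppose that $C$ separates the disk into three regions or, more generally for any number $n$ of regions, that $\Omega_1$ and $\Omega_2$ are adjacent to the same two regions (this is automatic when $n=3$). Then $C$ is unstable. -/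

import Mathlib

open scoped ContDiff

noncomputable section

/-- Finitely many plane curves `γ e : [0, len e] → ℂ` (the plane is identified with `ℂ`). -/
structure CurveSystem where
  numEdges : ℕ
  len : Fin numEdges → ℝ
  γ : Fin numEdges → ℝ → ℂ

namespace CurveSystem

variable (S : CurveSystem)

/-- The point set of the curve `e`. -/
def edge (e : Fin S.numEdges) : Set ℂ := S.γ e '' Set.Icc 0 (S.len e)

/-- The union of all the curves. -/
def carrier : Set ℂ := ⋃ e, S.edge e

/-- The two ends of the curves: `(e, false)` is the starting end and `(e, true)` the final end
of the curve `e`. -/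
abbrev End : Type := Fin S.numEdges × Bool

/-- The parameter value at an end. -/
def param (a : S.End) : ℝ := if a.2 then S.len a.1 else 0

/-- The point of the plane at an end. -/
def endPt (a : S.End) : ℂ := S.γ a.1 (S.param a)

/-- The other end of the same curve. -/
def opp (a : S.End) : S.End := (a.1, !a.2)

/-- The unit normal of the curve `e`, pointing to its left. -/
def leftNormal (e : Fin S.numEdges) (s : ℝ) : ℂ := Complex.I * deriv (S.γ e) s

/-- The geodesic curvature of the curve `e` (parametrized by arc length) with respect to the
normal pointing to its left. -/
def leftCurv (e : Fin S.numEdges) (s : ℝ) : ℝ :=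
  inner ℝ (iteratedDeriv 2 (S.γ e) s) (S.leftNormal e s)

end CurveSystem

/-- An admissible graph in the closed unit disk, decomposing the open unit disk into `n` (possibly
disconnected) regions. The curves are smooth up to their ends and parametrized by arc length (the
functions `γ e` are extended smoothly to the whole line, but only their values on `[0, len e]`
matter). A curve either joins two (possibly equal) vertices, or is a smooth closed curve without
vertices. -/
structure AdmissibleGraph (n : ℕ) extends CurveSystem where
  verts : Finset ℂ
  verts_mem : ∀ v ∈ verts, ‖v‖ ≤ 1
  len_pos : ∀ e, 0 < len e
  smooth : ∀ e, ContDiff ℝ ∞ (γ e)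
  unit_speed : ∀ e, ∀ s ∈ Set.Icc 0 (len e), ‖deriv (γ e) s‖ = 1
  ends : ∀ e, (γ e 0 ∈ verts ∧ γ e (len e) ∈ verts) ∨
    (γ e 0 ∉ verts ∧ Function.Periodic (γ e) (len e))
  /- The curves are simple, and meet each other and the vertices only at their ends. -/
  simple : ∀ e, Set.InjOn (γ e) (Set.Ico 0 (len e))
  interior_not_vert : ∀ e, ∀ s ∈ Set.Ioo 0 (len e), γ e s ∉ verts
  disjoint_edges : ∀ e f, e ≠ f → ∀ z, z ∈ toCurveSystem.edge e → z ∈ toCurveSystem.edge f →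
    z ∈ verts
  /- Away from the vertices the curves lie in the open disk. -/
  inside : ∀ z ∈ toCurveSystem.carrier, z ∉ verts → ‖z‖ < 1
  degree_interior : ∀ v ∈ verts, ‖v‖ < 1 → {a : toCurveSystem.End | toCurveSystem.endPt a = v}.ncard = 3
  degree_boundary : ∀ v ∈ verts, ‖v‖ = 1 → {a : toCurveSystem.End | toCurveSystem.endPt a = v}.ncard = 1
  /- The regions. -/
  region : Fin n → Set ℂ
  region_open : ∀ i, IsOpen (region i)
  region_nonempty : ∀ i, (region i).Nonempty
  region_disjoint : ∀ i j, i ≠ j → Disjoint (region i) (region j)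
  region_union : (⋃ i, region i) = Metric.ball 0 1 \ toCurveSystem.carrier
  /- Every curve separates two different regions, `left e` on its left and `right e` on its
  right. -/
  left : Fin numEdges → Fin n
  right : Fin numEdges → Fin n
  left_spec : ∀ e, ∀ s ∈ Set.Ioo 0 (len e), ∀ᶠ r : ℝ in nhdsWithin 0 (Set.Ioi 0),
    γ e s + r • toCurveSystem.leftNormal e s ∈ region (left e)
  right_spec : ∀ e, ∀ s ∈ Set.Ioo 0 (len e), ∀ᶠ r : ℝ in nhdsWithin 0 (Set.Ioi 0),
    γ e s - r • toCurveSystem.leftNormal e s ∈ region (right e)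
  left_ne_right : ∀ e, left e ≠ right e

namespace AdmissibleGraph

variable {n : ℕ} (C : AdmissibleGraph n)

/-- A smooth variation `φ t`, `|t| < ε`, of the graph inside the closed disk. In order that the
deformed regions make sense it is carried along by an isotopy `Φ t` of the closed disk:
`φ t = Φ t` on the graph, which is smooth on every curve, and the regions defined by the deformed
graph are the sets `Φ t '' region i`. -/
structure Variation where
  ε : ℝ
  ε_pos : 0 < ε
  Φ : ℝ → ℂ → ℂ
  zero : ∀ z ∈ Metric.closedBall (0 : ℂ) 1, Φ 0 z = z
  bijOn : ∀ t ∈ Set.Ioo (-ε) ε,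
    Set.BijOn (Φ t) (Metric.closedBall 0 1) (Metric.closedBall 0 1)
  mapsTo_boundary : ∀ t ∈ Set.Ioo (-ε) ε,
    Set.MapsTo (Φ t) (Metric.sphere 0 1) (Metric.sphere 0 1)
  cont : ContinuousOn (fun p : ℝ × ℂ => Φ p.1 p.2)
    (Set.Ioo (-ε) ε ×ˢ Metric.closedBall (0 : ℂ) 1)
  smooth : ∀ e, ContDiffOn ℝ ∞ (fun p : ℝ × ℝ => Φ p.1 (C.γ e p.2))
    (Set.Ioo (-ε) ε ×ˢ Set.Icc 0 (C.len e))

/-- The length of the deformed graph. -/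
def Variation.length {C : AdmissibleGraph n} (W : C.Variation) (t : ℝ) : ℝ :=
  ∑ e, ∫ s in (0 : ℝ)..(C.len e), ‖deriv (fun s => W.Φ t (C.γ e s)) s‖

/-- The variation leaves the area of every region constant. -/
def Variation.AreaPreserving {C : AdmissibleGraph n} (W : C.Variation) : Prop :=
  ∀ i, ∀ t ∈ Set.Ioo (-W.ε) W.ε,
    MeasureTheory.volume (W.Φ t '' C.region i) = MeasureTheory.volume (C.region i)

/-- A graph is stationary if the first derivative of length vanishes for every area-preserving
variation. -/
def IsStationary : Prop :=
  ∀ W : C.Variation, W.AreaPreserving → HasDerivAt W.length 0 0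

/-- The geodesic curvature of the curve `e` with respect to the normal pointing into the region `i`
(`0` if `i` is not one of the two regions separated by `e`). -/
def curvInto (i : Fin n) (e : Fin C.numEdges) (s : ℝ) : ℝ :=
  if C.left e = i then C.leftCurv e s else if C.right e = i then - C.leftCurv e s else 0

/-- The end `a` lies at an interior vertex. -/
def IsInteriorEnd (a : C.End) : Prop := C.endPt a ∈ C.verts ∧ ‖C.endPt a‖ < 1

/-- The end `a` lies at a boundary vertex. -/
def IsBoundaryEnd (a : C.End) : Prop := C.endPt a ∈ C.verts ∧ ‖C.endPt a‖ = 1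

open Classical in
/-- The number `q_ij(p) = (h_ki + h_kj)(p) / √3`, for the end `a`, at the interior vertex `p`, of
a curve separating the regions `i` and `j`. Here `k` is the third region touching `p`, and `h_ki`,
`h_kj` are the geodesic curvatures at `p` of the other two curves meeting there, with respect to
the normals pointing into the region `k`. (In the sum, regions `k` not touching `p` and the curve
of `a` itself contribute `0`.) -/
def q (a : C.End) : ℝ :=
  (∑ k : Fin n, if k = C.left a.1 ∨ k = C.right a.1 then 0 else
    ∑ b : C.End, if C.endPt b = C.endPt a then C.curvInto k b.1 (C.param b) else 0) / √3

/-- `1` at the starting end of a curve, `-1` at the final end. -/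
def endSign (a : C.End) : ℝ := if a.2 then -1 else 1

open Classical in
/-- Admissible functions. `u e` is the component, along the curve `e` parametrized by arc length,
with respect to the normal pointing to the left of `e`, i.e. `u_ij` for `i = left e`,
`j = right e` (and `u_ji = - u_ij`). It lies in the Sobolev space `W^{1,2}`, that is, it is
absolutely continuous with square integrable derivative (and it is well defined on a closed curve
without vertices). When the three curves at an interior vertex are oriented so as to leave it, the
region on the left of each of them is the one on the right of the next, so that the condition
`u_ij + u_jk + u_ki = 0` says that the components with respect to the left normals of the curves
oriented in this way add up to zero. -/
structure IsAdmissible (u : Fin C.numEdges → ℝ → ℝ) : Prop where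
  absCont : ∀ e, AbsolutelyContinuousOnInterval (u e) 0 (C.len e)
  deriv_memLp : ∀ e, MeasureTheory.MemLp (deriv (u e)) 2
    (MeasureTheory.volume.restrict (Set.Ioo 0 (C.len e)))
  closed : ∀ e, C.γ e 0 ∉ C.verts → u e 0 = u e (C.len e)
  vertex : ∀ v ∈ C.verts, ‖v‖ < 1 →
    ∑ a : C.End, (if C.endPt a = v then C.endSign a * u a.1 (C.param a) else 0) = 0

/-- The mean value conditions `∑_j ∫_{C_ij} u_ij = 0` for every region `i`: the associated
variation preserves areas (to first order). -/
def MeanZero (u : Fin C.numEdges → ℝ → ℝ) : Prop :=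
  ∀ i, ∑ e, ((if C.left e = i then ∫ s in (0 : ℝ)..(C.len e), u e s else 0) -
    (if C.right e = i then ∫ s in (0 : ℝ)..(C.len e), u e s else 0)) = 0

open Classical in
/-- The index form
`Q(u,v) = -1/2 ∑_{i,j} { ∫ (u_ij'' + h_ij² u_ij) v_ij + ∑_{p interior} (-q_ij u_ij + ∂u_ij/∂ν_ij) v_ij
+ ∑_{p boundary} (u_ij + ∂u_ij/∂ν_ij) v_ij }`, with `ν_ij` the inner conormal, on the space
`W^{1,2}`: the terms with `u_ij''` and `∂u_ij/∂ν_ij` add up to `- ∫ u_ij' v_ij'`, and every curve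
appears twice in the sum over ordered pairs `(i, j)`. -/
def indexForm (u v : Fin C.numEdges → ℝ → ℝ) : ℝ :=
  (∑ e, ∫ s in (0 : ℝ)..(C.len e),
    (deriv (u e) s * deriv (v e) s - C.leftCurv e s ^ 2 * u e s * v e s))
  + (∑ a : C.End, if C.IsInteriorEnd a then
      C.q a * u a.1 (C.param a) * v a.1 (C.param a) else 0)
  - ∑ a : C.End, if C.IsBoundaryEnd a then u a.1 (C.param a) * v a.1 (C.param a) else 0

/-- Stability: the index form is nonnegative on the admissible functions whose associated variation
preserves areas. -/
def IsStable : Prop :=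
  ∀ u : Fin C.numEdges → ℝ → ℝ, C.IsAdmissible u → C.MeanZero u → 0 ≤ C.indexForm u u

/-- Unstable means not stable. -/
def IsUnstable : Prop := ¬ C.IsStable

/-- `Ω` is a boundary 3-component of the region `i`: a connected component of this region whose
boundary is a curvilinear triangle formed by three edges, namely two curves of the graph leaving a
common interior vertex and reaching the unit circle, and the arc of the unit circle (containing no
further vertex) between their end points. -/
def IsBoundaryThreeComponent (i : Fin n) (Ω : Set ℂ) : Prop :=
  (∃ z ∈ C.region i, Ω = connectedComponentIn (C.region i) z) ∧
  ∃ a b : C.End, a.1 ≠ b.1 ∧ C.IsInteriorEnd a ∧ C.endPt a = C.endPt b ∧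
    C.IsBoundaryEnd (C.opp a) ∧ C.IsBoundaryEnd (C.opp b) ∧
    ∃ α β : ℝ, α < β ∧ β < α + 2 * Real.pi ∧
      C.endPt (C.opp a) = Complex.exp (α * Complex.I) ∧
      C.endPt (C.opp b) = Complex.exp (β * Complex.I) ∧
      (∀ θ ∈ Set.Ioo α β, Complex.exp (θ * Complex.I) ∉ C.verts) ∧
      frontier Ω = C.edge a.1 ∪ C.edge b.1 ∪
        (fun θ : ℝ => Complex.exp (θ * Complex.I)) '' Set.Icc α β

/-- The regions adjacent, along a curve of the graph, to the component `Ω` of the region `i`. -/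
def neighbours (i : Fin n) (Ω : Set ℂ) : Set (Fin n) :=
  {j | j ≠ i ∧ ∃ e, C.edge e ⊆ frontier Ω ∧ (C.left e = j ∨ C.right e = j)}

end AdmissibleGraph

end

open MeasureTheory Filter Topology

/-! A boundary 3-component is enlarged at the expense of the other one. Let `u` be `1` (with respect
to the normal into the region `i`) on the two curves of the first triangle, `-1` on those of the
second, and `0` elsewhere. It is admissible, because at each of the two triple points the region `i`
lies to the left of one outgoing curve and to the right of the other. Two facts remain to be shown:
`u` has mean zero, and `Q(u,u) < 0`.

Stationarity provides the geometry. Deformations `φ V`, with `V` constant or the rotation field, and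
Lagrange multipliers for the areas give pressures (`exists_pressures`). Concentrating `φ` at a
vertex yields angles of 120 degrees inside the disk and orthogonality to the unit circle
(`sum_tangent_eq_zero`, `inner_tangent_eq_zero`). Concentrating it at a point of a curve shows that
the curvature is a difference of pressures (`leftCurv_eq_pressure_sub`), so that it is constant, and
equal on all curves separating the same two regions (`curvTo_congr`).

Mean zero: a curve of constant curvature meeting the unit circle orthogonally satisfies `κ (1 -
|γ|²) = 2 ⟨γ, N⟩` (`curv_mul_one_sub_sq`). At the triple point `p` of a triangle this relation, for
both sides, determines `|p|` and the angles of `p` with the sides from the two curvatures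
(`initial_eq`), hence also the lengths of the sides (`len_eq_of_same_initial`). Triangles adjacent
to the same regions therefore have equal sides, and the changes of area cancel.

Sign: with `α`, `β` the curvatures of the sides with respect to the normal into `i`, each triangle
contributes `-(α² ℓ_a + β² ℓ_b + (α + β)/√3 + 2)` to the index form (`index_eq`); the curvature of
the third curve at `p` cancels. The bracket is positive by the same relation at `p` and the bound `ℓ
≥ 1 - |p|` (`energy_pos`). The two supports are disjoint since different components share no curve,
so the contributions add up. -/

/-! ### Linear algebra and calculus for deformations of the plane. -/

theorem ContinuousLinearMap.det_complex (f : ℂ →L[ℝ] ℂ) :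
    f.det = (f 1).re * (f Complex.I).im - (f 1).im * (f Complex.I).re := by
  rw [ContinuousLinearMap.det, ← LinearMap.det_toMatrix Complex.basisOneI, Matrix.det_fin_two]
  simp [LinearMap.toMatrix_apply]
  ring

theorem ContinuousLinearMap.apply_complex (L : ℂ →L[ℝ] ℝ) (v : ℂ) :
    L v = v.re * L 1 + v.im * L Complex.I := by
  conv_lhs => rw [← Complex.re_add_im v]
  have h1 : (v.re : ℂ) = v.re • (1 : ℂ) := by simp
  have h2 : (v.im : ℂ) * Complex.I = v.im • Complex.I := by simp
  rw [map_add, h1, h2, map_smul, map_smul, smul_eq_mul, smul_eq_mul]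

/-- The Jacobian of a rank one perturbation of the identity, up to a rotation. -/
theorem abs_det_rotation_rank_one (c : ℂ) (hc : ‖c‖ = 1) (t : ℝ) (L : ℂ →L[ℝ] ℝ) (v : ℂ) :
    |(c • (ContinuousLinearMap.id ℝ ℂ + t • L.smulRight v)).det| = |1 + t * L v| := by
  have h : (c • (ContinuousLinearMap.id ℝ ℂ + t • L.smulRight v)).det
      = (c.re ^ 2 + c.im ^ 2) * (1 + t * L v) := by
    rw [ContinuousLinearMap.det_complex, L.apply_complex v]
    simp
    ring
  have hc' : c.re ^ 2 + c.im ^ 2 = 1 := by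
    have := Complex.normSq_eq_norm_sq c
    rw [hc, Complex.normSq_apply] at this
    nlinarith
  rw [h, hc', one_mul]

/-- Makes the deformations bijective for small times: a perturbation of the identity with Lipschitz
constant below `1` is injective by the triangle inequality and surjective by the quantitative
inverse function theorem. -/
theorem bijective_of_lipschitz_sub_id (f : ℂ → ℂ) (K : NNReal) (hK : K < 1)
    (hf : ∀ x y, ‖(f x - x) - (f y - y)‖ ≤ K * ‖x - y‖) : Function.Bijective f := by
  have h : ApproximatesLinearOn f ((ContinuousLinearEquiv.refl ℝ ℂ : ℂ ≃L[ℝ] ℂ) : ℂ →L[ℝ] ℂ)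
      Set.univ K := by
    intro x _ y _
    have := hf x y
    simp only [ContinuousLinearEquiv.coe_refl, ContinuousLinearMap.coe_id', id]
    rwa [show f x - f y - (x - y) = f x - x - (f y - y) by ring]
  have hK' : K < ‖((ContinuousLinearEquiv.refl ℝ ℂ).symm : ℂ →L[ℝ] ℂ)‖₊⁻¹ := by
    simpa using hK
  refine ⟨?_, h.surjective (Or.inr hK')⟩
  intro x y hxy
  have := hf x y
  rw [hxy] at this
  by_contra hne
  have h1 : 0 < ‖x - y‖ := norm_pos_iff.2 (sub_ne_zero.2 hne)
  have h2 : ‖(f y - x) - (f y - y)‖ = ‖x - y‖ := by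
    rw [← norm_neg]; congr 1; ring
  rw [h2] at this
  have h3 : (K : ℝ) < 1 := by exact_mod_cast hK
  nlinarith

theorem hasDerivAt_norm_add_smul (T w : ℂ) (hT : ‖T‖ = 1) :
    HasDerivAt (fun t : ℝ => ‖T + t • w‖) (inner ℝ T w) 0 := by
  have h1 : HasDerivAt (fun t : ℝ => T + t • w) w 0 := by
    simpa using ((hasDerivAt_id (0 : ℝ)).smul_const w).const_add T
  have h2 := h1.norm_sq
  have h3 := h2.sqrt (by simp [hT])
  simp only [Real.sqrt_sq (norm_nonneg _)] at h3
  convert h3 using 1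
  simp [hT]

theorem hasDerivAt_integral_norm_add_smul {l : ℝ} (hl : 0 ≤ l) {T w : ℝ → ℂ} (hT : Continuous T)
    (hw : Continuous w) (h1 : ∀ s ∈ Set.Icc 0 l, ‖T s‖ = 1) :
    HasDerivAt (fun t : ℝ => ∫ s in (0 : ℝ)..l, ‖T s + t • w s‖)
      (∫ s in (0 : ℝ)..l, inner ℝ (T s) (w s)) 0 := by
  refine (intervalIntegral.hasDerivAt_integral_of_dominated_loc_of_lip (s := Set.univ)
    (bound := fun s => ‖w s‖) (F := fun t s => ‖T s + t • w s‖) Filter.univ_mem ?_ ?_ ?_ ?_ ?_ ?_).2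
  · refine Filter.Eventually.of_forall fun t => Continuous.aestronglyMeasurable ?_
    fun_prop
  · apply Continuous.intervalIntegrable
    fun_prop
  · apply Continuous.aestronglyMeasurable
    fun_prop
  · refine Filter.Eventually.of_forall fun s _ => ?_
    rw [lipschitzOnWith_univ]
    refine LipschitzWith.of_dist_le_mul fun a b => ?_
    rw [Real.dist_eq, Real.dist_eq]
    simp only [Real.coe_nnabs, abs_norm]
    refine (abs_norm_sub_norm_le _ _).trans ?_
    rw [add_sub_add_left_eq_sub, ← sub_smul, norm_smul, Real.norm_eq_abs, mul_comm]
  · apply Continuous.intervalIntegrable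
    fun_prop
  · refine Filter.Eventually.of_forall fun s hs => ?_
    rw [Set.uIoc_of_le hl] at hs
    exact hasDerivAt_norm_add_smul _ _ (h1 s ⟨hs.1.le, hs.2⟩)

/-- A functional vanishing on the common kernel of finitely many functionals lies in their span. The
constraints need not be independent, and the multipliers need not be unique. -/
theorem exists_lagrange_multipliers {n : ℕ} {E : Type*} [AddCommGroup E] [Module ℝ E]
    (L : E →ₗ[ℝ] ℝ) (A : Fin n → E →ₗ[ℝ] ℝ) (h : ∀ x, (∀ i, A i x = 0) → L x = 0) :
    ∃ p : Fin n → ℝ, ∀ x, L x = ∑ i, p i * A i x := by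
  have hm : L ∈ Submodule.span ℝ (Set.range A) := by
    apply mem_span_of_iInf_ker_le_ker
    intro x hx
    simp only [Submodule.mem_iInf, LinearMap.mem_ker] at hx ⊢
    exact h x hx
  obtain ⟨p, hp⟩ := (Submodule.mem_span_range_iff_exists_fun ℝ).1 hm
  refine ⟨p, fun x => ?_⟩
  rw [← hp]
  simp

/-- Smooth functions with compact support in `U`. -/
def testFunctions (U : Set ℂ) : Submodule ℝ (ℂ → ℝ) where
  carrier := {φ | ContDiff ℝ ∞ φ ∧ HasCompactSupport φ ∧ tsupport φ ⊆ U}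
  add_mem' := by
    rintro f g ⟨hf, hf', hf''⟩ ⟨hg, hg', hg''⟩
    exact ⟨hf.add hg, hf'.add hg', (tsupport_add f g).trans (Set.union_subset hf'' hg'')⟩
  zero_mem' := ⟨contDiff_const, HasCompactSupport.zero, by simp [tsupport]⟩
  smul_mem' := by
    rintro c f ⟨hf, hf', hf''⟩
    refine ⟨contDiff_const.smul hf, hf'.smul_left (f := fun _ => c), ?_⟩
    exact (closure_mono (Function.support_const_smul_subset c f)).trans hf''

/-! ### First variation and pressures. -/

namespace AdmissibleGraph

variable {n : ℕ} (C : AdmissibleGraph n)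

/-- First variation of length along the vector field `φ V`, the tangential component of the
derivative of `V` along the curves being zero. -/
noncomputable def lengthVar (V : ℂ → ℂ) (φ : ℂ → ℝ) : ℝ :=
  ∑ e, ∫ s in (0 : ℝ)..(C.len e), deriv (fun s => φ (C.γ e s)) s *
    inner ℝ (deriv (C.γ e) s) (V (C.γ e s))

/-- First variation of the area of a region along the vector field `φ V`, with `V` divergence
free. -/
noncomputable def areaVar (V : ℂ → ℂ) (φ : ℂ → ℝ) (i : Fin n) : ℝ :=
  ∫ z in C.region i, fderiv ℝ φ z (V z)

theorem region_subset (i : Fin n) : C.region i ⊆ Metric.ball 0 1 \ C.carrier := by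
  rw [← C.region_union]; exact Set.subset_iUnion _ i

theorem volume_region_ne_top (i : Fin n) : volume (C.region i) ≠ ⊤ :=
  ((measure_mono ((C.region_subset i).trans Set.sdiff_subset)).trans_lt
    measure_ball_lt_top).ne

theorem continuous_deriv_γ (e : Fin C.numEdges) : Continuous (deriv (C.γ e)) :=
  (C.smooth e).continuous_deriv (by simp)

theorem hasDerivAt_γ (e : Fin C.numEdges) (s : ℝ) : HasDerivAt (C.γ e) (deriv (C.γ e) s) s :=
  ((C.smooth e).differentiable (by simp) s).hasDerivAt

theorem continuous_γ (e : Fin C.numEdges) : Continuous (C.γ e) := (C.smooth e).continuous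

theorem deriv_comp_γ {φ : ℂ → ℝ} (hφ : ContDiff ℝ ∞ φ) (e : Fin C.numEdges) (s : ℝ) :
    deriv (fun s => φ (C.γ e s)) s = fderiv ℝ φ (C.γ e s) (deriv (C.γ e) s) :=
  (((hφ.differentiable (by simp) _).hasFDerivAt).comp_hasDerivAt s (C.hasDerivAt_γ e s)).deriv

theorem continuous_deriv_comp_γ {φ : ℂ → ℝ} (hφ : ContDiff ℝ ∞ φ) (e : Fin C.numEdges) :
    Continuous (deriv fun s => φ (C.γ e s)) :=
  (hφ.comp (C.smooth e)).continuous_deriv (by simp)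

theorem differentiableAt_comp_γ {φ : ℂ → ℝ} (hφ : ContDiff ℝ ∞ φ) (e : Fin C.numEdges) (s : ℝ) :
    DifferentiableAt ℝ (fun s => φ (C.γ e s)) s :=
  (hφ.comp (C.smooth e)).differentiable (by simp) s

theorem continuous_fderiv_apply {φ : ℂ → ℝ} (hφ : ContDiff ℝ ∞ φ) {V : ℂ → ℂ}
    (hV : Continuous V) : Continuous fun z => fderiv ℝ φ z (V z) :=
  (hφ.continuous_fderiv (by simp)).clm_apply hV

theorem integrable_fderiv_apply {φ : ℂ → ℝ} (hφ : ContDiff ℝ ∞ φ) (hc : HasCompactSupport φ)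
    {V : ℂ → ℂ} (hV : Continuous V) : Integrable fun z => fderiv ℝ φ z (V z) := by
  refine (continuous_fderiv_apply hφ hV).integrable_of_hasCompactSupport ?_
  refine (hc.fderiv ℝ).mono ?_
  intro z hz h
  apply hz
  simp [h]

/-- `Ψ t` stands for following the flow of `V` during the time `t φ(z)`, where this flow consists of
isometries. Its differential is then a rotation `c` composed with a rank one perturbation of the
identity, whose Jacobian `1 + t dφ(V)` is affine in `t`. Hence areas change by exactly `t` times
`areaVar`: preservation to first order is already preservation, and no correction of the variation
is needed. -/
theorem lengthVar_eq_zero (hC : C.IsStationary) {φ : ℂ → ℝ} {V : ℂ → ℂ} {Ψ : ℝ → ℂ → ℂ}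
    (hφ : ContDiff ℝ ∞ φ) (hφc : HasCompactSupport φ) (hV : Continuous V)
    (hΨ : ContDiff ℝ ∞ (fun p : ℝ × ℂ => Ψ p.1 p.2)) (h0 : ∀ z, Ψ 0 z = z)
    (hd : ∀ (t : ℝ) (z : ℂ), ∃ c : ℂ, ‖c‖ = 1 ∧ HasFDerivAt (Ψ t)
      (c • (ContinuousLinearMap.id ℝ ℂ + t • (fderiv ℝ φ z).smulRight (V z))) z)
    (hlip : ∃ K : NNReal, ∀ (t : ℝ) (x y : ℂ), |t| ≤ 1 →
      ‖(Ψ t x - x) - (Ψ t y - y)‖ ≤ K * |t| * ‖x - y‖)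
    (hdisk : ∀ t, Function.Injective (Ψ t) → ∀ z, ‖Ψ t z‖ ≤ 1 ↔ ‖z‖ ≤ 1)
    (hsph : ∀ t z, ‖z‖ = 1 → ‖Ψ t z‖ = 1)
    (hA : ∀ i, C.areaVar V φ i = 0) : C.lengthVar V φ = 0 := by
  obtain ⟨K, hK⟩ := hlip
  obtain ⟨M, hM⟩ : ∃ M, ∀ z, ‖fderiv ℝ φ z (V z)‖ ≤ M := by
    refine HasCompactSupport.exists_bound_of_continuous ?_ (continuous_fderiv_apply hφ hV)
    refine (hφc.fderiv ℝ).mono ?_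
    intro z hz h
    apply hz
    simp [h]
  have hM0 : 0 ≤ M := (norm_nonneg _).trans (hM 0)
  -- For `|t| < ε` this gives `K |t| < 1` (bijectivity), `M |t| < 1` (positive Jacobian) and `|t| ≤
  -- 1` (the range of the Lipschitz hypothesis).
  set ε : ℝ := 1 / (K + M + 1) with hε
  have hεpos : 0 < ε := by positivity
  have hsmall : ∀ t ∈ Set.Ioo (-ε) ε, K * |t| < 1 ∧ |t| * M < 1 ∧ |t| ≤ 1 := by
    intro t ht
    have h1 : |t| < ε := abs_lt.2 ht
    have h2 : |t| * (K + M + 1) < 1 := by rwa [hε, lt_div_iff₀ (by positivity)] at h1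
    have h3 : 0 ≤ |t| * K := by positivity
    have h4 : 0 ≤ |t| * M := by positivity
    have h5 : 0 ≤ |t| := by positivity
    refine ⟨by nlinarith, by nlinarith, by nlinarith⟩
  have hbij : ∀ t ∈ Set.Ioo (-ε) ε, Function.Bijective (Ψ t) := by
    intro t ht
    obtain ⟨h1, -, h3⟩ := hsmall t ht
    refine bijective_of_lipschitz_sub_id (Ψ t) (K * Real.nnabs t) ?_ ?_
    · rw [← NNReal.coe_lt_coe]; simpa using h1
    · intro x y; simpa using hK t x y h3
  let W : C.Variation :=
    { ε := ε
      ε_pos := hεpos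
      Φ := Ψ
      zero := fun z _ => h0 z
      bijOn := by
        intro t ht
        have hb := hbij t ht
        refine ⟨fun z hz => ?_, hb.1.injOn, fun z hz => ?_⟩
        · simpa using (hdisk t hb.1 z).2 (by simpa using hz)
        · obtain ⟨w, rfl⟩ := hb.2 z
          exact ⟨w, by simpa using (hdisk t hb.1 w).1 (by simpa using hz), rfl⟩
      mapsTo_boundary := by
        intro t _ z hz
        simpa using hsph t z (by simpa using hz)
      cont := hΨ.continuous.continuousOn
      smooth := by
        intro e
        have h : ContDiff ℝ ∞ (fun p : ℝ × ℝ => (p.1, C.γ e p.2)) :=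
          contDiff_fst.prodMk ((C.smooth e).comp contDiff_snd)
        exact (hΨ.comp h).contDiffOn }
  have hlen : HasDerivAt W.length (C.lengthVar V φ) 0 := by
    have h1 : W.length = fun t : ℝ => ∑ e, ∫ s in (0 : ℝ)..(C.len e),
        ‖deriv (C.γ e) s + t • (deriv (fun s => φ (C.γ e s)) s • V (C.γ e s))‖ := by
      funext t
      unfold Variation.length
      refine Finset.sum_congr rfl fun e _ => ?_
      refine intervalIntegral.integral_congr fun s _ => ?_
      obtain ⟨c, hc, hcd⟩ := hd t (C.γ e s)
      have h2 := (hcd.comp_hasDerivAt s (C.hasDerivAt_γ e s)).deriv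
      have h3 : deriv (fun s => W.Φ t (C.γ e s)) s = _ := h2
      simp only [h3]
      rw [C.deriv_comp_γ hφ, smul_apply, norm_smul, hc, one_mul]
      rfl
    rw [h1]
    unfold lengthVar
    have h4 := fun e => hasDerivAt_integral_norm_add_smul (C.len_pos e).le
      (C.continuous_deriv_γ e)
      (w := fun s => deriv (fun s => φ (C.γ e s)) s • V (C.γ e s)) ((C.continuous_deriv_comp_γ hφ e).smul
        (hV.comp (C.continuous_γ e))) (C.unit_speed e)
    have h5 := HasDerivAt.fun_sum (u := Finset.univ) fun e _ => h4 e
    simpa only [inner_smul_right] using h5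
  have harea : W.AreaPreserving := by
    intro i t ht
    change volume (Ψ t '' C.region i) = _
    obtain ⟨-, hs, -⟩ := hsmall t ht
    choose c hc hcd using hd t
    rw [← lintegral_abs_det_fderiv_eq_addHaar_image volume (C.region_open i).measurableSet
      (fun z _ => (hcd z).hasFDerivWithinAt) (hbij t ht).1.injOn]
    have h1 : ∀ z, |(c z • (ContinuousLinearMap.id ℝ ℂ
        + t • (fderiv ℝ φ z).smulRight (V z))).det| = 1 + t * fderiv ℝ φ z (V z) := by
      intro z
      rw [abs_det_rotation_rank_one _ (hc z), abs_of_nonneg]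
      have h2 : |t * fderiv ℝ φ z (V z)| ≤ |t| * M := by
        rw [abs_mul]; exact mul_le_mul_of_nonneg_left (hM z) (abs_nonneg t)
      linarith [neg_abs_le (t * fderiv ℝ φ z (V z))]
    rw [lintegral_congr fun z => by rw [h1 z]]
    have hint : IntegrableOn (fun z => fderiv ℝ φ z (V z)) (C.region i) :=
      (integrable_fderiv_apply hφ hφc hV).integrableOn
    have hone : IntegrableOn (fun _ : ℂ => (1 : ℝ)) (C.region i) :=
      integrableOn_const (C.volume_region_ne_top i)
    have hadd : IntegrableOn (fun z => 1 + t * fderiv ℝ φ z (V z)) (C.region i) :=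
      hone.add (hint.const_mul t)
    rw [← ofReal_integral_eq_lintegral_ofReal hadd
      (Filter.Eventually.of_forall fun z => (abs_nonneg _).trans_eq (h1 z))]
    rw [integral_add hone (hint.const_mul t), integral_const_mul]
    have h3 := hA i
    unfold areaVar at h3
    rw [h3]
    simp [Measure.real, ENNReal.ofReal_toReal (C.volume_region_ne_top i)]
  exact hlen.unique (hC W harea)

/-- The multipliers are the pressures of the regions; at this stage they may depend on `V`. -/
theorem exists_pressures {U : Set ℂ} {V : ℂ → ℂ} (hV : Continuous V)
    (h : ∀ φ ∈ testFunctions U, (∀ i, C.areaVar V φ i = 0) → C.lengthVar V φ = 0) :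
    ∃ p : Fin n → ℝ, ∀ φ ∈ testFunctions U, C.lengthVar V φ = ∑ i, p i * C.areaVar V φ i := by
  have hcont : ∀ φ ∈ testFunctions U, ∀ e, Continuous fun s => deriv (fun s => φ (C.γ e s)) s *
      inner ℝ (deriv (C.γ e) s) (V (C.γ e s)) := by
    intro φ hφ e
    exact (C.continuous_deriv_comp_γ hφ.1 e).mul
      ((C.continuous_deriv_γ e).inner (hV.comp (C.continuous_γ e)))
  let L : testFunctions U →ₗ[ℝ] ℝ :=
    { toFun := fun φ => C.lengthVar V φ
      map_add' := by
        rintro ⟨φ, hφ⟩ ⟨ψ, hψ⟩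
        simp only [lengthVar]
        rw [← Finset.sum_add_distrib]
        refine Finset.sum_congr rfl fun e _ => ?_
        rw [← intervalIntegral.integral_add ((hcont φ hφ e).intervalIntegrable _ _)
          ((hcont ψ hψ e).intervalIntegrable _ _)]
        refine intervalIntegral.integral_congr fun s _ => ?_
        rw [← add_mul]
        congr 1
        exact deriv_add (C.differentiableAt_comp_γ hφ.1 e s) (C.differentiableAt_comp_γ hψ.1 e s)
      map_smul' := by
        rintro c ⟨φ, hφ⟩
        simp only [lengthVar, RingHom.id_apply, smul_eq_mul]
        rw [Finset.mul_sum]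
        refine Finset.sum_congr rfl fun e _ => ?_
        rw [← intervalIntegral.integral_const_mul]
        refine intervalIntegral.integral_congr fun s _ => ?_
        rw [← mul_assoc]
        congr 1
        exact deriv_const_mul c (C.differentiableAt_comp_γ hφ.1 e s) }
  let A : Fin n → testFunctions U →ₗ[ℝ] ℝ := fun i =>
    { toFun := fun φ => C.areaVar V φ i
      map_add' := by
        rintro ⟨φ, hφ⟩ ⟨ψ, hψ⟩
        simp only [areaVar]
        rw [← integral_add (integrable_fderiv_apply hφ.1 hφ.2.1 hV).integrableOn
          (integrable_fderiv_apply hψ.1 hψ.2.1 hV).integrableOn]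
        refine integral_congr_ae (Filter.Eventually.of_forall fun z => ?_)
        exact congrArg (fun L => L (V z))
          (fderiv_add (hφ.1.differentiable (by simp) z) (hψ.1.differentiable (by simp) z))
      map_smul' := by
        rintro c ⟨φ, hφ⟩
        simp only [areaVar, RingHom.id_apply, smul_eq_mul]
        rw [← integral_const_mul]
        refine integral_congr_ae (Filter.Eventually.of_forall fun z => ?_)
        exact congrArg (fun L => L (V z)) (fderiv_const_smul (hφ.1.differentiable (by simp) z) c) }
  obtain ⟨p, hp⟩ := exists_lagrange_multipliers L A fun φ hφ => h φ φ.2 hφ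
  exact ⟨p, fun φ hφ => hp ⟨φ, hφ⟩⟩


/-- Translations do not preserve the disk, whence the restriction to `φ` supported in the open disk.
-/
theorem exists_pressures_const (hC : C.IsStationary) (v : ℂ) :
    ∃ p : Fin n → ℝ, ∀ φ ∈ testFunctions (Metric.ball 0 1),
      C.lengthVar (fun _ => v) φ = ∑ i, p i * C.areaVar (fun _ => v) φ i := by
  refine C.exists_pressures continuous_const fun φ hφ hA => ?_
  obtain ⟨hs, hc, hsupp⟩ := hφ
  have hout : ∀ z : ℂ, 1 ≤ ‖z‖ → φ z = 0 := by
    intro z hz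
    apply image_eq_zero_of_notMem_tsupport
    intro h
    have := hsupp h
    rw [mem_ball_zero_iff] at this
    linarith
  refine C.lengthVar_eq_zero hC (Ψ := fun t z => z + (t * φ z) • v) hs hc continuous_const
    ?_ ?_ ?_ ?_ ?_ ?_ hA
  · have : ContDiff ℝ ∞ fun p : ℝ × ℂ => φ p.2 := hs.comp contDiff_snd
    fun_prop
  · intro z; simp
  · intro t z
    refine ⟨1, by simp, ?_⟩
    have h1 := ((hs.differentiable (by simp) z).hasFDerivAt.const_mul t).smul_const v
    refine ((hasFDerivAt_id z).fun_add h1).congr_fderiv ?_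
    ext w
    simp [mul_assoc]
  · have h1 : ContDiff ℝ ∞ fun z => φ z • v := hs.smul contDiff_const
    obtain ⟨K, hK⟩ := ContDiff.lipschitzWith_of_hasCompactSupport
      (hc.smul_right (f' := fun _ => v)) h1 (by simp)
    refine ⟨K, fun t x y _ => ?_⟩
    have h2 := hK.dist_le_mul x y
    rw [dist_eq_norm, dist_eq_norm] at h2
    have h3 : x + (t * φ x) • v - x - (y + (t * φ y) • v - y) = t • (φ x • v - φ y • v) := by
      simp only [smul_sub, smul_smul]; ring
    rw [h3, norm_smul, Real.norm_eq_abs]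
    calc |t| * ‖φ x • v - φ y • v‖ ≤ |t| * (K * ‖x - y‖) :=
          mul_le_mul_of_nonneg_left h2 (abs_nonneg t)
      _ = K * |t| * ‖x - y‖ := by ring
  · intro t hinj z
    have hfix : ∀ z : ℂ, 1 ≤ ‖z‖ → z + (t * φ z) • v = z := by
      intro z hz; simp [hout z hz]
    rcases le_or_gt 1 ‖z‖ with hz | hz
    · simp only [hfix z hz]
    -- Points off the open disk are fixed; a point of the open disk leaving the closed disk would
    -- have the same image as the fixed point that it reaches.
    · refine ⟨fun _ => hz.le, fun _ => ?_⟩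
      by_contra! hgt
      have h1 : z + (t * φ z) • v = z := hinj (hfix _ hgt.le)
      simp only [h1] at hgt
      linarith
  · intro t z hz
    simp [hout z hz.ge, hz]

/-- Turning `z` by the angle `t φ(z)` preserves every circle about `0`, so `φ` is free on the unit
circle. This is the deformation that reaches the boundary vertices. -/
theorem exists_pressures_rotation (hC : C.IsStationary) :
    ∃ p : Fin n → ℝ, ∀ φ ∈ testFunctions Set.univ,
      C.lengthVar (fun z => Complex.I * z) φ =
        ∑ i, p i * C.areaVar (fun z => Complex.I * z) φ i := by
  have hV : Continuous fun z : ℂ => Complex.I * z := by fun_prop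
  refine C.exists_pressures hV fun φ hφ hA => ?_
  obtain ⟨hs, hc, -⟩ := hφ
  have hnorm : ∀ (t : ℝ) (z : ℂ), ‖Complex.exp (Complex.I * ((t * φ z : ℝ) : ℂ))‖ = 1 := by
    intro t z
    rw [mul_comm, Complex.norm_exp_ofReal_mul_I]
  have hd : ∀ (t : ℝ) (z : ℂ),
      HasFDerivAt (fun z : ℂ => Complex.exp (Complex.I * ((t * φ z : ℝ) : ℂ)) * z)
      (Complex.exp (Complex.I * ((t * φ z : ℝ) : ℂ)) • (ContinuousLinearMap.id ℝ ℂ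
        + t • (fderiv ℝ φ z).smulRight (Complex.I * z))) z := by
    intro t z
    have h1 := (hs.differentiable (by simp) z).hasFDerivAt.const_mul t
    have h2 : HasFDerivAt (fun z : ℂ => ((t * φ z : ℝ) : ℂ))
        (Complex.ofRealCLM.comp (t • fderiv ℝ φ z)) z := Complex.ofRealCLM.hasFDerivAt.comp z h1
    have h3 := ((h2.const_mul Complex.I).cexp).mul (hasFDerivAt_id z)
    refine h3.congr_fderiv ?_
    ext w
    simp only [ContinuousLinearMap.comp_apply, smul_apply, add_apply,
      ContinuousLinearMap.smulRight_apply, ContinuousLinearMap.id_apply, Complex.ofRealCLM_apply, smul_eq_mul, Complex.real_smul, Complex.ofReal_mul, id]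
    ring
  refine C.lengthVar_eq_zero hC
    (Ψ := fun t z => Complex.exp (Complex.I * ((t * φ z : ℝ) : ℂ)) * z) hs hc hV
    ?_ ?_ ?_ ?_ ?_ ?_ hA
  · have h1 : ContDiff ℝ ∞ fun p : ℝ × ℂ => p.1 * φ p.2 :=
      contDiff_fst.mul (hs.comp contDiff_snd)
    have h2 : ContDiff ℝ ∞ fun p : ℝ × ℂ => ((p.1 * φ p.2 : ℝ) : ℂ) :=
      Complex.ofRealCLM.contDiff.comp h1
    exact (contDiff_const.mul h2).cexp.mul contDiff_snd
  · intro z; simp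
  · exact fun t z => ⟨_, hnorm t z, hd t z⟩
  · obtain ⟨M₁, hM₁⟩ := hc.exists_bound_of_continuous hs.continuous
    obtain ⟨M₂, hM₂⟩ : ∃ M, ∀ z : ℂ, ‖‖z‖ • fderiv ℝ φ z‖ ≤ M := by
      refine HasCompactSupport.exists_bound_of_continuous ?_
        (continuous_norm.smul (hs.continuous_fderiv (by simp)))
      exact (hc.fderiv ℝ).smul_left (f := fun z : ℂ => ‖z‖)
    have hM₁' : 0 ≤ M₁ := (norm_nonneg _).trans (hM₁ 0)
    have hM₂' : 0 ≤ M₂ := (norm_nonneg _).trans (hM₂ 0)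
    refine ⟨⟨M₁ + M₂, by positivity⟩, fun t x y _ => ?_⟩
    refine Convex.norm_image_sub_le_of_norm_hasFDerivWithin_le (s := Set.univ)
      (f := fun z => Complex.exp (Complex.I * ((t * φ z : ℝ) : ℂ)) * z - z)
      (fun z _ => ((hd t z).sub (hasFDerivAt_id z)).hasFDerivWithinAt) ?_ convex_univ
      (Set.mem_univ y) (Set.mem_univ x)
    intro z _
    set c := Complex.exp (Complex.I * ((t * φ z : ℝ) : ℂ)) with hcdef
    have h1 : c • (ContinuousLinearMap.id ℝ ℂ + t • (fderiv ℝ φ z).smulRight (Complex.I * z))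
        - ContinuousLinearMap.id ℝ ℂ = (c - 1) • ContinuousLinearMap.id ℝ ℂ
        + c • (t • (fderiv ℝ φ z).smulRight (Complex.I * z)) := by
      ext w
      simp only [sub_apply, smul_apply,
        add_apply, ContinuousLinearMap.id_apply, smul_eq_mul]
      ring
    rw [h1]
    refine (norm_add_le _ _).trans ?_
    have h2 : ‖c - 1‖ ≤ |t| * M₁ := by
      refine Real.norm_exp_I_mul_ofReal_sub_one_le.trans ?_
      rw [norm_mul]
      exact mul_le_mul_of_nonneg_left (hM₁ z) (abs_nonneg t)
    have h3 : ‖(c - 1) • ContinuousLinearMap.id ℝ ℂ‖ ≤ |t| * M₁ := by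
      rw [norm_smul, ContinuousLinearMap.norm_id, mul_one]; exact h2
    have h4 : ‖c • (t • (fderiv ℝ φ z).smulRight (Complex.I * z))‖ ≤ |t| * M₂ := by
      rw [norm_smul, hnorm, one_mul, norm_smul, ContinuousLinearMap.norm_smulRight_apply,
        norm_mul, Complex.norm_I, one_mul]
      have := hM₂ z
      rw [norm_smul, norm_norm] at this
      rw [mul_comm ‖fderiv ℝ φ z‖]
      exact mul_le_mul_of_nonneg_left this (abs_nonneg t)
    change _ ≤ (M₁ + M₂) * |t|
    linarith
  · intro t _ z
    simp only [norm_mul, hnorm, one_mul]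
  · intro t z hz
    simp only [norm_mul, hnorm, one_mul, hz]

end AdmissibleGraph

/-! ### Balance of the tangents at the vertices. -/

/-- Rescalings of one bump. The gradient grows like `1 / r`, while the area of the support is of
order `r²`. -/
theorem exists_bump_family (q : ℂ) : ∃ (ψ : ℝ → ℂ → ℝ) (M : ℝ), 0 ≤ M ∧ ∀ r > 0,
    ContDiff ℝ ∞ (ψ r) ∧ HasCompactSupport (ψ r) ∧ tsupport (ψ r) ⊆ Metric.closedBall q r ∧
    ψ r q = 1 ∧ (∀ z, 0 ≤ ψ r z) ∧ (∀ z, |ψ r z| ≤ 1) ∧ ∀ z, ‖fderiv ℝ (ψ r) z‖ ≤ M / r := by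
  let χ : ContDiffBump (0 : ℂ) := ⟨1 / 2, 1, by norm_num, by norm_num⟩
  have hχ : ContDiff ℝ ∞ χ := χ.contDiff
  obtain ⟨M, hM⟩ := (χ.hasCompactSupport.fderiv ℝ).exists_bound_of_continuous
    (hχ.continuous_fderiv (by simp))
  refine ⟨fun r z => χ (r⁻¹ • (z - q)), M, (norm_nonneg _).trans (hM 0), fun r hr => ?_⟩
  have hsupp : tsupport (fun z => χ (r⁻¹ • (z - q))) ⊆ Metric.closedBall q r := by
    refine closure_minimal ?_ Metric.isClosed_closedBall
    intro z hz
    have h1 : r⁻¹ • (z - q) ∈ Function.support χ := hz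
    rw [χ.support_eq, mem_ball_zero_iff, norm_smul, norm_inv, Real.norm_eq_abs, abs_of_pos hr,
      inv_mul_lt_iff₀ hr, mul_one] at h1
    rw [mem_closedBall_iff_norm]
    exact h1.le
  refine ⟨hχ.comp (by fun_prop : ContDiff ℝ ∞ fun z : ℂ => r⁻¹ • (z - q)),
    HasCompactSupport.of_support_subset_isCompact (isCompact_closedBall q r)
      ((subset_tsupport _).trans hsupp), hsupp, ?_, fun z => χ.nonneg, fun z => ?_, fun z => ?_⟩
  · simp only [sub_self, smul_zero]
    exact χ.one_of_mem_closedBall (by simp [χ.rIn_pos.le])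
  · rw [abs_of_nonneg χ.nonneg]; exact χ.le_one
  · have h1 : HasFDerivAt (fun z : ℂ => r⁻¹ • (z - q)) (r⁻¹ • ContinuousLinearMap.id ℝ ℂ) z :=
      ((hasFDerivAt_id z).sub_const q).const_smul r⁻¹
    have h2 := ((hχ.differentiable (by simp) (r⁻¹ • (z - q))).hasFDerivAt.comp z h1).fderiv
    have h3 : fderiv ℝ (fun z => χ (r⁻¹ • (z - q))) z = _ := h2
    rw [h3, ContinuousLinearMap.comp_smul, norm_smul, ContinuousLinearMap.comp_id, norm_inv,
      Real.norm_eq_abs, abs_of_pos hr, div_eq_inv_mul]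
    exact mul_le_mul_of_nonneg_left (hM _) (by positivity)

namespace AdmissibleGraph

variable {n : ℕ} (C : AdmissibleGraph n)

/-- The unit tangent vector at an end of a curve, pointing along the curve. -/
noncomputable def tangent (a : C.End) : ℂ := C.endSign a • deriv (C.γ a.1) (C.param a)

theorem contDiff_deriv_γ (e : Fin C.numEdges) : ContDiff ℝ ∞ (deriv (C.γ e)) :=
  (C.smooth e).deriv' 

-- The bumps `ψ r` at `q` are used as `φ` and `r` tends to `0`. The area terms are `O(r)`, and
-- integration by parts reduces the length term to the values at the curve ends lying at `q`.
open Classical in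
theorem sum_inner_tangent_eq_zero {V : ℂ → ℂ} (hV : ContDiff ℝ ∞ V) {U : Set ℂ} (hU : IsOpen U)
    {p : Fin n → ℝ}
    (hp : ∀ φ ∈ testFunctions U, C.lengthVar V φ = ∑ i, p i * C.areaVar V φ i)
    {q : ℂ} (hq : q ∈ C.verts) (hqU : q ∈ U) :
    ∑ a : C.End, (if C.endPt a = q then inner ℝ (C.tangent a) (V q) else 0) = 0 := by
  obtain ⟨ψ, M, hM, hψ⟩ := exists_bump_family q
  have hball : ∀ᶠ r in 𝓝[>] (0 : ℝ), Metric.closedBall q r ⊆ U := by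
    obtain ⟨ε, hε, hsub⟩ := Metric.isOpen_iff.1 hU q hqU
    filter_upwards [Ioo_mem_nhdsGT hε] with r hr
    exact (Metric.closedBall_subset_ball hr.2).trans hsub
  have hpos : ∀ᶠ r in 𝓝[>] (0 : ℝ), 0 < r := self_mem_nhdsWithin
  have hone : ∀ z, Tendsto (fun r => ψ r z) (𝓝[>] 0) (𝓝 (if z = q then 1 else 0)) := by
    intro z
    split_ifs with h
    · subst h
      refine tendsto_const_nhds.congr' ?_
      filter_upwards [hpos] with r hr
      exact ((hψ r hr).2.2.2.1).symm
    · refine tendsto_const_nhds.congr' ?_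
      filter_upwards [hpos, Ioo_mem_nhdsGT (dist_pos.2 h)] with r hr hr'
      refine (image_eq_zero_of_notMem_tsupport fun hz => ?_).symm
      have := (hψ r hr).2.2.1 hz
      rw [Metric.mem_closedBall] at this
      exact absurd hr'.2 (not_lt.2 this)
  have harea : ∀ i, Tendsto (fun r => C.areaVar V (ψ r) i) (𝓝[>] 0) (𝓝 0) := by
    intro i
    obtain ⟨B, hB⟩ := (isCompact_closedBall q 1).exists_bound_of_continuousOn
      hV.continuous.continuousOn
    have hB0 : 0 ≤ B := (norm_nonneg _).trans (hB q (by simp))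
    have hlim : Tendsto (fun r : ℝ => M * B * Real.pi * r) (𝓝[>] 0) (𝓝 0) := by
      have : Tendsto (fun r : ℝ => M * B * Real.pi * r) (𝓝 0) (𝓝 (M * B * Real.pi * 0)) :=
        (continuous_const.mul continuous_id).tendsto 0
      rw [mul_zero] at this
      exact this.mono_left nhdsWithin_le_nhds
    refine squeeze_zero_norm' ?_ hlim
    filter_upwards [hpos, Ioo_mem_nhdsGT one_pos] with r hr hr1
    obtain ⟨-, -, h3, -, -, -, h7⟩ := hψ r hr
    have hzero : ∀ z ∉ Metric.closedBall q r, fderiv ℝ (ψ r) z (V z) = 0 := by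
      intro z hz
      have : z ∉ Function.support (fderiv ℝ (ψ r)) :=
        fun h => hz (h3 (support_fderiv_subset ℝ h))
      rw [Function.notMem_support] at this
      simp [this]
    unfold areaVar
    rw [setIntegral_eq_of_subset_of_forall_sdiff_eq_zero
      (s := C.region i ∩ Metric.closedBall q r) (t := C.region i) (C.region_open i).measurableSet
      Set.inter_subset_left (fun z hz => hzero z fun h => hz.2 ⟨hz.1, h⟩)]
    have hfin : volume (C.region i ∩ Metric.closedBall q r) < ⊤ :=
      (measure_mono Set.inter_subset_right).trans_lt measure_closedBall_lt_top
    refine (norm_setIntegral_le_of_norm_le_const (C := M / r * B) hfin ?_).trans ?_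
    · intro z hz
      refine (ContinuousLinearMap.le_opNorm _ _).trans ?_
      exact mul_le_mul (h7 z) (hB z (Metric.closedBall_subset_closedBall hr1.2.le hz.2))
        (norm_nonneg _) (by positivity)
    · have hvol : volume.real (C.region i ∩ Metric.closedBall q r) ≤ r ^ 2 * Real.pi := by
        refine (measureReal_mono Set.inter_subset_right measure_closedBall_lt_top.ne).trans ?_
        simp [Measure.real, Complex.volume_closedBall, ENNReal.toReal_ofReal hr.le]
      calc M / r * B * volume.real (C.region i ∩ Metric.closedBall q r)
          ≤ M / r * B * (r ^ 2 * Real.pi) := by gcongr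
        _ = M * B * Real.pi * r := by field_simp
  have hlen : Tendsto (fun r => C.lengthVar V (ψ r)) (𝓝[>] 0)
      (𝓝 (∑ e, ((if C.γ e (C.len e) = q then 1 else 0) *
          inner ℝ (deriv (C.γ e) (C.len e)) (V (C.γ e (C.len e)))
        - (if C.γ e 0 = q then 1 else 0) * inner ℝ (deriv (C.γ e) 0) (V (C.γ e 0)) - 0))) := by
    unfold lengthVar
    refine tendsto_finsetSum _ fun e _ => ?_
    set g : ℝ → ℝ := fun s => inner ℝ (deriv (C.γ e) s) (V (C.γ e s)) with hg
    have hgs : ContDiff ℝ ∞ g := (C.contDiff_deriv_γ e).inner ℝ (hV.comp (C.smooth e))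
    have hgd : ∀ s, HasDerivAt g (deriv g s) s :=
      fun s => (hgs.differentiable (by simp) s).hasDerivAt
    have hgc : Continuous (deriv g) := hgs.continuous_deriv (by simp)
    -- The curves meet the vertex `q` only at their ends, so `ψ r` tends to `0` almost everywhere
    -- along them.
    have hint : Tendsto (fun r => ∫ s in (0 : ℝ)..(C.len e), ψ r (C.γ e s) * deriv g s) (𝓝[>] 0)
        (𝓝 (∫ s in (0 : ℝ)..(C.len e), (0 : ℝ))) := by
      refine intervalIntegral.tendsto_integral_filter_of_dominated_convergence
        (fun s => |deriv g s|) ?_ ?_ (hgc.abs.intervalIntegrable _ _) ?_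
      · filter_upwards [hpos] with r hr
        exact (((hψ r hr).1.continuous.comp (C.continuous_γ e)).mul hgc).aestronglyMeasurable
      · filter_upwards [hpos] with r hr
        refine Eventually.of_forall fun s _ => ?_
        rw [norm_mul, Real.norm_eq_abs, Real.norm_eq_abs]
        have := (hψ r hr).2.2.2.2.2.1 (C.γ e s)
        nlinarith [abs_nonneg (deriv g s)]
      · have hae : ∀ᵐ s : ℝ, s ≠ C.len e := by simp [ae_iff]
        filter_upwards [hae] with s hs hs'
        rw [Set.uIoc_of_le (C.len_pos e).le] at hs'
        have hne : C.γ e s ≠ q := fun h =>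
          C.interior_not_vert e s ⟨hs'.1, lt_of_le_of_ne hs'.2 hs⟩ (h ▸ hq)
        have := (hone (C.γ e s)).mul_const (deriv g s)
        rwa [if_neg hne, zero_mul] at this
    rw [intervalIntegral.integral_zero] at hint
    have hlim := (((hone (C.γ e (C.len e))).mul_const (g (C.len e))).sub
      ((hone (C.γ e 0)).mul_const (g 0))).sub hint
    refine hlim.congr' ?_
    filter_upwards [hpos] with r hr
    have hs := (hψ r hr).1
    have h1 := intervalIntegral.integral_mul_deriv_eq_deriv_mul (a := 0) (b := C.len e)
      (u := fun s => ψ r (C.γ e s)) (v := g)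
      (fun s _ => (C.differentiableAt_comp_γ hs e s).hasDerivAt) (fun s _ => hgd s)
      ((C.continuous_deriv_comp_γ hs e).intervalIntegrable _ _)
      (hgc.intervalIntegrable _ _)
    simp only [h1]
    ring
  have hzero : Tendsto (fun r => C.lengthVar V (ψ r)) (𝓝[>] 0) (𝓝 (∑ i, p i * 0)) := by
    refine (tendsto_finsetSum _ fun i _ => (harea i).const_mul (p i)).congr' ?_
    filter_upwards [hpos, hball] with r hr hb
    exact (hp _ ⟨(hψ r hr).1, (hψ r hr).2.1, (hψ r hr).2.2.1.trans hb⟩).symm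
  have heq := tendsto_nhds_unique hlen hzero
  simp only [mul_zero, Finset.sum_const_zero] at heq
  -- `tangent` points into the curve at both ends, which is the opposite of the sign in the boundary
  -- terms.
  rw [Fintype.sum_prod_type, ← neg_eq_zero, ← Finset.sum_neg_distrib]
  refine Eq.trans ?_ heq
  refine Finset.sum_congr rfl fun e _ => ?_
  rw [Fintype.sum_bool]
  simp only [CurveSystem.endPt, CurveSystem.param, tangent, endSign]
  by_cases h1 : C.γ e (C.len e) = q <;> by_cases h2 : C.γ e 0 = q <;> simp [h1, h2] <;> ring

open Classical in
theorem sum_tangent_eq_zero (hC : C.IsStationary) {q : ℂ} (hq : q ∈ C.verts) (hq1 : ‖q‖ < 1) :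
    ∑ a : C.End, (if C.endPt a = q then C.tangent a else 0) = 0 := by
  have h : ∀ v : ℂ, inner ℝ (∑ a : C.End, (if C.endPt a = q then C.tangent a else 0)) v = 0 := by
    intro v
    obtain ⟨p, hp⟩ := C.exists_pressures_const hC v
    have := C.sum_inner_tangent_eq_zero contDiff_const Metric.isOpen_ball hp hq (by simpa using hq1)
    rw [sum_inner, ← this]
    refine Finset.sum_congr rfl fun a _ => ?_
    split_ifs <;> simp
  exact inner_self_eq_zero.1 (h _)

/-- Only one curve ends at a boundary vertex, so the balance along the circle says that this curve
is orthogonal to it. -/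
theorem inner_tangent_eq_zero (hC : C.IsStationary) {a : C.End} (ha : C.IsBoundaryEnd a) :
    inner ℝ (C.tangent a) (Complex.I * C.endPt a) = 0 := by
  classical
  obtain ⟨hq, hq1⟩ := ha
  obtain ⟨p, hp⟩ := C.exists_pressures_rotation hC
  have h := C.sum_inner_tangent_eq_zero (by fun_prop) isOpen_univ hp hq (Set.mem_univ _)
  obtain ⟨b, hb⟩ := Set.ncard_eq_one.1 (C.degree_boundary _ hq hq1)
  have hab : a = b := by
    have : a ∈ ({b} : Set C.End) := hb ▸ rfl
    exact this
  subst hab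
  rw [Finset.sum_eq_single a] at h
  · simpa using h
  · intro c _ hc
    rw [if_neg]
    intro hca
    have : c ∈ ({a} : Set C.End) := hb ▸ hca
    exact hc this
  · simp


/-! ### Local structure of the graph along a curve. -/

theorem γ_len_of_not_mem (e : Fin C.numEdges) (h : C.γ e 0 ∉ C.verts) :
    C.γ e (C.len e) = C.γ e 0 := by
  rcases C.ends e with ⟨h0, -⟩ | ⟨-, h1⟩
  · exact absurd h0 h
  · simpa using h1 0

theorem γ_mem_carrier {e : Fin C.numEdges} {s : ℝ} (hs : s ∈ Set.Icc 0 (C.len e)) :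
    C.γ e s ∈ C.carrier :=
  Set.mem_iUnion.2 ⟨e, s, hs, rfl⟩

/-- Interior points of the curves are simple points of the graph. -/
theorem eq_of_γ_eq {e f : Fin C.numEdges} {s₀ s : ℝ} (hs₀ : s₀ ∈ Set.Ioo 0 (C.len e))
    (hs : s ∈ Set.Icc 0 (C.len f)) (h : C.γ f s = C.γ e s₀) : f = e ∧ s = s₀ := by
  have hv := C.interior_not_vert e s₀ hs₀
  have hfe : f = e := by
    by_contra hne
    exact hv (C.disjoint_edges f e hne _ ⟨s, hs, h⟩ ⟨s₀, ⟨hs₀.1.le, hs₀.2.le⟩, rfl⟩)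
  subst hfe
  refine ⟨rfl, ?_⟩
  rcases hs.2.lt_or_eq with hlt | heq
  · exact C.simple f ⟨hs.1, hlt⟩ ⟨hs₀.1.le, hs₀.2⟩ h
  · subst heq
    rcases C.ends f with ⟨-, h1⟩ | ⟨h0, -⟩
    · exact absurd (h ▸ h1) hv
    · rw [C.γ_len_of_not_mem f h0] at h
      have := C.simple f ⟨le_rfl, C.len_pos f⟩ ⟨hs₀.1.le, hs₀.2⟩ h
      exact absurd this hs₀.1.ne

theorem norm_γ_lt_one {e : Fin C.numEdges} {s : ℝ} (hs : s ∈ Set.Ioo 0 (C.len e)) :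
    ‖C.γ e s‖ < 1 :=
  C.inside _ (C.γ_mem_carrier ⟨hs.1.le, hs.2.le⟩) (C.interior_not_vert e s hs)

/-- Parameters of points of the graph close to `p` are close to parameters of `p`. -/
theorem exists_radius (p : ℂ) {δ : ℝ} (hδ : 0 < δ) :
    ∃ r > 0, ∀ e, ∀ s ∈ Set.Icc 0 (C.len e), dist (C.γ e s) p < r →
      ∃ s' ∈ Set.Icc 0 (C.len e), C.γ e s' = p ∧ |s - s'| < δ := by
  have h : ∀ᶠ r in 𝓝[>] (0 : ℝ), ∀ e, ∀ s ∈ Set.Icc 0 (C.len e), dist (C.γ e s) p < r →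
      ∃ s' ∈ Set.Icc 0 (C.len e), C.γ e s' = p ∧ |s - s'| < δ := by
    rw [eventually_all]
    intro e
    -- `K` consists of the parameters at distance at least `δ` from all parameters of `p`; its image
    -- is compact and misses `p`.
    set K : Set ℝ := Set.Icc 0 (C.len e) ∩
      ⋂ s' ∈ {s' | s' ∈ Set.Icc 0 (C.len e) ∧ C.γ e s' = p}, {s | δ ≤ |s - s'|} with hK
    have hKc : IsCompact K := by
      refine isCompact_Icc.inter_right (isClosed_biInter fun s' _ => ?_)
      exact isClosed_le continuous_const (by fun_prop)
    have hp : p ∉ C.γ e '' K := by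
      rintro ⟨s, ⟨hs, hs'⟩, hsp⟩
      have := Set.mem_iInter₂.1 hs' s ⟨hs, hsp⟩
      simp at this
      linarith
    have hopen : IsOpen (C.γ e '' K)ᶜ := ((hKc.image (C.continuous_γ e)).isClosed).isOpen_compl
    obtain ⟨ε, hε, hsub⟩ := Metric.isOpen_iff.1 hopen p hp
    filter_upwards [Ioo_mem_nhdsGT hε] with r hr s hs hd
    by_contra! hcon
    refine hsub (Metric.mem_ball.2 (hd.trans hr.2)) ⟨s, ⟨hs, ?_⟩, rfl⟩
    exact Set.mem_iInter₂.2 fun s' hs' => hcon s' hs'.1 hs'.2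
  obtain ⟨r, hr, hr'⟩ := (h.and self_mem_nhdsWithin).exists
  exact ⟨r, hr', hr⟩

theorem exists_radius_of_interior {e : Fin C.numEdges} {s₀ : ℝ} (hs₀ : s₀ ∈ Set.Ioo 0 (C.len e))
    {δ : ℝ} (hδ : 0 < δ) :
    ∃ r > 0, ∀ f, ∀ s ∈ Set.Icc 0 (C.len f), dist (C.γ f s) (C.γ e s₀) < r →
      f = e ∧ |s - s₀| < δ := by
  obtain ⟨r, hr, h⟩ := C.exists_radius (C.γ e s₀) hδ
  refine ⟨r, hr, fun f s hs hd => ?_⟩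
  obtain ⟨s', hs', h1, h2⟩ := h f s hs hd
  obtain ⟨rfl, rfl⟩ := C.eq_of_γ_eq hs₀ hs' h1
  exact ⟨rfl, h2⟩

theorem subset_region_of_isPreconnected {S : Set ℂ} (hS : IsPreconnected S)
    (hsub : S ⊆ Metric.ball 0 1 \ C.carrier) {i : Fin n} (hi : (S ∩ C.region i).Nonempty) :
    S ⊆ C.region i := by
  refine hS.subset_left_of_subset_union (C.region_open i)
    (isOpen_biUnion (s := {j | j ≠ i}) fun j _ => C.region_open j) ?_ ?_ hi
  · rw [Set.disjoint_iUnion₂_right]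
    exact fun j hj => C.region_disjoint i j (Ne.symm hj)
  · intro z hz
    have := hsub hz
    rw [← C.region_union] at this
    obtain ⟨j, hj⟩ := Set.mem_iUnion.1 this
    by_cases hji : j = i
    · exact Or.inl (hji ▸ hj)
    · exact Or.inr (Set.mem_biUnion hji hj)

/-- Frees the conditions on the two sides of a curve from the normal direction. The segment from `γ
+ r u` to `γ + r v` keeps a distance of order `r` from the tangent line, while nearby points of the
curve are within `o(r)` of it, so the segment misses the graph. -/
theorem eventually_mem_of_same_side {i : Fin n} {e : Fin C.numEdges} {s₀ : ℝ}
    (hs₀ : s₀ ∈ Set.Ioo 0 (C.len e)) {M u v : ℂ} (hM : inner ℝ (deriv (C.γ e) s₀) M = 0)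
    (hu : 0 < inner ℝ u M) (hv : 0 < inner ℝ v M)
    (h : ∀ᶠ r in 𝓝[>] (0 : ℝ), C.γ e s₀ + r • u ∈ C.region i) :
    ∀ᶠ r in 𝓝[>] (0 : ℝ), C.γ e s₀ + r • v ∈ C.region i := by
  set m := min (inner ℝ u M) (inner ℝ v M) with hm
  have hmpos : 0 < m := lt_min hu hv
  set B := max ‖u‖ ‖v‖ with hB
  have hB0 : 0 ≤ B := (norm_nonneg u).trans (le_max_left _ _)
  have hw : ∀ w ∈ segment ℝ u v, m ≤ inner ℝ w M ∧ ‖w‖ ≤ B := by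
    intro w hw
    have h1 : Convex ℝ {w : ℂ | m ≤ inner ℝ w M} := by
      intro x hx y hy a b ha hb hab
      simp only [Set.mem_ofPred_eq] at hx hy ⊢
      rw [inner_add_left, inner_smul_left, inner_smul_left]
      simp only [conj_trivial]
      nlinarith
    have h2 : Convex ℝ {w : ℂ | ‖w‖ ≤ B} := by
      have := convex_closedBall (0 : ℂ) B
      simpa [Metric.closedBall, dist_zero_right] using this
    exact ⟨h1.segment_subset (min_le_left (inner ℝ u M) (inner ℝ v M))
      (min_le_right (inner ℝ u M) (inner ℝ v M)) hw,
      h2.segment_subset (le_max_left ‖u‖ ‖v‖) (le_max_right ‖u‖ ‖v‖) hw⟩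
  have hT := C.unit_speed e s₀ ⟨hs₀.1.le, hs₀.2.le⟩
  -- With `ε ≤ 1 / 2`, a curve point on the segment has `|s - s₀| ≤ 2 r B`; the second bound then
  -- contradicts its height `≥ r m` over the tangent.
  obtain ⟨ε, hε, hε1, hε2⟩ : ∃ ε > 0, ε ≤ 1 / 2 ∧ 2 * ε * B * ‖M‖ < m := by
    refine ⟨min (1 / 2) (m / (4 * (B * ‖M‖ + 1))), by positivity, min_le_left _ _, ?_⟩
    have h1 := min_le_right (1 / 2) (m / (4 * (B * ‖M‖ + 1)))
    have h2 : 0 ≤ B * ‖M‖ := by positivity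
    rw [le_div_iff₀ (by positivity)] at h1
    have h3 : 0 < min (1 / 2) (m / (4 * (B * ‖M‖ + 1))) := by positivity
    nlinarith
  obtain ⟨δ, hδ, hlin⟩ := Metric.eventually_nhds_iff.1
    ((C.hasDerivAt_γ e s₀).isLittleO.def hε)
  obtain ⟨ρ, hρ, hnear⟩ := C.exists_radius_of_interior hs₀ hδ
  have hin := C.norm_γ_lt_one hs₀
  have hcont : ∀ᶠ r in 𝓝[>] (0 : ℝ), r * B < ρ ∧ r * B < 1 - ‖C.γ e s₀‖ := by
    have h1 : Tendsto (fun r : ℝ => r * B) (𝓝[>] 0) (𝓝 0) := by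
      have : Tendsto (fun r : ℝ => r * B) (𝓝 0) (𝓝 (0 * B)) :=
        (continuous_id.mul continuous_const).tendsto 0
      rw [zero_mul] at this
      exact this.mono_left nhdsWithin_le_nhds
    exact (h1.eventually_lt_const hρ).and (h1.eventually_lt_const (by linarith))
  have hpos : ∀ᶠ r in 𝓝[>] (0 : ℝ), 0 < r := self_mem_nhdsWithin
  filter_upwards [h, hcont, hpos] with r hr hrc hr0
  set S : Set ℂ := (fun w => C.γ e s₀ + r • w) '' segment ℝ u v with hS
  have hSc : IsPreconnected S :=
    (convex_segment u v).isPreconnected.image _ (by fun_prop)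
  have hSsub : S ⊆ Metric.ball 0 1 \ C.carrier := by
    rintro _ ⟨w, hwS, rfl⟩
    obtain ⟨hw1, hw2⟩ := hw w hwS
    have hnorm : ‖r • w‖ ≤ r * B := by
      rw [norm_smul, Real.norm_eq_abs, abs_of_pos hr0]
      exact mul_le_mul_of_nonneg_left hw2 hr0.le
    refine ⟨?_, fun hc => ?_⟩
    · rw [mem_ball_zero_iff]
      linarith [norm_add_le (C.γ e s₀) (r • w), hrc.2]
    · obtain ⟨f, s, hs, hsw⟩ := Set.mem_iUnion.1 hc
      simp only at hsw
      obtain ⟨rfl, hsδ⟩ := hnear f s hs (by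
        rw [hsw, dist_eq_norm, add_sub_cancel_left]; linarith [hrc.1])
      have h1 := hlin (y := s) (by rwa [Real.dist_eq])
      rw [hsw, add_sub_cancel_left, Real.norm_eq_abs] at h1
      have h2 : |s - s₀| ≤ 2 * (r * B) := by
        have h3 : ‖(s - s₀) • deriv (C.γ f) s₀‖ = |s - s₀| := by
          rw [norm_smul, hT, mul_one, Real.norm_eq_abs]
        have h4 := norm_sub_norm_le ((s - s₀) • deriv (C.γ f) s₀) (r • w)
        rw [norm_sub_rev, h3] at h4
        nlinarith [abs_nonneg (s - s₀)]
      have h5 : inner ℝ (r • w - (s - s₀) • deriv (C.γ f) s₀) M = r * inner ℝ w M := by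
        rw [inner_sub_left, inner_smul_left, inner_smul_left, hM]
        simp
      have h6 := real_inner_le_norm (r • w - (s - s₀) • deriv (C.γ f) s₀) M
      rw [h5] at h6
      have h7 : r * m ≤ ε * (2 * (r * B)) * ‖M‖ := by
        calc r * m ≤ r * inner ℝ w M := mul_le_mul_of_nonneg_left hw1 hr0.le
          _ ≤ ‖r • w - (s - s₀) • deriv (C.γ f) s₀‖ * ‖M‖ := h6
          _ ≤ ε * (2 * (r * B)) * ‖M‖ := by gcongr; exact h1.trans (by gcongr)
      nlinarith
  exact C.subset_region_of_isPreconnected hSc hSsub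
    ⟨_, ⟨u, left_mem_segment ℝ u v, rfl⟩, hr⟩ ⟨v, right_mem_segment ℝ u v, rfl⟩

theorem inner_deriv_leftNormal (e : Fin C.numEdges) (s : ℝ) :
    inner ℝ (deriv (C.γ e) s) (C.leftNormal e s) = 0 := by
  simp [CurveSystem.leftNormal, Complex.inner]
  ring

theorem norm_leftNormal {e : Fin C.numEdges} {s : ℝ} (hs : s ∈ Set.Icc 0 (C.len e)) :
    ‖C.leftNormal e s‖ = 1 := by
  simp [CurveSystem.leftNormal, C.unit_speed e s hs]

theorem eventually_mem_left {e : Fin C.numEdges} {s : ℝ} (hs : s ∈ Set.Ioo 0 (C.len e)) {v : ℂ}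
    (hv : 0 < inner ℝ v (C.leftNormal e s)) :
    ∀ᶠ r in 𝓝[>] (0 : ℝ), C.γ e s + r • v ∈ C.region (C.left e) := by
  refine C.eventually_mem_of_same_side hs (C.inner_deriv_leftNormal e s) ?_ hv (C.left_spec e s hs)
  rw [real_inner_self_eq_norm_sq, C.norm_leftNormal ⟨hs.1.le, hs.2.le⟩]
  norm_num

theorem eventually_mem_right {e : Fin C.numEdges} {s : ℝ} (hs : s ∈ Set.Ioo 0 (C.len e)) {v : ℂ}
    (hv : inner ℝ v (C.leftNormal e s) < 0) :
    ∀ᶠ r in 𝓝[>] (0 : ℝ), C.γ e s + r • v ∈ C.region (C.right e) := by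
  refine C.eventually_mem_of_same_side hs (M := -C.leftNormal e s) (u := -C.leftNormal e s)
    ?_ ?_ ?_ ?_
  · rw [inner_neg_right, C.inner_deriv_leftNormal, neg_zero]
  · rw [real_inner_self_eq_norm_sq, norm_neg, C.norm_leftNormal ⟨hs.1.le, hs.2.le⟩]
    norm_num
  · rw [inner_neg_right]; linarith
  · filter_upwards [C.right_spec e s hs] with r hr
    rwa [smul_neg, ← sub_eq_add_neg]


/-! ### Tubular coordinates and the divergence theorem near a curve. -/

/-- Coordinates near a curve: `s + τ I` is sent to `γ s + τ v`. -/
noncomputable def tube (e : Fin C.numEdges) (v : ℂ) (z : ℂ) : ℂ := C.γ e z.re + z.im • v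

noncomputable def tubeDeriv (e : Fin C.numEdges) (v : ℂ) (z : ℂ) : ℂ →L[ℝ] ℂ :=
  Complex.reCLM.smulRight (deriv (C.γ e) z.re) + Complex.imCLM.smulRight v

theorem contDiff_tube (e : Fin C.numEdges) (v : ℂ) : ContDiff ℝ ∞ (C.tube e v) :=
  ((C.smooth e).comp Complex.reCLM.contDiff).add (Complex.imCLM.contDiff.smul contDiff_const)

theorem hasFDerivAt_tube (e : Fin C.numEdges) (v z : ℂ) :
    HasFDerivAt (C.tube e v) (C.tubeDeriv e v z) z := by
  have h1 := (C.hasDerivAt_γ e z.re).hasFDerivAt.comp z Complex.reCLM.hasFDerivAt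
  have h2 := Complex.imCLM.hasFDerivAt (x := z) |>.smul_const v
  refine (h1.fun_add h2).congr_fderiv ?_
  ext w
  simp [tubeDeriv]

theorem det_tubeDeriv (e : Fin C.numEdges) (v z : ℂ) :
    (C.tubeDeriv e v z).det = inner ℝ v (C.leftNormal e z.re) := by
  rw [ContinuousLinearMap.det_complex]
  simp [tubeDeriv, CurveSystem.leftNormal, Complex.inner]
  ring

theorem continuous_leftNormal (e : Fin C.numEdges) : Continuous (C.leftNormal e) :=
  continuous_const.mul (C.continuous_deriv_γ e)

theorem map_nhds_tube {e : Fin C.numEdges} {v z : ℂ}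
    (h : inner ℝ v (C.leftNormal e z.re) ≠ 0) :
    Filter.map (C.tube e v) (𝓝 z) = 𝓝 (C.tube e v z) := by
  have hs : HasStrictFDerivAt (C.tube e v) (C.tubeDeriv e v z) z :=
    (C.contDiff_tube e v).contDiffAt.hasStrictFDerivAt' (C.hasFDerivAt_tube e v z) (by simp)
  refine hs.map_nhds_eq_of_surj ?_
  rw [LinearMap.range_eq_top]
  have hdet : IsUnit (LinearMap.det (C.tubeDeriv e v z : ℂ →ₗ[ℝ] ℂ)) := by
    rw [isUnit_iff_ne_zero]
    have := C.det_tubeDeriv e v z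
    rw [ContinuousLinearMap.det] at this
    rwa [this]
  intro w
  obtain ⟨x, hx⟩ := (LinearMap.equivOfIsUnitDet hdet).surjective w
  exact ⟨x, by simpa using hx⟩

theorem exists_tube {e : Fin C.numEdges} {s₀ : ℝ} (hs₀ : s₀ ∈ Set.Ioo 0 (C.len e)) {v : ℂ}
    (hv : 0 < inner ℝ v (C.leftNormal e s₀)) :
    ∃ δ > 0, ∃ η > (0 : ℝ), ∃ r > 0, Set.Icc (s₀ - δ) (s₀ + δ) ⊆ Set.Ioo 0 (C.len e) ∧
      (∀ s ∈ Set.Icc (s₀ - δ) (s₀ + δ), 0 < inner ℝ v (C.leftNormal e s)) ∧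
      (∀ s ∈ Set.Icc (s₀ - δ) (s₀ + δ), ∀ s' ∈ Set.Icc (s₀ - δ) (s₀ + δ), ∀ τ τ' : ℝ,
        C.γ e s + τ • v = C.γ e s' + τ' • v → s = s' ∧ τ = τ') ∧
      (∀ s ∈ Set.Ioo (s₀ - δ) (s₀ + δ), ∀ τ ∈ Set.Ioo 0 η,
        C.γ e s + τ • v ∈ C.region (C.left e)) ∧
      (∀ s ∈ Set.Ioo (s₀ - δ) (s₀ + δ), ∀ τ ∈ Set.Ioo (-η) 0,
        C.γ e s + τ • v ∈ C.region (C.right e)) ∧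
      (∀ z, dist z (C.γ e s₀) < r →
        ∃ s ∈ Set.Ioo (s₀ - δ) (s₀ + δ), ∃ τ ∈ Set.Ioo (-η) η, z = C.γ e s + τ • v) ∧
      (∀ f, ∀ s ∈ Set.Icc 0 (C.len f), dist (C.γ f s) (C.γ e s₀) < r →
        f = e ∧ s ∈ Set.Ioo (s₀ - δ) (s₀ + δ)) ∧
      Metric.ball (C.γ e s₀) r ⊆ Metric.ball 0 1 := by
  have hv0 : v ≠ 0 := by rintro rfl; simp at hv
  have hcN : Continuous fun s => inner ℝ v (C.leftNormal e s) :=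
    continuous_const.inner (C.continuous_leftNormal e)
  obtain ⟨δ₀, hδ₀, hδpos⟩ : ∃ δ₀ > 0, ∀ s, |s - s₀| < δ₀ →
      s ∈ Set.Ioo 0 (C.len e) ∧ 0 < inner ℝ v (C.leftNormal e s) := by
    have h1 : ∀ᶠ s in 𝓝 s₀, s ∈ Set.Ioo 0 (C.len e) ∧ 0 < inner ℝ v (C.leftNormal e s) :=
      Filter.Eventually.and (Ioo_mem_nhds hs₀.1 hs₀.2)
        (hcN.continuousAt.eventually (lt_mem_nhds hv))
    obtain ⟨δ, hδ, h⟩ := Metric.eventually_nhds_iff.1 h1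
    exact ⟨δ, hδ, fun s hs => h (by rwa [Real.dist_eq])⟩
  -- Projecting along `v`, that is, pairing with `I v`, forgets `τ` and is monotone in `s`; this
  -- gives injectivity for all values of `τ`.
  have hmono : StrictAntiOn (fun s => inner ℝ (Complex.I * v) (C.γ e s))
      (Metric.ball s₀ δ₀) := by
    refine strictAntiOn_of_deriv_neg (convex_ball s₀ δ₀)
      (continuous_const.inner (C.continuous_γ e)).continuousOn fun s hs => ?_
    have h1 : HasDerivAt (fun s => inner ℝ (Complex.I * v) (C.γ e s))
        (inner ℝ (Complex.I * v) (deriv (C.γ e) s)) s := by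
      simpa using (hasDerivAt_const s (Complex.I * v)).inner ℝ (C.hasDerivAt_γ e s)
    rw [h1.deriv]
    have h2 := (hδpos s (by simpa [Real.dist_eq] using interior_subset hs)).2
    have h3 : inner ℝ (Complex.I * v) (deriv (C.γ e) s) = - inner ℝ v (C.leftNormal e s) := by
      simp [CurveSystem.leftNormal, Complex.inner]
      ring
    linarith
  have hinj : ∀ s, |s - s₀| < δ₀ → ∀ s', |s' - s₀| < δ₀ → ∀ τ τ' : ℝ,
      C.γ e s + τ • v = C.γ e s' + τ' • v → s = s' ∧ τ = τ' := by
    intro s hs s' hs' τ τ' h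
    have h0 : inner ℝ (Complex.I * v) v = 0 := by
      simp [Complex.inner]; ring
    have h1 := congrArg (inner ℝ (Complex.I * v)) h
    rw [inner_add_right, inner_add_right, inner_smul_right, inner_smul_right, h0, mul_zero,
      mul_zero, add_zero, add_zero] at h1
    have h2 : s = s' := hmono.injOn (by simpa [Real.dist_eq] using hs)
      (by simpa [Real.dist_eq] using hs') h1
    subst h2
    exact ⟨rfl, smul_left_injective ℝ hv0 (add_left_cancel h)⟩
  obtain ⟨r₁, hr₁, hnear₁⟩ := C.exists_radius_of_interior hs₀ hδ₀
  have hin := C.norm_γ_lt_one hs₀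
  set r₂ := min r₁ (1 - ‖C.γ e s₀‖) with hr₂
  have hr₂pos : 0 < r₂ := lt_min hr₁ (by linarith)
  have hball : Metric.ball (C.γ e s₀) r₂ ⊆ Metric.ball 0 1 := by
    intro z hz
    rw [Metric.mem_ball, dist_eq_norm] at hz
    rw [mem_ball_zero_iff]
    have h1 := norm_sub_norm_le z (C.γ e s₀)
    have h2 := min_le_right r₁ (1 - ‖C.γ e s₀‖)
    linarith
  obtain ⟨δ, hδ, hδδ₀, η, hη, hsmall⟩ : ∃ δ > 0, δ < δ₀ ∧ ∃ η > 0, ∀ s τ : ℝ, |s - s₀| < δ →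
      |τ| < η → dist (C.γ e s + τ • v) (C.γ e s₀) < r₂ := by
    have hc : Continuous fun p : ℝ × ℝ => C.γ e p.1 + p.2 • v :=
      ((C.continuous_γ e).comp continuous_fst).add (continuous_snd.smul continuous_const)
    have h1 : ∀ᶠ p : ℝ × ℝ in 𝓝 (s₀, 0), dist (C.γ e p.1 + p.2 • v) (C.γ e s₀) < r₂ := by
      refine (hc.dist continuous_const).continuousAt.eventually (gt_mem_nhds ?_)
      simpa using hr₂pos
    obtain ⟨ε, hε, h⟩ := Metric.eventually_nhds_iff.1 h1
    refine ⟨min (ε) (δ₀ / 2), by positivity,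
      (min_le_right _ _).trans_lt (by linarith), ε, hε, fun s τ hs hτ => ?_⟩
    refine h (y := (s, τ)) ?_
    rw [Prod.dist_eq, Real.dist_eq, Real.dist_eq, sub_zero]
    exact max_lt (hs.trans_le (min_le_left _ _)) hτ
  have hI : ∀ s ∈ Set.Icc (s₀ - δ) (s₀ + δ), |s - s₀| < δ₀ := by
    intro s hs
    rw [abs_lt]
    constructor <;> linarith [hs.1, hs.2]
  have hI' : ∀ s ∈ Set.Ioo (s₀ - δ) (s₀ + δ), |s - s₀| < δ := by
    intro s hs
    rw [abs_lt]
    constructor <;> linarith [hs.1, hs.2]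
  have hs₀I : s₀ ∈ Set.Ioo (s₀ - δ) (s₀ + δ) := ⟨by linarith, by linarith⟩
  -- The alternative `0 ≤ a` or `b ≤ 0` puts the strip on one side of the curve. It is connected and
  -- misses the graph, so one of its points decides its region.
  have hside : ∀ a b : ℝ, -η ≤ a → b ≤ η → (0 ≤ a ∨ b ≤ 0) → ∀ i,
      (∃ τ ∈ Set.Ioo a b, C.γ e s₀ + τ • v ∈ C.region i) →
      ∀ s ∈ Set.Ioo (s₀ - δ) (s₀ + δ), ∀ τ ∈ Set.Ioo a b, C.γ e s + τ • v ∈ C.region i := by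
    rintro a b ha hb hab i ⟨τ₀, hτ₀, hmem⟩ s hs τ hτ
    have hsub : (fun p : ℝ × ℝ => C.γ e p.1 + p.2 • v) ''
        (Set.Ioo (s₀ - δ) (s₀ + δ) ×ˢ Set.Ioo a b) ⊆ C.region i := by
      refine C.subset_region_of_isPreconnected ?_ ?_ ⟨_, ⟨(s₀, τ₀), ⟨hs₀I, hτ₀⟩, rfl⟩, hmem⟩
      · refine (isPreconnected_Ioo.prod isPreconnected_Ioo).image _ ?_
        exact (((C.continuous_γ e).comp continuous_fst).add
          (continuous_snd.smul continuous_const)).continuousOn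
      · rintro _ ⟨⟨s, τ⟩, ⟨hs, hτ⟩, rfl⟩
        simp only at hs hτ ⊢
        have hτη : |τ| < η := by
          rw [abs_lt]
          constructor <;> linarith [hτ.1, hτ.2]
        have hd := hsmall s τ (hI' s hs) hτη
        refine ⟨hball hd, fun hc => ?_⟩
        obtain ⟨f, s', hs', hfs⟩ := Set.mem_iUnion.1 hc
        rw [← hfs] at hd
        obtain ⟨rfl, hs'δ⟩ := hnear₁ f s' hs' (hd.trans_le (min_le_left _ _))
        have h1 : C.γ f s' + (0 : ℝ) • v = C.γ f s + τ • v := by rw [zero_smul, add_zero, hfs]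
        have h2 := (hinj s' hs'δ s ((hI' s hs).trans hδδ₀) 0 τ h1).2
        rcases hab with hab | hab <;> linarith [hτ.1, hτ.2]
    exact hsub ⟨(s, τ), ⟨hs, hτ⟩, rfl⟩
  obtain ⟨r₃, hr₃, hcover⟩ : ∃ r > 0, ∀ z, dist z (C.γ e s₀) < r →
      ∃ s ∈ Set.Ioo (s₀ - δ) (s₀ + δ), ∃ τ ∈ Set.Ioo (-η) η, z = C.γ e s + τ • v := by
    have h1 : Filter.map (C.tube e v) (𝓝 (s₀ : ℂ)) = 𝓝 (C.tube e v s₀) :=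
      C.map_nhds_tube (by simpa using hv.ne')
    have h2 : C.tube e v s₀ = C.γ e s₀ := by simp [tube]
    have h3 : (Set.Ioo (s₀ - δ) (s₀ + δ) ×ℂ Set.Ioo (-η) η) ∈ 𝓝 (s₀ : ℂ) := by
      refine (IsOpen.reProdIm isOpen_Ioo isOpen_Ioo).mem_nhds ?_
      rw [Complex.mem_reProdIm]
      simpa [hη] using hδ
    have h4 := Filter.image_mem_map (m := C.tube e v) h3
    rw [h1, h2] at h4
    obtain ⟨r, hr, hsub⟩ := Metric.mem_nhds_iff.1 h4
    refine ⟨r, hr, fun z hz => ?_⟩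
    obtain ⟨w, hw, rfl⟩ := hsub hz
    exact ⟨w.re, hw.1, w.im, hw.2, rfl⟩
  obtain ⟨r₄, hr₄, hnear₄⟩ := C.exists_radius_of_interior hs₀ hδ
  refine ⟨δ, hδ, η, hη, min r₂ (min r₃ r₄), by positivity, fun s hs => (hδpos s (hI s hs)).1,
    fun s hs => (hδpos s (hI s hs)).2, fun s hs s' hs' => hinj s (hI s hs) s' (hI s' hs'),
    hside 0 η (by linarith) le_rfl (Or.inl le_rfl) _ ?_,
    hside (-η) 0 le_rfl hη.le (Or.inr le_rfl) _ ?_,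
    fun z hz => hcover z (hz.trans_le ((min_le_right _ _).trans (min_le_left _ _))),
    fun f s hs hd => ?_, (Metric.ball_subset_ball (min_le_left _ _)).trans hball⟩
  · obtain ⟨τ, h1, h2⟩ := ((C.eventually_mem_left hs₀ hv).and (Ioo_mem_nhdsGT hη)).exists
    exact ⟨τ, h2, h1⟩
  · have hv' : inner ℝ (-v) (C.leftNormal e s₀) < 0 := by rw [inner_neg_left]; linarith
    obtain ⟨τ, h1, h2⟩ := ((C.eventually_mem_right hs₀ hv').and (Ioo_mem_nhdsGT hη)).exists
    refine ⟨-τ, ⟨by linarith [h2.2], by linarith [h2.1]⟩, ?_⟩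
    rwa [neg_smul, ← smul_neg]
  · obtain ⟨rfl, h⟩ := hnear₄ f s hs
      (hd.trans_le ((min_le_right _ _).trans (min_le_right _ _)))
    rw [abs_lt] at h
    exact ⟨rfl, by linarith [h.1], by linarith [h.2]⟩

/-- The fixed direction `v`, in place of the normal, makes the Jacobian `⟨v, N(s)⟩` independent of
`τ` and `dφ(v)` the `τ`-derivative of `φ`, so the inner integral is explicit. -/
theorem setIntegral_tube_image {e : Fin C.numEdges} {v : ℂ} {a b c d : ℝ} (hab : a ≤ b)
    (hcd : c ≤ d)
    (hpos : ∀ s ∈ Set.Icc a b, 0 < inner ℝ v (C.leftNormal e s))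
    (hinj : ∀ s ∈ Set.Icc a b, ∀ s' ∈ Set.Icc a b, ∀ τ τ' : ℝ,
        C.γ e s + τ • v = C.γ e s' + τ' • v → s = s' ∧ τ = τ')
    {φ : ℂ → ℝ} (hφ : ContDiff ℝ ∞ φ) :
    ∫ z in C.tube e v '' (Set.Ioo a b ×ℂ Set.Ioo c d), fderiv ℝ φ z v =
      ∫ s in a..b, inner ℝ v (C.leftNormal e s) *
        (φ (C.γ e s + d • v) - φ (C.γ e s + c • v)) := by
  have hmeas : MeasurableSet (Set.Ioo a b ×ℂ Set.Ioo c d) :=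
    (IsOpen.reProdIm isOpen_Ioo isOpen_Ioo).measurableSet
  rw [integral_image_eq_integral_abs_det_fderiv_smul volume hmeas
    (fun z _ => (C.hasFDerivAt_tube e v z).hasFDerivWithinAt)]
  swap
  · rintro z ⟨hz, -⟩ w ⟨hw, -⟩ h
    obtain ⟨h1, h2⟩ := hinj z.re (Set.Ioo_subset_Icc_self hz) w.re (Set.Ioo_subset_Icc_self hw)
      z.im w.im h
    exact Complex.ext h1 h2
  set g : ℝ × ℝ → ℝ := fun p => inner ℝ v (C.leftNormal e p.1) *
    fderiv ℝ φ (C.γ e p.1 + p.2 • v) v with hg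
  have hgc : Continuous g := by
    have h1 : Continuous fun p : ℝ × ℝ => C.leftNormal e p.1 :=
      (C.continuous_leftNormal e).comp continuous_fst
    have h2 : Continuous fun p : ℝ × ℝ => C.γ e p.1 + p.2 • v :=
      ((C.continuous_γ e).comp continuous_fst).add (continuous_snd.smul continuous_const)
    exact (continuous_const.inner h1).mul
      (((hφ.continuous_fderiv (by simp)).comp h2).clm_apply continuous_const)
  have h1 : ∫ z in Set.Ioo a b ×ℂ Set.Ioo c d, |(C.tubeDeriv e v z).det| •
      fderiv ℝ φ (C.tube e v z) v =
      ∫ z in Complex.measurableEquivRealProd ⁻¹' (Set.Ioo a b ×ˢ Set.Ioo c d),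
        g (Complex.measurableEquivRealProd z) := by
    refine setIntegral_congr_fun hmeas fun z hz => ?_
    have h2 := hpos z.re (Set.Ioo_subset_Icc_self hz.1)
    simp only [C.det_tubeDeriv, abs_of_pos h2, smul_eq_mul]
    rfl
  rw [h1, Complex.volume_preserving_equiv_real_prod.setIntegral_preimage_emb
    Complex.measurableEquivRealProd.measurableEmbedding, Measure.volume_eq_prod, setIntegral_prod]
  swap
  · exact (hgc.continuousOn.integrableOn_compact (isCompact_Icc.prod isCompact_Icc)).mono_set
      (Set.prod_mono Set.Ioo_subset_Icc_self Set.Ioo_subset_Icc_self)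
  rw [intervalIntegral.integral_of_le hab, integral_Ioc_eq_integral_Ioo]
  refine setIntegral_congr_fun measurableSet_Ioo fun s _ => ?_
  simp only [hg]
  rw [← integral_Ioc_eq_integral_Ioo, ← intervalIntegral.integral_of_le hcd,
    intervalIntegral.integral_const_mul]
  congr 1
  refine intervalIntegral.integral_eq_sub_of_hasDerivAt
    (f := fun τ : ℝ => φ (C.γ e s + τ • v)) (fun τ _ => ?_) ?_
  · have h2 : HasDerivAt (fun τ : ℝ => C.γ e s + τ • v) v τ := by
      simpa using ((hasDerivAt_id τ).smul_const v).const_add (C.γ e s)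
    exact (hφ.differentiable (by simp) _).hasFDerivAt.comp_hasDerivAt τ h2
  · refine Continuous.intervalIntegrable ?_ _ _
    exact ((hφ.continuous_fderiv (by simp)).comp (by fun_prop)).clm_apply continuous_const

end AdmissibleGraph

theorem eq_zero_of_mem_testFunctions {U : Set ℂ} {φ : ℂ → ℝ} (hφ : φ ∈ testFunctions U) {z : ℂ}
    (hz : z ∉ U) : φ z = 0 :=
  image_eq_zero_of_notMem_tsupport fun h => hz (hφ.2.2 h)

theorem fderiv_eq_zero_of_mem_testFunctions {U : Set ℂ} {φ : ℂ → ℝ} (hφ : φ ∈ testFunctions U)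
    {z : ℂ} (hz : z ∉ U) : fderiv ℝ φ z = 0 := by
  have : z ∉ Function.support (fderiv ℝ φ) :=
    fun h => hz (hφ.2.2 (support_fderiv_subset ℝ h))
  rwa [Function.notMem_support] at this

namespace AdmissibleGraph

variable {n : ℕ} (C : AdmissibleGraph n)

theorem disjoint_region_carrier (i : Fin n) : Disjoint (C.region i) C.carrier :=
  Set.disjoint_left.2 fun _ hz => (C.region_subset i hz).2

theorem areaVar_neg (v : ℂ) (φ : ℂ → ℝ) (i : Fin n) :
    C.areaVar (fun _ => -v) φ i = - C.areaVar (fun _ => v) φ i := by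
  unfold areaVar
  rw [← integral_neg]
  simp

/-- On the support of `φ` the left and right regions are the strips `0 < τ < η` and `-η < τ < 0` of
the tube. Since `φ` vanishes at `τ = ±η`, only its values on the curve survive, with opposite signs.
-/
theorem flux_of_pos {e : Fin C.numEdges} {s₀ : ℝ} (hs₀ : s₀ ∈ Set.Ioo 0 (C.len e)) {v : ℂ}
    (hv : 0 < inner ℝ v (C.leftNormal e s₀)) :
    ∃ r > 0, Metric.ball (C.γ e s₀) r ⊆ Metric.ball 0 1 ∧
      ∀ φ ∈ testFunctions (Metric.ball (C.γ e s₀) r),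
        (∀ f ≠ e, ∀ s ∈ Set.Icc 0 (C.len f), φ (C.γ f s) = 0) ∧
        φ (C.γ e 0) = 0 ∧ φ (C.γ e (C.len e)) = 0 ∧
        C.areaVar (fun _ => v) φ (C.left e) =
          - ∫ s in (0 : ℝ)..(C.len e), inner ℝ v (C.leftNormal e s) * φ (C.γ e s) ∧
        C.areaVar (fun _ => v) φ (C.right e) =
          ∫ s in (0 : ℝ)..(C.len e), inner ℝ v (C.leftNormal e s) * φ (C.γ e s) ∧
        ∀ i, i ≠ C.left e → i ≠ C.right e → C.areaVar (fun _ => v) φ i = 0 := by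
  obtain ⟨δ, hδ, η, hη, r, hr, hI, hpos, hinj, hleft, hright, hcover, hnear, hball⟩ :=
    C.exists_tube hs₀ hv
  refine ⟨r, hr, hball, fun φ hφ => ?_⟩
  have hout : ∀ z, r ≤ dist z (C.γ e s₀) → φ z = 0 := fun z hz =>
    eq_zero_of_mem_testFunctions hφ fun h => absurd hz (not_le.2 h)
  have hcar : ∀ f, ∀ s ∈ Set.Icc 0 (C.len f),
      ¬ (f = e ∧ s ∈ Set.Ioo (s₀ - δ) (s₀ + δ)) → φ (C.γ f s) = 0 := fun f s hs h =>
    hout _ (not_lt.1 fun hd => h (hnear f s hs hd))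
  have hlen := C.len_pos e
  have ha : s₀ - δ ∈ Set.Ioo 0 (C.len e) := hI ⟨le_rfl, by linarith⟩
  have hb : s₀ + δ ∈ Set.Ioo 0 (C.len e) := hI ⟨by linarith, le_rfl⟩
  have hfar : ∀ s ∈ Set.Ioo (s₀ - δ) (s₀ + δ), ∀ τ : ℝ, η ≤ |τ| → φ (C.γ e s + τ • v) = 0 := by
    intro s hs τ hτ
    refine hout _ (not_lt.1 fun hd => ?_)
    obtain ⟨s', hs', τ', hτ', h⟩ := hcover _ hd
    obtain ⟨-, rfl⟩ := hinj s (Set.Ioo_subset_Icc_self hs) s' (Set.Ioo_subset_Icc_self hs') τ τ' h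
    exact absurd hτ (not_le.2 (abs_lt.2 hτ'))
  have hrestrict : ∫ s in (s₀ - δ)..(s₀ + δ), inner ℝ v (C.leftNormal e s) * φ (C.γ e s) =
      ∫ s in (0 : ℝ)..(C.len e), inner ℝ v (C.leftNormal e s) * φ (C.γ e s) := by
    rw [intervalIntegral.integral_of_le (by linarith), intervalIntegral.integral_of_le hlen.le,
      integral_Ioc_eq_integral_Ioo, integral_Ioc_eq_integral_Ioo]
    refine (setIntegral_eq_of_subset_of_forall_sdiff_eq_zero measurableSet_Ioo ?_ ?_).symm
    · exact Set.Ioo_subset_Ioo ha.1.le hb.2.le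
    · intro s hs
      rw [hcar e s (Set.Ioo_subset_Icc_self hs.1) fun h => hs.2 h.2, mul_zero]
  have hregion : ∀ i, ∀ S : Set ℂ, MeasurableSet S → S ⊆ C.region i →
      (∀ s ∈ Set.Ioo (s₀ - δ) (s₀ + δ), ∀ τ ∈ Set.Ioo (-η) η,
        C.γ e s + τ • v ∈ C.region i → C.γ e s + τ • v ∈ S) →
      C.areaVar (fun _ => v) φ i = ∫ z in S, fderiv ℝ φ z v := by
    intro i S _ hS h
    refine setIntegral_eq_of_subset_of_forall_sdiff_eq_zero (C.region_open i).measurableSet hS ?_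
    intro z hz
    rw [fderiv_eq_zero_of_mem_testFunctions hφ]
    · rfl
    · intro hzb
      obtain ⟨s, hs, τ, hτ, rfl⟩ := hcover z hzb
      exact hz.2 (h s hs τ hτ hz.1)
  have hnotcar : ∀ i, ∀ s ∈ Set.Ioo (s₀ - δ) (s₀ + δ), C.γ e s + (0 : ℝ) • v ∉ C.region i := by
    intro i s hs h
    rw [zero_smul, add_zero] at h
    have := hI (Set.Ioo_subset_Icc_self hs)
    exact Set.disjoint_left.1 (C.disjoint_region_carrier i) h
      (C.γ_mem_carrier ⟨this.1.le, this.2.le⟩)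
  have hdisj : ∀ i j, i ≠ j → ∀ z, z ∈ C.region i → z ∉ C.region j := fun i j hij z h =>
    Set.disjoint_left.1 (C.region_disjoint i j hij) h
  have hmeas : ∀ c d : ℝ, MeasurableSet
      (C.tube e v '' (Set.Ioo (s₀ - δ) (s₀ + δ) ×ℂ Set.Ioo c d)) := by
    intro c d
    refine measurable_image_of_fderivWithin
      (IsOpen.reProdIm isOpen_Ioo isOpen_Ioo).measurableSet
      (fun z _ => (C.hasFDerivAt_tube e v z).hasFDerivWithinAt) ?_
    rintro z ⟨hz, -⟩ w ⟨hw, -⟩ h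
    obtain ⟨h1, h2⟩ := hinj z.re (Set.Ioo_subset_Icc_self hz) w.re (Set.Ioo_subset_Icc_self hw)
      z.im w.im h
    exact Complex.ext h1 h2
  have hmem : ∀ s ∈ Set.Ioo (s₀ - δ) (s₀ + δ), ∀ c d : ℝ, ∀ τ ∈ Set.Ioo c d,
      C.γ e s + τ • v ∈ C.tube e v '' (Set.Ioo (s₀ - δ) (s₀ + δ) ×ℂ Set.Ioo c d) :=
    fun s hs c d τ hτ => ⟨⟨s, τ⟩, ⟨hs, hτ⟩, rfl⟩
  refine ⟨fun f hf s hs => hcar f s hs fun h => hf h.1,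
    hcar e 0 ⟨le_rfl, hlen.le⟩ fun h => ?_, hcar e _ ⟨hlen.le, le_rfl⟩ fun h => ?_, ?_, ?_, ?_⟩
  · linarith [h.2.1, ha.1]
  · linarith [h.2.2, hb.2]
  · rw [hregion _ _ (hmeas 0 η) ?_ ?_, C.setIntegral_tube_image (by linarith) hη.le hpos hinj hφ.1,
      ← hrestrict, ← intervalIntegral.integral_neg]
    · refine intervalIntegral.integral_congr_ae ?_
      have hae : ∀ᵐ s : ℝ, s ≠ s₀ + δ := by simp [ae_iff]
      filter_upwards [hae] with s hs hs'
      rw [Set.uIoc_of_le (by linarith)] at hs'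
      rw [hfar s ⟨hs'.1, lt_of_le_of_ne hs'.2 hs⟩ η (le_abs_self η), zero_smul, add_zero]
      ring
    · rintro _ ⟨z, ⟨hz1, hz2⟩, rfl⟩
      exact hleft z.re hz1 z.im hz2
    · intro s hs τ hτ h
      refine hmem s hs _ _ τ ⟨?_, hτ.2⟩
      rcases lt_trichotomy τ 0 with h0 | h0 | h0
      · exact absurd (hright s hs τ ⟨hτ.1, h0⟩) (hdisj _ _ (C.left_ne_right e) _ h)
      · exact absurd h (h0 ▸ hnotcar _ s hs)
      · exact h0
  · rw [hregion _ _ (hmeas (-η) 0) ?_ ?_,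
      C.setIntegral_tube_image (by linarith) (by linarith) hpos hinj hφ.1, ← hrestrict]
    · refine intervalIntegral.integral_congr_ae ?_
      have hae : ∀ᵐ s : ℝ, s ≠ s₀ + δ := by simp [ae_iff]
      filter_upwards [hae] with s hs hs'
      rw [Set.uIoc_of_le (by linarith)] at hs'
      rw [hfar s ⟨hs'.1, lt_of_le_of_ne hs'.2 hs⟩ (-η) (by rw [abs_neg]; exact le_abs_self η),
        zero_smul, add_zero]
      ring
    · rintro _ ⟨z, ⟨hz1, hz2⟩, rfl⟩
      exact hright z.re hz1 z.im hz2
    · intro s hs τ hτ h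
      refine hmem s hs _ _ τ ⟨hτ.1, ?_⟩
      rcases lt_trichotomy τ 0 with h0 | h0 | h0
      · exact h0
      · exact absurd h (h0 ▸ hnotcar _ s hs)
      · exact absurd (hleft s hs τ ⟨h0, hτ.2⟩) (hdisj _ _ (C.left_ne_right e).symm _ h)
  · intro i hil hir
    rw [hregion i ∅ MeasurableSet.empty (Set.empty_subset _) ?_]
    · simp
    · intro s hs τ hτ h
      exfalso
      rcases lt_trichotomy τ 0 with h0 | h0 | h0
      · exact hdisj _ _ hir _ h (hright s hs τ ⟨hτ.1, h0⟩)
      · exact (h0 ▸ hnotcar i s hs) h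
      · exact hdisj _ _ hil _ h (hleft s hs τ ⟨h0, hτ.2⟩)

/-- The divergence theorem for vector fields `φ v` supported near a point of a curve. -/
theorem flux {e : Fin C.numEdges} {s₀ : ℝ} (hs₀ : s₀ ∈ Set.Ioo 0 (C.len e)) {v : ℂ}
    (hv : inner ℝ v (C.leftNormal e s₀) ≠ 0) :
    ∃ r > 0, Metric.ball (C.γ e s₀) r ⊆ Metric.ball 0 1 ∧
      ∀ φ ∈ testFunctions (Metric.ball (C.γ e s₀) r),
        (∀ f ≠ e, ∀ s ∈ Set.Icc 0 (C.len f), φ (C.γ f s) = 0) ∧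
        φ (C.γ e 0) = 0 ∧ φ (C.γ e (C.len e)) = 0 ∧
        ∀ p : Fin n → ℝ, ∑ i, p i * C.areaVar (fun _ => v) φ i =
          (p (C.right e) - p (C.left e)) *
            ∫ s in (0 : ℝ)..(C.len e), inner ℝ v (C.leftNormal e s) * φ (C.γ e s) := by
  have hsum : ∀ (w : ℂ) (φ : ℂ → ℝ) (A : ℝ),
      C.areaVar (fun _ => w) φ (C.left e) = -A → C.areaVar (fun _ => w) φ (C.right e) = A →
      (∀ i, i ≠ C.left e → i ≠ C.right e → C.areaVar (fun _ => w) φ i = 0) →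
      ∀ p : Fin n → ℝ, ∑ i, p i * C.areaVar (fun _ => w) φ i =
        (p (C.right e) - p (C.left e)) * A := by
    intro w φ A h1 h2 h3 p
    rw [Finset.sum_eq_add (C.left e) (C.right e) (C.left_ne_right e), h1, h2]
    · ring
    · intro i _ hi
      rw [h3 i hi.1 hi.2, mul_zero]
    · simp
    · simp
  rcases lt_or_gt_of_ne hv with hneg | hpos
  · obtain ⟨r, hr, hball, h⟩ := C.flux_of_pos hs₀ (v := -v) (by rw [inner_neg_left]; linarith)
    refine ⟨r, hr, hball, fun φ hφ => ?_⟩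
    obtain ⟨h1, h2, h3, h4, h5, h6⟩ := h φ hφ
    refine ⟨h1, h2, h3, fun p => ?_⟩
    have h7 := hsum (-v) φ _ h4 h5 h6 p
    simp only [areaVar_neg, inner_neg_left, neg_mul, mul_neg, Finset.sum_neg_distrib,
      intervalIntegral.integral_neg, neg_inj] at h7
    exact h7
  · obtain ⟨r, hr, hball, h⟩ := C.flux_of_pos hs₀ hpos
    refine ⟨r, hr, hball, fun φ hφ => ?_⟩
    obtain ⟨h1, h2, h3, h4, h5, h6⟩ := h φ hφ
    exact ⟨h1, h2, h3, hsum v φ _ h4 h5 h6⟩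

/-! ### Curvature as a difference of pressures. -/

theorem continuous_iteratedDeriv_two (e : Fin C.numEdges) :
    Continuous (iteratedDeriv 2 (C.γ e)) := by
  rw [iteratedDeriv_succ, iteratedDeriv_one]
  exact (C.contDiff_deriv_γ e).continuous_deriv (by simp)

theorem continuous_leftCurv (e : Fin C.numEdges) : Continuous (C.leftCurv e) := by
  exact (C.continuous_iteratedDeriv_two e).inner (C.continuous_leftNormal e)

theorem hasDerivAt_deriv_γ (e : Fin C.numEdges) (s : ℝ) :
    HasDerivAt (deriv (C.γ e)) (iteratedDeriv 2 (C.γ e) s) s := by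
  have h := ((C.contDiff_deriv_γ e).differentiable (by simp) s).hasDerivAt
  rwa [iteratedDeriv_succ, iteratedDeriv_one]

/-- Frenet's formula. -/
theorem iteratedDeriv_two_γ {e : Fin C.numEdges} {s : ℝ} (hs : s ∈ Set.Icc 0 (C.len e)) :
    iteratedDeriv 2 (C.γ e) s = C.leftCurv e s • C.leftNormal e s := by
  have hcont := C.continuous_iteratedDeriv_two e
  have h : Set.EqOn (iteratedDeriv 2 (C.γ e)) (fun s => C.leftCurv e s • C.leftNormal e s)
      (Set.Ioo 0 (C.len e)) := by
    intro s hs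
    have h1 := (C.hasDerivAt_deriv_γ e s).norm_sq
    have h2 : (fun s => ‖deriv (C.γ e) s‖ ^ 2) =ᶠ[𝓝 s] fun _ => 1 := by
      filter_upwards [Ioo_mem_nhds hs.1 hs.2] with t ht
      rw [C.unit_speed e t (Set.Ioo_subset_Icc_self ht), one_pow]
    have h3 := (h1.congr_of_eventuallyEq h2.symm).unique (hasDerivAt_const s (1 : ℝ))
    have h4 : ‖deriv (C.γ e) s‖ ^ 2 = 1 := by
      rw [C.unit_speed e s (Set.Ioo_subset_Icc_self hs), one_pow]
    rw [← Complex.normSq_eq_norm_sq, Complex.normSq_apply] at h4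
    simp only [CurveSystem.leftCurv, CurveSystem.leftNormal, Complex.inner] at h3 ⊢
    simp at h3
    have h5 : (deriv (C.γ e) s).re * (iteratedDeriv 2 (C.γ e) s).re
        + (deriv (C.γ e) s).im * (iteratedDeriv 2 (C.γ e) s).im = 0 := by linarith
    apply Complex.ext
    · simp
      linear_combination (-(iteratedDeriv 2 (C.γ e) s).re) * h4 + (deriv (C.γ e) s).re * h5
    · simp
      linear_combination (-(iteratedDeriv 2 (C.γ e) s).im) * h4 + (deriv (C.γ e) s).im * h5
  have h' := h.closure hcont ((C.continuous_leftCurv e).smul (C.continuous_leftNormal e))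
  rw [closure_Ioo (C.len_pos e).ne] at h'
  exact h' hs

/-- By parts and Frenet's formula the length variation is `-∫ κ ⟨v, N⟩ φ`; by `flux` the pressure
side is `(p_right - p_left) ∫ ⟨v, N⟩ φ`. As `φ` is an arbitrary function near the point, the
integrands agree there. -/
theorem leftCurv_eq_pressure_sub {v : ℂ} {p : Fin n → ℝ}
    (hp : ∀ φ ∈ testFunctions (Metric.ball 0 1),
      C.lengthVar (fun _ => v) φ = ∑ i, p i * C.areaVar (fun _ => v) φ i)
    {e : Fin C.numEdges} {s₀ : ℝ} (hs₀ : s₀ ∈ Set.Ioo 0 (C.len e))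
    (hv : inner ℝ v (C.leftNormal e s₀) ≠ 0) :
    C.leftCurv e s₀ = p (C.left e) - p (C.right e) := by
  obtain ⟨r, hr, hball, hflux⟩ := C.flux hs₀ hv
  set k := p (C.left e) - p (C.right e) with hk
  set g : ℝ → ℝ := fun s => (C.leftCurv e s - k) * inner ℝ v (C.leftNormal e s) with hg
  have hgc : Continuous g := ((C.continuous_leftCurv e).sub continuous_const).mul
    (continuous_const.inner (C.continuous_leftNormal e))
  have hzero : ∀ φ ∈ testFunctions (Metric.ball (C.γ e s₀) r),
      ∫ s in (0 : ℝ)..(C.len e), g s * φ (C.γ e s) = 0 := by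
    intro φ hφ
    obtain ⟨h1, h2, h3, h4⟩ := hflux φ hφ
    have hL := hp φ ⟨hφ.1, hφ.2.1, hφ.2.2.trans hball⟩
    rw [h4 p] at hL
    have hL' : C.lengthVar (fun _ => v) φ = - ∫ s in (0 : ℝ)..(C.len e),
        C.leftCurv e s * inner ℝ v (C.leftNormal e s) * φ (C.γ e s) := by
      unfold lengthVar
      have hIBP : ∀ f, ∫ s in (0 : ℝ)..(C.len f), deriv (fun s => φ (C.γ f s)) s *
          inner ℝ (deriv (C.γ f) s) v =
          φ (C.γ f (C.len f)) * inner ℝ (deriv (C.γ f) (C.len f)) v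
          - φ (C.γ f 0) * inner ℝ (deriv (C.γ f) 0) v
          - ∫ s in (0 : ℝ)..(C.len f), φ (C.γ f s) * inner ℝ (iteratedDeriv 2 (C.γ f) s) v := by
        intro f
        have hd : ∀ s, HasDerivAt (fun s => inner ℝ (deriv (C.γ f) s) v)
            (inner ℝ (iteratedDeriv 2 (C.γ f) s) v) s := by
          intro s
          simpa using (C.hasDerivAt_deriv_γ f s).inner ℝ (hasDerivAt_const s v)
        have hcont := C.continuous_iteratedDeriv_two f
        have := intervalIntegral.integral_mul_deriv_eq_deriv_mul (a := 0) (b := C.len f)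
          (u := fun s => φ (C.γ f s)) (fun s _ => (C.differentiableAt_comp_γ hφ.1 f s).hasDerivAt)
          (fun s _ => hd s) ((C.continuous_deriv_comp_γ hφ.1 f).intervalIntegrable _ _)
          ((hcont.inner continuous_const).intervalIntegrable _ _)
        rw [this]
        ring
      rw [Finset.sum_eq_single e]
      · rw [hIBP, h2, h3, zero_mul, zero_mul, sub_zero, zero_sub, neg_inj]
        refine intervalIntegral.integral_congr fun s hs => ?_
        rw [Set.uIcc_of_le (C.len_pos e).le] at hs
        rw [C.iteratedDeriv_two_γ hs, inner_smul_left, real_inner_comm]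
        simp only [conj_trivial]
        ring
      · intro f _ hf
        rw [hIBP, h1 f hf _ ⟨le_rfl, (C.len_pos f).le⟩, h1 f hf _ ⟨(C.len_pos f).le, le_rfl⟩]
        rw [intervalIntegral.integral_congr (g := fun _ => (0 : ℝ))]
        · simp
        · intro s hs
          rw [Set.uIcc_of_le (C.len_pos f).le] at hs
          simp only
          rw [h1 f hf s hs, zero_mul]
      · simp
    have hφc : Continuous fun s => φ (C.γ e s) := hφ.1.continuous.comp (C.continuous_γ e)
    have hNc : Continuous fun s => inner ℝ v (C.leftNormal e s) :=
      continuous_const.inner (C.continuous_leftNormal e)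
    have hsplit : ∫ s in (0 : ℝ)..(C.len e), g s * φ (C.γ e s) =
        (∫ s in (0 : ℝ)..(C.len e), C.leftCurv e s * inner ℝ v (C.leftNormal e s) * φ (C.γ e s))
        - k * ∫ s in (0 : ℝ)..(C.len e), inner ℝ v (C.leftNormal e s) * φ (C.γ e s) := by
      rw [← intervalIntegral.integral_const_mul, ← intervalIntegral.integral_sub]
      · refine intervalIntegral.integral_congr fun s _ => ?_
        simp only [hg]
        ring
      · exact (((C.continuous_leftCurv e).mul hNc).mul hφc).intervalIntegrable _ _
      · exact (continuous_const.mul (hNc.mul hφc)).intervalIntegrable _ _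
    rw [hsplit]
    linarith
  by_contra hne
  have hg0 : g s₀ ≠ 0 := mul_ne_zero (sub_ne_zero.2 hne) hv
  have hsq : 0 < g s₀ * g s₀ := mul_self_pos.2 hg0
  obtain ⟨δ, hδ, hgδ⟩ := Metric.eventually_nhds_iff.1
    ((continuous_const.mul hgc).continuousAt.eventually (lt_mem_nhds hsq) :
      ∀ᶠ s in 𝓝 s₀, 0 < g s₀ * g s)
  obtain ⟨r', hr', hnear⟩ := C.exists_radius_of_interior hs₀ hδ
  obtain ⟨ψ, M, -, hψ⟩ := exists_bump_family (C.γ e s₀)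
  set ρ := min r r' / 2 with hρ
  have hρpos : 0 < ρ := by positivity
  obtain ⟨h1, h2, h3, h4, h5, -, -⟩ := hψ ρ hρpos
  have hρr : ρ < r := by
    have := min_le_left r r'
    have : 0 < min r r' := by positivity
    linarith
  have hρr' : ρ < r' := by
    have := min_le_right r r'
    have : 0 < min r r' := by positivity
    linarith
  have hφ : ψ ρ ∈ testFunctions (Metric.ball (C.γ e s₀) r) :=
    ⟨h1, h2, h3.trans (Metric.closedBall_subset_ball hρr)⟩
  have hint := hzero _ hφ
  -- The constant factor `g s₀` fixes the sign: `g s₀ * g s > 0` wherever the bump may be nonzero.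
  have hpos : 0 < ∫ s in (0 : ℝ)..(C.len e), g s₀ * (g s * ψ ρ (C.γ e s)) := by
    refine intervalIntegral.integral_pos (C.len_pos e) ?_ ?_
      ⟨s₀, ⟨hs₀.1.le, hs₀.2.le⟩, ?_⟩
    · exact (continuous_const.mul
        (hgc.mul (h1.continuous.comp (C.continuous_γ e)))).continuousOn
    · intro s hs
      by_cases hd : dist (C.γ e s) (C.γ e s₀) < r'
      · have h6 := hgδ (y := s) (by
          rw [Real.dist_eq]; exact (hnear e s ⟨hs.1.le, hs.2⟩ hd).2)
        have := h5 (C.γ e s)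
        rw [← mul_assoc]
        positivity
      · rw [image_eq_zero_of_notMem_tsupport fun h => hd
          ((Metric.mem_closedBall.1 (h3 h)).trans_lt hρr')]
        simp
    · rw [h4, mul_one]
      exact hsq
  rw [intervalIntegral.integral_const_mul, hint, mul_zero] at hpos
  exact lt_irrefl _ hpos

/-- The pressures are found for one direction `v` at a time. Two curves can be compared through the
same pressures only if `v` is transversal to both. -/
theorem exists_transversal (N₁ N₂ : ℂ) (h₁ : N₁ ≠ 0) (h₂ : N₂ ≠ 0) :
    ∃ v : ℂ, inner ℝ v N₁ ≠ 0 ∧ inner ℝ v N₂ ≠ 0 := by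
  have h11 : inner ℝ N₁ N₁ ≠ 0 := (inner_self_ne_zero (𝕜 := ℝ)).2 h₁
  have h22 : inner ℝ N₂ N₂ ≠ 0 := (inner_self_ne_zero (𝕜 := ℝ)).2 h₂
  by_cases h12 : inner ℝ N₁ N₂ = 0
  · refine ⟨N₁ + N₂, ?_, ?_⟩
    · rw [inner_add_left, real_inner_comm N₁ N₂, h12, add_zero]; exact h11
    · rw [inner_add_left, h12, zero_add]; exact h22
  · exact ⟨N₁, h11, h12⟩

theorem leftNormal_ne_zero {e : Fin C.numEdges} {s : ℝ} (hs : s ∈ Set.Icc 0 (C.len e)) :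
    C.leftNormal e s ≠ 0 := by
  rw [← norm_ne_zero_iff, C.norm_leftNormal hs]
  exact one_ne_zero

/-- The curvatures of any two curves of a stationary graph are given by the same pressures. -/
theorem exists_pressures_of_pair (hC : C.IsStationary) {e f : Fin C.numEdges} {s t : ℝ}
    (hs : s ∈ Set.Ioo 0 (C.len e)) (ht : t ∈ Set.Ioo 0 (C.len f)) :
    ∃ p : Fin n → ℝ, C.leftCurv e s = p (C.left e) - p (C.right e) ∧
      C.leftCurv f t = p (C.left f) - p (C.right f) := by
  obtain ⟨v, hv1, hv2⟩ := exists_transversal _ _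
    (C.leftNormal_ne_zero (Set.Ioo_subset_Icc_self hs))
    (C.leftNormal_ne_zero (Set.Ioo_subset_Icc_self ht))
  obtain ⟨p, hp⟩ := C.exists_pressures_const hC v
  exact ⟨p, C.leftCurv_eq_pressure_sub hp hs hv1, C.leftCurv_eq_pressure_sub hp ht hv2⟩

/-- The curvature of a curve, which is constant if the graph is stationary. -/
noncomputable def curv (e : Fin C.numEdges) : ℝ := C.leftCurv e (C.len e / 2)

theorem half_mem (e : Fin C.numEdges) : C.len e / 2 ∈ Set.Ioo 0 (C.len e) := by
  have := C.len_pos e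
  constructor <;> linarith

theorem leftCurv_eq_curv (hC : C.IsStationary) {e : Fin C.numEdges} {s : ℝ}
    (hs : s ∈ Set.Icc 0 (C.len e)) : C.leftCurv e s = C.curv e := by
  have h : Set.EqOn (C.leftCurv e) (fun _ => C.curv e) (Set.Ioo 0 (C.len e)) := by
    intro s hs
    obtain ⟨p, h1, h2⟩ := C.exists_pressures_of_pair hC hs (C.half_mem e)
    exact h1.trans h2.symm
  have h' := h.closure (C.continuous_leftCurv e) continuous_const
  rw [closure_Ioo (C.len_pos e).ne] at h'
  exact h' hs

/-- The curvature of a curve with respect to the normal pointing into `i`, if `i` is one of the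
regions it separates. -/
noncomputable def curvTo (i : Fin n) (e : Fin C.numEdges) : ℝ :=
  if C.left e = i then C.curv e else if C.right e = i then - C.curv e else 0

theorem curvInto_eq_curvTo (hC : C.IsStationary) (i : Fin n) {e : Fin C.numEdges} {s : ℝ}
    (hs : s ∈ Set.Icc 0 (C.len e)) : C.curvInto i e s = C.curvTo i e := by
  unfold curvInto curvTo
  rw [C.leftCurv_eq_curv hC hs]

/-- The curve `e` separates the regions `i` and `j`. -/
def Separates (e : Fin C.numEdges) (i j : Fin n) : Prop :=
  (C.left e = i ∧ C.right e = j) ∨ (C.left e = j ∧ C.right e = i)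

theorem curvTo_congr (hC : C.IsStationary) {i j : Fin n} {e f : Fin C.numEdges}
    (he : C.Separates e i j) (hf : C.Separates f i j) : C.curvTo i e = C.curvTo i f := by
  obtain ⟨p, h1, h2⟩ := C.exists_pressures_of_pair hC (C.half_mem e) (C.half_mem f)
  have hel := C.left_ne_right e
  have hfl := C.left_ne_right f
  unfold curvTo
  change C.curv e = _ at h1
  change C.curv f = _ at h2
  rcases he with ⟨rfl, rfl⟩ | ⟨rfl, rfl⟩ <;> rcases hf with ⟨h3, h4⟩ | ⟨h3, h4⟩ <;>
    simp_all

end AdmissibleGraph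

/-! ### Curves leaving a vertex and the sectors between them. -/

theorem eq_inner_smul_add {A : ℂ} (hA : ‖A‖ = 1) {σ : ℝ} (hσ : σ ^ 2 = 1) (w : ℂ) :
    w = inner ℝ w A • A + inner ℝ w (σ • (Complex.I * A)) • (σ • (Complex.I * A)) := by
  have hA1 : A.re * A.re + A.im * A.im = 1 := by
    rw [← Complex.normSq_apply, Complex.normSq_eq_norm_sq, hA, one_pow]
  have hσ' : σ * σ = 1 := by rw [← hσ]; ring
  apply Complex.ext
  · simp [Complex.inner]
    linear_combination (-w.re * (σ * σ)) * hA1 +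
      (-w.re + (w.re * A.re + w.im * A.im) * A.re) * hσ'
  · simp [Complex.inner]
    linear_combination (-w.im * (σ * σ)) * hA1 +
      (-w.im + (w.re * A.re + w.im * A.im) * A.im) * hσ'

namespace AdmissibleGraph

variable {n : ℕ} (C : AdmissibleGraph n)

/-- The curve of an end, parametrized so as to leave this end. -/
noncomputable def out (a : C.End) (s : ℝ) : ℂ :=
  if a.2 then C.γ a.1 (C.len a.1 - s) else C.γ a.1 s

noncomputable def outDeriv (a : C.End) (s : ℝ) : ℂ :=
  if a.2 then - deriv (C.γ a.1) (C.len a.1 - s) else deriv (C.γ a.1) s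

/-- The region on the left of a curve leaving the end `a`. -/
def leftOf (a : C.End) : Fin n := if a.2 then C.right a.1 else C.left a.1

/-- The region on the right of a curve leaving the end `a`. -/
def rightOf (a : C.End) : Fin n := if a.2 then C.left a.1 else C.right a.1

theorem out_zero (a : C.End) : C.out a 0 = C.endPt a := by
  simp [out, CurveSystem.endPt, CurveSystem.param]
  split_ifs <;> rfl

theorem outDeriv_zero (a : C.End) : C.outDeriv a 0 = C.tangent a := by
  unfold outDeriv tangent endSign CurveSystem.param
  split_ifs <;> simp

theorem param_mem (a : C.End) : C.param a ∈ Set.Icc 0 (C.len a.1) := by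
  have := C.len_pos a.1
  unfold CurveSystem.param
  split_ifs <;> constructor <;> linarith

theorem norm_tangent (a : C.End) : ‖C.tangent a‖ = 1 := by
  have := C.unit_speed a.1 _ (C.param_mem a)
  unfold tangent endSign
  split_ifs <;> simp [this]

theorem hasDerivAt_out (a : C.End) (s : ℝ) : HasDerivAt (C.out a) (C.outDeriv a s) s := by
  unfold out outDeriv
  split_ifs
  · have h := (C.hasDerivAt_γ a.1 (C.len a.1 - s)).scomp s
      ((hasDerivAt_id s).const_sub (C.len a.1))
    simp only [neg_smul, one_smul] at h
    exact h
  · exact C.hasDerivAt_γ a.1 s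

theorem continuous_out (a : C.End) : Continuous (C.out a) :=
  continuous_iff_continuousAt.2 fun s => (C.hasDerivAt_out a s).continuousAt

theorem continuous_outDeriv (a : C.End) : Continuous (C.outDeriv a) := by
  unfold outDeriv
  split_ifs
  · exact ((C.continuous_deriv_γ a.1).comp (by fun_prop)).neg
  · exact C.continuous_deriv_γ a.1

theorem eventually_mem_leftOf {a : C.End} {s : ℝ} (hs : s ∈ Set.Ioo 0 (C.len a.1)) {v : ℂ}
    (hv : 0 < inner ℝ v (Complex.I * C.outDeriv a s)) :
    ∀ᶠ r in 𝓝[>] (0 : ℝ), C.out a s + r • v ∈ C.region (C.leftOf a) := by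
  unfold outDeriv at hv
  unfold out leftOf
  split_ifs at hv ⊢
  · refine C.eventually_mem_right ⟨by linarith [hs.2], by linarith [hs.1]⟩ ?_
    rw [mul_neg, inner_neg_right] at hv
    exact neg_pos.1 hv
  · exact C.eventually_mem_left hs hv

theorem eventually_mem_rightOf {a : C.End} {s : ℝ} (hs : s ∈ Set.Ioo 0 (C.len a.1)) {v : ℂ}
    (hv : inner ℝ v (Complex.I * C.outDeriv a s) < 0) :
    ∀ᶠ r in 𝓝[>] (0 : ℝ), C.out a s + r • v ∈ C.region (C.rightOf a) := by
  unfold outDeriv at hv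
  unfold out rightOf
  split_ifs at hv ⊢
  · refine C.eventually_mem_left ⟨by linarith [hs.2], by linarith [hs.1]⟩ ?_
    rw [mul_neg, inner_neg_right] at hv
    exact neg_neg_iff_pos.1 hv
  · exact C.eventually_mem_right hs hv

theorem exists_radius_of_vertex {p : ℂ} (hp : p ∈ C.verts) {δ : ℝ} (hδ : 0 < δ) :
    ∃ r > 0, ∀ z ∈ C.carrier, dist z p < r →
      ∃ b : C.End, C.endPt b = p ∧ ∃ t, 0 ≤ t ∧ t < δ ∧ z = C.out b t := by
  obtain ⟨r, hr, h⟩ := C.exists_radius p hδ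
  refine ⟨r, hr, fun z hz hd => ?_⟩
  obtain ⟨f, s, hs, rfl⟩ := Set.mem_iUnion.1 hz
  obtain ⟨s', hs', h1, h2⟩ := h f s hs hd
  rw [abs_lt] at h2
  rcases hs'.1.eq_or_lt with h0 | h0
  · subst h0
    exact ⟨(f, false), by simpa [CurveSystem.endPt, CurveSystem.param] using h1, s, hs.1,
      by linarith [h2.2], by simp [out]⟩
  rcases hs'.2.eq_or_lt with h3 | h3
  · subst h3
    exact ⟨(f, true), by simpa [CurveSystem.endPt, CurveSystem.param] using h1, C.len f - s,
      by linarith [hs.2], by linarith [h2.1], by simp [out]⟩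
  · exact absurd (h1 ▸ hp) (C.interior_not_vert f s' ⟨h0, h3⟩)

/-- A sector at a vertex between a curve and its neighbour lies in one region. The sign `σ`
says on which side of the curve the sector lies. -/
theorem eventually_mem_sector {a : C.End} (hp : C.endPt a ∈ C.verts) (hp1 : ‖C.endPt a‖ < 1)
    (hother : ∀ b, C.endPt b = C.endPt a → b ≠ a → inner ℝ (C.tangent b) (C.tangent a) < 0)
    {σ : ℝ} (hσ : σ ^ 2 = 1) {i : Fin n}
    (hside : ∀ s ∈ Set.Ioo 0 (C.len a.1), ∀ v : ℂ,
      0 < σ * inner ℝ v (Complex.I * C.outDeriv a s) →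
      ∀ᶠ r in 𝓝[>] (0 : ℝ), C.out a s + r • v ∈ C.region i)
    {w : ℂ} (hw : 0 < inner ℝ w (C.tangent a))
    (hw' : 0 < σ * inner ℝ w (Complex.I * C.tangent a)) :
    ∀ᶠ ρ in 𝓝[>] (0 : ℝ), C.endPt a + ρ • w ∈ C.region i := by
  set p := C.endPt a with hpdef
  set A := C.tangent a with hA
  set M := σ • (Complex.I * A) with hM
  set x := inner ℝ w A with hx
  set y := σ * inner ℝ w (Complex.I * A) with hy
  have hdecomp : w = x • A + y • M := by
    have h := eq_inner_smul_add (C.norm_tangent a) hσ w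
    rwa [inner_smul_right] at h
  have hAA : inner ℝ A A = 1 := by
    rw [real_inner_self_eq_norm_sq, C.norm_tangent a, one_pow]
  have hMA : inner ℝ M A = 0 := by
    simp [hM, Complex.inner]; ring
  have hMM : ‖M‖ = 1 := by
    have h1 : |σ| = 1 := by
      rw [← sq_eq_sq₀ (abs_nonneg σ) zero_le_one, sq_abs, hσ, one_pow]
    rw [hM, norm_smul, norm_mul, Complex.norm_I, C.norm_tangent a, Real.norm_eq_abs, h1]
    norm_num
  -- `c` bounds the slope of the curve over its tangent. At height `ρ x` along `A` the parameter is
  -- at most `2 ρ x`, so the curve deviates by at most `2 c ρ x < ρ y` and does not reach `p + ρ w`.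
  obtain ⟨c, hc, hc1, hcy⟩ : ∃ c > 0, c ≤ 1 / 2 ∧ 2 * c * x < y := by
    refine ⟨min (1 / 2) (y / (4 * x)), by positivity, min_le_left _ _, ?_⟩
    have h1 := min_le_right (1 / 2) (y / (4 * x))
    rw [le_div_iff₀ (by positivity)] at h1
    nlinarith
  have hout0 : C.out a 0 = p := C.out_zero a
  obtain ⟨ε, hε, hεlen, hεlin, hεpos⟩ : ∃ ε > 0, ε < C.len a.1 ∧
      (∀ s, 0 ≤ s → s ≤ ε → ‖C.out a s - p - s • A‖ ≤ c * s) ∧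
      (∀ s, 0 ≤ s → s ≤ ε → 0 < inner ℝ (C.outDeriv a s) A) := by
    have h1 := (C.hasDerivAt_out a 0).isLittleO.def hc
    have h2 : ∀ᶠ s in 𝓝 (0 : ℝ), 0 < inner ℝ (C.outDeriv a s) A := by
      refine ((C.continuous_outDeriv a).inner continuous_const).continuousAt.eventually
        (lt_mem_nhds ?_)
      simp only [C.outDeriv_zero]
      rw [hAA]
      exact one_pos
    obtain ⟨d, hd, h3⟩ := Metric.eventually_nhds_iff.1 (h1.and h2)
    refine ⟨min (d / 2) (C.len a.1 / 2), ?_, ?_, ?_, ?_⟩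
    · have := C.len_pos a.1
      positivity
    · have := C.len_pos a.1
      exact (min_le_right _ _).trans_lt (by linarith)
    · intro s hs hs'
      have h4 := (h3 (y := s) (by
        rw [Real.dist_eq, sub_zero, abs_of_nonneg hs]
        linarith [hs'.trans (min_le_left _ _)])).1
      rwa [hout0, C.outDeriv_zero, sub_zero, Real.norm_eq_abs, abs_of_nonneg hs] at h4
    · intro s hs hs'
      exact (h3 (y := s) (by
        rw [Real.dist_eq, sub_zero, abs_of_nonneg hs]
        linarith [hs'.trans (min_le_left _ _)])).2
  set f : ℝ → ℝ := fun s => inner ℝ (C.out a s - p) A with hf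
  have hfc : Continuous f := ((C.continuous_out a).sub continuous_const).inner continuous_const
  have hfd : ∀ s, HasDerivAt f (inner ℝ (C.outDeriv a s) A) s := by
    intro s
    have h := ((C.hasDerivAt_out a s).sub_const p).inner ℝ (hasDerivAt_const s A)
    rwa [inner_zero_right, zero_add] at h
  have hmono : StrictMonoOn f (Set.Icc 0 ε) := by
    refine strictMonoOn_of_deriv_pos (convex_Icc 0 ε) hfc.continuousOn fun s hs => ?_
    have hs' := interior_subset hs
    rw [(hfd s).deriv]
    exact hεpos s hs'.1 hs'.2
  have hf0 : f 0 = 0 := by simp [hf, hout0]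
  have hfε : 0 < f ε := by
    rw [← hf0]; exact hmono ⟨le_rfl, hε.le⟩ ⟨hε.le, le_rfl⟩ hε
  -- The other curves leave `p` at obtuse angles with `A`, hence stay in the half plane `⟨z - p, A⟩
  -- ≤ 0`; beyond it only the curve of `a` is met.
  obtain ⟨δ, hδ, hδε, hδo⟩ : ∃ δ > 0, δ ≤ ε ∧ ∀ b, C.endPt b = p → b ≠ a → ∀ t, 0 ≤ t → t < δ →
      inner ℝ (C.out b t - p) A ≤ 0 := by
    have h1 : ∀ᶠ δ in 𝓝[>] (0 : ℝ), ∀ b, C.endPt b = p → b ≠ a → ∀ t, 0 ≤ t → t < δ →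
        inner ℝ (C.out b t - p) A ≤ 0 := by
      rw [eventually_all]
      intro b
      by_cases hb : C.endPt b = p ∧ b ≠ a
      · have h2 := hother b hb.1 hb.2
        have hk : 0 < -inner ℝ (C.tangent b) A := by linarith
        have h3 := (C.hasDerivAt_out b 0).isLittleO.def hk
        obtain ⟨d, hd, h4⟩ := Metric.eventually_nhds_iff.1 h3
        filter_upwards [Ioo_mem_nhdsGT hd] with δ hδ _ _ t ht htδ
        have h5 := h4 (y := t) (by
          rw [Real.dist_eq, sub_zero, abs_of_nonneg ht]; exact htδ.trans hδ.2)
        rw [C.out_zero, hb.1, C.outDeriv_zero, sub_zero, Real.norm_eq_abs, abs_of_nonneg ht] at h5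
        have h6 := real_inner_le_norm (C.out b t - p - t • C.tangent b) A
        rw [inner_sub_left, inner_smul_left, C.norm_tangent a, mul_one] at h6
        simp only [conj_trivial] at h6
        linarith
      · exact Eventually.of_forall fun _ h3 h4 => absurd ⟨h3, h4⟩ hb
    obtain ⟨δ, h2, h3⟩ := (h1.and (Ioo_mem_nhdsGT hε)).exists
    exact ⟨δ, h3.1, h3.2.le, h2⟩
  obtain ⟨r₀, hr₀, hnear⟩ := C.exists_radius_of_vertex hp hδ
  have hlim : ∀ k : ℝ, Tendsto (fun ρ : ℝ => ρ * k) (𝓝[>] 0) (𝓝 0) := by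
    intro k
    have : Tendsto (fun ρ : ℝ => ρ * k) (𝓝 0) (𝓝 (0 * k)) :=
      (continuous_id.mul continuous_const).tendsto 0
    rw [zero_mul] at this
    exact this.mono_left nhdsWithin_le_nhds
  have hpos : ∀ᶠ ρ in 𝓝[>] (0 : ℝ), 0 < ρ := self_mem_nhdsWithin
  filter_upwards [hpos, (hlim x).eventually_lt_const hfε,
    (hlim (x + y)).eventually_lt_const hr₀,
    (hlim (x + y)).eventually_lt_const (show 0 < 1 - ‖p‖ by linarith)] with ρ hρ h1 h2 h3
  obtain ⟨s, hs, hfs⟩ : ∃ s ∈ Set.Ioo 0 ε, f s = ρ * x := by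
    have := intermediate_value_Ioo hε.le hfc.continuousOn
    exact this ⟨by rw [hf0]; positivity, h1⟩
  set g := inner ℝ (C.out a s - p) M with hg
  have hgs : |g| < ρ * y := by
    have h4 := hεlin s hs.1.le hs.2.le
    have h5 : |g| ≤ c * s := by
      have h6 : g = inner ℝ (C.out a s - p - s • A) M := by
        rw [inner_sub_left _ (s • A), inner_smul_left, real_inner_comm M A, hMA, mul_zero, sub_zero]
      rw [h6]
      refine (abs_real_inner_le_norm _ _).trans ?_
      rw [hMM, mul_one]
      exact h4
    have h7 : s ≤ 2 * (ρ * x) := by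
      have h8 := real_inner_le_norm (s • A - (C.out a s - p)) A
      rw [C.norm_tangent a, mul_one, norm_sub_rev, inner_sub_left, inner_smul_left, hAA] at h8
      simp only [conj_trivial] at h8
      change s * 1 - f s ≤ _ at h8
      rw [hfs] at h8
      nlinarith [hs.1]
    calc |g| ≤ c * s := h5
      _ ≤ c * (2 * (ρ * x)) := by gcongr
      _ = ρ * (2 * c * x) := by ring
      _ < ρ * y := by gcongr
  obtain ⟨hg1, hg2⟩ := abs_lt.1 hgs
  have houts : C.out a s = p + (ρ * x) • A + g • M := by
    have h := eq_inner_smul_add (C.norm_tangent a) hσ (C.out a s - p)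
    rw [← hfs, add_assoc]
    exact eq_add_of_sub_eq' h
  -- This segment joins the curve, at the same height along `A`, to `p + ρ w`. It is open at the
  -- curve, so it misses the graph and lies in one region, read off near the curve.
  set S : Set ℂ := (fun τ : ℝ => C.out a s + τ • M) '' Set.Ioc 0 (ρ * y - g) with hS
  have hSc : IsPreconnected S := isPreconnected_Ioc.image _ (by fun_prop)
  have hSsub : S ⊆ Metric.ball 0 1 \ C.carrier := by
    rintro _ ⟨τ, hτ, rfl⟩
    have hz : C.out a s + τ • M = p + ((ρ * x) • A + (g + τ) • M) := by
      rw [houts, add_smul]; ring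
    have hnorm : ‖(ρ * x) • A + (g + τ) • M‖ ≤ ρ * (x + y) := by
      refine (norm_add_le _ _).trans ?_
      rw [norm_smul, norm_smul, hMM, C.norm_tangent a, mul_one, mul_one, Real.norm_eq_abs,
        Real.norm_eq_abs, abs_of_pos (by positivity)]
      have : |g + τ| ≤ ρ * y := abs_le.2 ⟨by linarith [hτ.1], by linarith [hτ.2]⟩
      linarith
    refine ⟨?_, fun hcar => ?_⟩
    · rw [mem_ball_zero_iff]
      simp only
      rw [hz]
      linarith [norm_add_le p ((ρ * x) • A + (g + τ) • M)]
    · simp only at hcar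
      obtain ⟨b, hb, t, ht0, htδ, hzt⟩ := hnear _ hcar (by
        rw [hz, dist_eq_norm, add_sub_cancel_left]; linarith)
      have hin : inner ℝ (C.out b t - p) A = ρ * x := by
        rw [← hzt, hz, add_sub_cancel_left, inner_add_left, inner_smul_left, inner_smul_left, hMA,
          hAA]
        simp
      by_cases hba : b = a
      · subst hba
        have h4 : f t = f s := by rw [hfs]; exact hin
        have h5 : t = s := hmono.injOn ⟨ht0, htδ.le.trans hδε⟩ ⟨hs.1.le, hs.2.le⟩ h4
        rw [h5] at hzt
        have h6 : τ • M = 0 := by simpa using hzt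
        rcases smul_eq_zero.1 h6 with h7 | h7
        · exact hτ.1.ne' h7
        · rw [h7, norm_zero] at hMM
          exact zero_ne_one hMM
      · have := hδo b hb hba t ht0 htδ
        have : 0 < ρ * x := by positivity
        linarith
  have hmem : ∃ τ ∈ Set.Ioc 0 (ρ * y - g), C.out a s + τ • M ∈ C.region i := by
    have h4 : 0 < σ * inner ℝ M (Complex.I * C.outDeriv a s) := by
      have h5 : σ * inner ℝ M (Complex.I * C.outDeriv a s) =
          σ ^ 2 * inner ℝ (C.outDeriv a s) A := by
        simp [hM, Complex.inner]; ring
      rw [h5, hσ, one_mul]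
      exact hεpos s hs.1.le hs.2.le
    have h6 := hside s ⟨hs.1, hs.2.trans hεlen⟩ M h4
    obtain ⟨τ, h7, h8⟩ := (h6.and (Ioo_mem_nhdsGT (show 0 < ρ * y - g by linarith))).exists
    exact ⟨τ, ⟨h8.1, h8.2.le⟩, h7⟩
  obtain ⟨τ, hτ, hτm⟩ := hmem
  have hsub := C.subset_region_of_isPreconnected hSc hSsub ⟨_, ⟨τ, hτ, rfl⟩, hτm⟩
  have hend : p + ρ • w = C.out a s + (ρ * y - g) • M := by
    rw [houts, hdecomp, sub_smul, smul_add, smul_smul, smul_smul]; ring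
  rw [hend]
  exact hsub ⟨ρ * y - g, ⟨by linarith, le_rfl⟩, rfl⟩

/-- The region at the side of the curve leaving `a` to which `w` points. -/
noncomputable def sideOf (a : C.End) (w : ℂ) : Fin n :=
  if 0 < inner ℝ w (Complex.I * C.tangent a) then C.leftOf a else C.rightOf a

theorem eventually_mem_sideOf {a : C.End} (hp : C.endPt a ∈ C.verts) (hp1 : ‖C.endPt a‖ < 1)
    (hother : ∀ b, C.endPt b = C.endPt a → b ≠ a → inner ℝ (C.tangent b) (C.tangent a) < 0)
    {w : ℂ} (hw : 0 < inner ℝ w (C.tangent a))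
    (hw' : inner ℝ w (Complex.I * C.tangent a) ≠ 0) :
    ∀ᶠ ρ in 𝓝[>] (0 : ℝ), C.endPt a + ρ • w ∈ C.region (C.sideOf a w) := by
  unfold sideOf
  split_ifs with h
  · refine C.eventually_mem_sector hp hp1 hother (σ := 1) (by norm_num) ?_ hw (by linarith)
    intro s hs v hv
    exact C.eventually_mem_leftOf hs (by linarith)
  · have h' : inner ℝ w (Complex.I * C.tangent a) < 0 := lt_of_le_of_ne (not_lt.1 h) hw'
    refine C.eventually_mem_sector hp hp1 hother (σ := -1) (by norm_num) ?_ hw (by linarith)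
    intro s hs v hv
    exact C.eventually_mem_rightOf hs (by linarith)

theorem exists_third_end (hC : C.IsStationary) {a b : C.End} (hab : a ≠ b)
    (ha : C.IsInteriorEnd a) (hb : C.endPt b = C.endPt a) :
    ∃ c, c ≠ a ∧ c ≠ b ∧ C.endPt c = C.endPt a ∧
      (∀ d, C.endPt d = C.endPt a → d = a ∨ d = b ∨ d = c) ∧
      C.tangent a + C.tangent b + C.tangent c = 0 := by
  classical
  obtain ⟨hp, hp1⟩ := ha
  obtain ⟨c, hca, hcb, hc, hall⟩ : ∃ c, c ≠ a ∧ c ≠ b ∧ C.endPt c = C.endPt a ∧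
      ∀ d, C.endPt d = C.endPt a → d = a ∨ d = b ∨ d = c := by
    obtain ⟨x, y, z, hxy, hxz, hyz, hS⟩ := Set.ncard_eq_three.1 (C.degree_interior _ hp hp1)
    have hmem : ∀ d, C.endPt d = C.endPt a ↔ d = x ∨ d = y ∨ d = z := by
      intro d
      have h1 : d ∈ {d : C.End | C.endPt d = C.endPt a} ↔ d ∈ ({x, y, z} : Set C.End) := by rw [hS]
      simpa using h1
    have ha' := (hmem a).1 rfl
    have hb' := (hmem b).1 hb
    have hx := (hmem x).2 (by simp)
    have hy := (hmem y).2 (by simp)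
    have hz := (hmem z).2 (by simp)
    simp only [hmem]
    rcases ha' with rfl | rfl | rfl <;> rcases hb' with rfl | rfl | rfl <;>
      first
      | exact absurd rfl hab
      | exact ⟨z, by tauto, by tauto, by tauto, by tauto⟩
      | exact ⟨y, by tauto, by tauto, by tauto, by tauto⟩
      | exact ⟨x, by tauto, by tauto, by tauto, by tauto⟩
  refine ⟨c, hca, hcb, hc, hall, ?_⟩
  have hsum := C.sum_tangent_eq_zero hC hp hp1
  rw [← Finset.sum_filter] at hsum
  have hfil : Finset.univ.filter (fun d => C.endPt d = C.endPt a) = {a, b, c} := by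
    ext d
    simp only [Finset.mem_filter, Finset.mem_univ, true_and, Finset.mem_insert,
      Finset.mem_singleton]
    refine ⟨hall d, ?_⟩
    rintro (rfl | rfl | rfl)
    · rfl
    · exact hb
    · exact hc
  rw [hfil, Finset.sum_insert (by simp [hab, hca.symm]), Finset.sum_insert (by simp [hcb.symm]),
    Finset.sum_singleton, ← add_assoc] at hsum
  exact hsum

end AdmissibleGraph

/-! ### Angles of 120 degrees and boundary triangles. -/

theorem inner_eq_neg_half {A B D : ℂ} (hA : ‖A‖ = 1) (hB : ‖B‖ = 1) (hD : ‖D‖ = 1)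
    (h : A + B + D = 0) : inner ℝ A B = (-1 / 2 : ℝ) := by
  have h1 : D = -(A + B) := by linear_combination h
  rw [h1, norm_neg] at hD
  have h2 := norm_add_sq_real A B
  rw [hA, hB, hD] at h2
  linarith

theorem sq_inner_eq {A B : ℂ} (hA : ‖A‖ = 1) (hB : ‖B‖ = 1) (h : inner ℝ A B = (-1 / 2 : ℝ)) :
    (inner ℝ B (Complex.I * A)) ^ 2 = 3 / 4 := by
  have hA1 : A.re * A.re + A.im * A.im = 1 := by
    rw [← Complex.normSq_apply, Complex.normSq_eq_norm_sq, hA, one_pow]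
  have hB1 : B.re * B.re + B.im * B.im = 1 := by
    rw [← Complex.normSq_apply, Complex.normSq_eq_norm_sq, hB, one_pow]
  simp [Complex.inner] at h ⊢
  have h' : A.re * B.re + A.im * B.im = -1 / 2 := by linarith
  linear_combination (B.re * B.re + B.im * B.im) * hA1 + hB1 -
    (A.re * B.re + A.im * B.im - 1 / 2) * h'

theorem add_two_smul_eq {A B : ℂ} (hA : ‖A‖ = 1) (h : inner ℝ A B = (-1 / 2 : ℝ)) :
    A + (2 : ℝ) • B = (2 * inner ℝ B (Complex.I * A)) • (Complex.I * A) := by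
  have h1 := eq_inner_smul_add hA (one_pow 2) B
  rw [one_smul, real_inner_comm, h] at h1
  conv_lhs => rw [h1]
  rw [smul_add, smul_smul, smul_smul, ← add_assoc]
  norm_num

namespace AdmissibleGraph

variable {n : ℕ} (C : AdmissibleGraph n)

/-- `1` if the region `i` is on the left of the curve `e`, `-1` otherwise. -/
def orient (i : Fin n) (e : Fin C.numEdges) : ℝ := if C.left e = i then 1 else -1

variable {C}

/-- The direction bisecting the two tangents lies in a sector of each curve, so both sides contain
common points near the vertex. -/
theorem sideOf_eq_sideOf {a b : C.End} (ha : C.IsInteriorEnd a) (hb : C.endPt b = C.endPt a)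
    (hother : ∀ d, C.endPt d = C.endPt a → d ≠ a → inner ℝ (C.tangent d) (C.tangent a) < 0)
    (hother' : ∀ d, C.endPt d = C.endPt a → d ≠ b → inner ℝ (C.tangent d) (C.tangent b) < 0)
    (h : inner ℝ (C.tangent a) (C.tangent b) = (-1 / 2 : ℝ)) :
    C.sideOf a (C.tangent b) = C.sideOf b (C.tangent a) := by
  have haux : ∀ a b : C.End, C.IsInteriorEnd a →
      (∀ d, C.endPt d = C.endPt a → d ≠ a → inner ℝ (C.tangent d) (C.tangent a) < 0) →
      inner ℝ (C.tangent a) (C.tangent b) = (-1 / 2 : ℝ) →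
      ∀ᶠ ρ in 𝓝[>] (0 : ℝ), C.endPt a + ρ • (C.tangent a + C.tangent b) ∈
        C.region (C.sideOf a (C.tangent b)) := by
    intro a b ha ho h
    have h1 : inner ℝ (C.tangent a + C.tangent b) (Complex.I * C.tangent a) =
        inner ℝ (C.tangent b) (Complex.I * C.tangent a) := by
      simp [Complex.inner]; ring
    have h2 : C.sideOf a (C.tangent b) = C.sideOf a (C.tangent a + C.tangent b) := by
      unfold sideOf; rw [h1]
    rw [h2]
    refine C.eventually_mem_sideOf ha.1 ha.2 ho ?_ ?_
    · rw [inner_add_left, real_inner_self_eq_norm_sq, C.norm_tangent,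
        real_inner_comm (C.tangent a), h]
      norm_num
    · rw [h1]
      intro h0
      have := sq_inner_eq (C.norm_tangent a) (C.norm_tangent b) h
      rw [h0] at this
      norm_num at this
  have h1 := haux a b ha hother h
  have h2 := haux b a (by rw [IsInteriorEnd, hb]; exact ha) (by rwa [hb])
    (by rw [real_inner_comm]; exact h)
  obtain ⟨ρ, h3, h4⟩ := (h1.and h2).exists
  rw [hb, add_comm (C.tangent b)] at h4
  by_contra hne
  exact Set.disjoint_left.1 (C.region_disjoint _ _ hne) h3 h4

theorem separates_sideOf {a : C.End} {B D : ℂ} (hA : ‖B‖ = 1)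
    (h : inner ℝ (C.tangent a) B = (-1 / 2 : ℝ)) (hsum : C.tangent a + B + D = 0) :
    C.Separates a.1 (C.sideOf a B) (C.sideOf a D) := by
  have h1 : inner ℝ D (Complex.I * C.tangent a) = - inner ℝ B (Complex.I * C.tangent a) := by
    have : D = -(C.tangent a + B) := by linear_combination hsum
    rw [this]
    simp [Complex.inner]; ring
  have h2 : inner ℝ B (Complex.I * C.tangent a) ≠ 0 := by
    intro h0
    have := sq_inner_eq (C.norm_tangent a) hA h
    rw [h0] at this
    norm_num at this
  unfold Separates sideOf leftOf rightOf
  rw [h1]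
  rcases lt_or_gt_of_ne h2 with h3 | h3
  · rw [if_neg (not_lt.2 h3.le), if_pos (neg_pos.2 h3)]
    split_ifs <;> simp
  · rw [if_pos h3, if_neg (not_lt.2 (neg_nonpos.2 h3.le))]
    split_ifs <;> simp

theorem Separates.ne {e : Fin C.numEdges} {i j : Fin n} (h : C.Separates e i j) : i ≠ j := by
  rcases h with ⟨rfl, rfl⟩ | ⟨rfl, rfl⟩
  · exact C.left_ne_right e
  · exact (C.left_ne_right e).symm

theorem Separates.symm {e : Fin C.numEdges} {i j : Fin n} (h : C.Separates e i j) :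
    C.Separates e j i := Or.symm h

theorem Separates.eq_or_eq {e : Fin C.numEdges} {i j m : Fin n} (h : C.Separates e i j)
    (hm : C.left e = m ∨ C.right e = m) : m = i ∨ m = j := by
  rcases h with ⟨rfl, rfl⟩ | ⟨rfl, rfl⟩ <;> tauto

/-- The product of signs is `1` when the region on the side of `B` lies to the left of the curve
leaving `a`, which is also when `⟨B, I A⟩` is positive; its absolute value is the sine of 120
degrees. -/
theorem orient_mul_endSign {a : C.End} {B : ℂ} (hB : ‖B‖ = 1)
    (h : inner ℝ (C.tangent a) B = (-1 / 2 : ℝ)) :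
    (C.orient (C.sideOf a B) a.1 * C.endSign a) * inner ℝ B (Complex.I * C.tangent a) = √3 / 2 := by
  have hsq := sq_inner_eq (C.norm_tangent a) hB h
  set d := inner ℝ B (Complex.I * C.tangent a) with hd
  have h3 : √3 / 2 = |d| := by
    rw [← Real.sqrt_sq_eq_abs, hsq, Real.sqrt_div' _ (by norm_num : (0 : ℝ) ≤ 4)]
    norm_num
  rw [h3]
  have hlr := C.left_ne_right a.1
  unfold orient sideOf leftOf rightOf endSign
  rw [← hd]
  by_cases hpos : 0 < d
  · rw [if_pos hpos, abs_of_pos hpos]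
    split_ifs <;> simp_all
  · rw [if_neg hpos, abs_of_nonpos (not_lt.1 hpos)]
    split_ifs <;> simp_all

/-- The structure of a stationary graph near the boundary of a boundary 3-component of the region
`i`, bounded by the curves `a`, `b`: the third curve `c` issuing from the common vertex separates
the regions `j` and `k` adjacent to `a` and `b`. -/
structure BoundaryTriangle (C : AdmissibleGraph n) (i j k : Fin n) (a b c : C.End) : Prop where
  ne : a.1 ≠ b.1
  interior : C.IsInteriorEnd a
  endPt_b : C.endPt b = C.endPt a
  endPt_c : C.endPt c = C.endPt a
  c_ne_a : c ≠ a
  c_ne_b : c ≠ b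
  eq_or : ∀ d, C.endPt d = C.endPt a → d = a ∨ d = b ∨ d = c
  boundary_a : C.IsBoundaryEnd (C.opp a)
  boundary_b : C.IsBoundaryEnd (C.opp b)
  jk : j ≠ k
  sep_a : C.Separates a.1 i j
  sep_b : C.Separates b.1 i k
  sep_c : C.Separates c.1 j k
  inner_eq : inner ℝ (C.tangent a) (C.tangent b) = (-1 / 2 : ℝ)
  normal_a : (C.orient i a.1 * C.endSign a) * inner ℝ (C.tangent b) (Complex.I * C.tangent a)
    = √3 / 2
  normal_b : (C.orient i b.1 * C.endSign b) * inner ℝ (C.tangent a) (Complex.I * C.tangent b)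
    = √3 / 2

/-- The three sectors at the vertex are matched with regions by `sideOf_eq_sideOf`. This identifies
the regions across the sides and shows that the third curve separates them. -/
theorem exists_boundaryTriangle (hC : C.IsStationary) {i : Fin n} {a b : C.End} (hab : a.1 ≠ b.1)
    (ha : C.IsInteriorEnd a) (hb : C.endPt b = C.endPt a) (ha' : C.IsBoundaryEnd (C.opp a))
    (hb' : C.IsBoundaryEnd (C.opp b)) (hia : C.left a.1 = i ∨ C.right a.1 = i)
    (hib : C.left b.1 = i ∨ C.right b.1 = i) :
    ∃ j k c, C.BoundaryTriangle i j k a b c := by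
  obtain ⟨c, hca, hcb, hc, hall, hsum⟩ :=
    C.exists_third_end hC (fun h => hab (congrArg Prod.fst h)) ha hb
  have hnA := C.norm_tangent a
  have hnB := C.norm_tangent b
  have hnC := C.norm_tangent c
  have hAB := inner_eq_neg_half hnA hnB hnC hsum
  have hBC := inner_eq_neg_half hnB hnC hnA (by linear_combination hsum)
  have hCA := inner_eq_neg_half hnC hnA hnB (by linear_combination hsum)
  have hBA : inner ℝ (C.tangent b) (C.tangent a) = (-1 / 2 : ℝ) := by
    rw [real_inner_comm]; exact hAB
  have hCB : inner ℝ (C.tangent c) (C.tangent b) = (-1 / 2 : ℝ) := by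
    rw [real_inner_comm]; exact hBC
  have hAC : inner ℝ (C.tangent a) (C.tangent c) = (-1 / 2 : ℝ) := by
    rw [real_inner_comm]; exact hCA
  have hoa : ∀ d, C.endPt d = C.endPt a → d ≠ a → inner ℝ (C.tangent d) (C.tangent a) < 0 := by
    intro d hd hne
    rcases hall d hd with rfl | rfl | rfl
    · exact absurd rfl hne
    · rw [hBA]; norm_num
    · rw [hCA]; norm_num
  have hob : ∀ d, C.endPt d = C.endPt a → d ≠ b → inner ℝ (C.tangent d) (C.tangent b) < 0 := by
    intro d hd hne
    rcases hall d hd with rfl | rfl | rfl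
    · rw [hAB]; norm_num
    · exact absurd rfl hne
    · rw [hCB]; norm_num
  have hoc : ∀ d, C.endPt d = C.endPt a → d ≠ c → inner ℝ (C.tangent d) (C.tangent c) < 0 := by
    intro d hd hne
    rcases hall d hd with rfl | rfl | rfl
    · rw [hAC]; norm_num
    · rw [hBC]; norm_num
    · exact absurd rfl hne
  have h1 : C.sideOf a (C.tangent b) = C.sideOf b (C.tangent a) :=
    sideOf_eq_sideOf ha hb hoa hob hAB
  have h2 : C.sideOf a (C.tangent c) = C.sideOf c (C.tangent a) :=
    sideOf_eq_sideOf ha hc hoa hoc hAC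
  have h3 : C.sideOf b (C.tangent c) = C.sideOf c (C.tangent b) :=
    sideOf_eq_sideOf (by rw [IsInteriorEnd, hb]; exact ha) (hc.trans hb.symm) (by rwa [hb])
      (by rwa [hb]) hBC
  have sa := separates_sideOf hnB hAB hsum
  have sb := separates_sideOf (a := b) (D := C.tangent c) hnA hBA (by linear_combination hsum)
  have sc := separates_sideOf (a := c) (D := C.tangent b) hnA hCA (by linear_combination hsum)
  -- Otherwise `i` would be both the sector between `a` and `c` and the one between `b` and `c`,
  -- which the curve of `c` separates.
  have hi : i = C.sideOf a (C.tangent b) := by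
    rcases sa.eq_or_eq hia with h | h
    · exact h
    · rcases sb.eq_or_eq hib with h' | h'
      · rw [h', h1]
      · exact absurd (h2.symm.trans (h.symm.trans (h'.trans h3))) sc.ne
  refine ⟨C.sideOf a (C.tangent c), C.sideOf b (C.tangent c), c, ?_⟩
  exact
    { ne := hab
      interior := ha
      endPt_b := hb
      endPt_c := hc
      c_ne_a := hca
      c_ne_b := hcb
      eq_or := hall
      boundary_a := ha'
      boundary_b := hb'
      jk := by rw [h2, h3]; exact sc.ne
      sep_a := by rw [hi]; exact sa
      sep_b := by rw [hi, h1]; exact sb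
      sep_c := by rw [h2, h3]; exact sc
      inner_eq := hAB
      normal_a := by rw [hi]; exact orient_mul_endSign hnB hAB
      normal_b := by rw [hi, h1]; exact orient_mul_endSign hnA hBA }

theorem BoundaryTriangle.swap {i j k : Fin n} {a b c : C.End} (T : C.BoundaryTriangle i j k a b c) :
    C.BoundaryTriangle i k j b a c where
  ne := T.ne.symm
  interior := by rw [IsInteriorEnd, T.endPt_b]; exact T.interior
  endPt_b := T.endPt_b.symm
  endPt_c := T.endPt_c.trans T.endPt_b.symm
  c_ne_a := T.c_ne_b
  c_ne_b := T.c_ne_a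
  eq_or := by
    intro d hd
    have := T.eq_or d (hd.trans T.endPt_b)
    tauto
  boundary_a := T.boundary_b
  boundary_b := T.boundary_a
  jk := T.jk.symm
  sep_a := T.sep_b
  sep_b := T.sep_a
  sep_c := T.sep_c.symm
  inner_eq := by rw [real_inner_comm]; exact T.inner_eq
  normal_a := T.normal_b
  normal_b := T.normal_a

/-! ### From components of a region to boundary triangles. -/

/-- A component `Ω` of the region `i` contains one side of every curve in its frontier. -/
theorem side_subset_of_edge_subset_frontier {i : Fin n} {Ω : Set ℂ} {z : ℂ}
    (hΩ : Ω = connectedComponentIn (C.region i) z) {e : Fin C.numEdges}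
    (he : C.edge e ⊆ frontier Ω) :
    (C.left e = i ∧ ∀ᶠ τ in 𝓝[>] (0 : ℝ), C.γ e (C.len e / 2) +
      τ • C.leftNormal e (C.len e / 2) ∈ Ω) ∨
    (C.right e = i ∧ ∀ᶠ τ in 𝓝[>] (0 : ℝ), C.γ e (C.len e / 2) -
      τ • C.leftNormal e (C.len e / 2) ∈ Ω) := by
  have hs₀ := C.half_mem e
  set s₀ := C.len e / 2 with hs₀def
  set v := C.leftNormal e s₀ with hv
  have hpos : 0 < inner ℝ v (C.leftNormal e s₀) := by
    rw [real_inner_self_eq_norm_sq, C.norm_leftNormal (Set.Ioo_subset_Icc_self hs₀)]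
    norm_num
  obtain ⟨δ, hδ, η, hη, r, hr, hI, -, -, hleft, hright, hcover, -, -⟩ := C.exists_tube hs₀ hpos
  have hmem : C.γ e s₀ ∈ closure Ω :=
    frontier_subset_closure (he ⟨s₀, Set.Ioo_subset_Icc_self hs₀, rfl⟩)
  obtain ⟨w, hwΩ, hwd⟩ := Metric.mem_closure_iff.1 hmem r hr
  rw [dist_comm] at hwd
  obtain ⟨s, hs, τ, hτ, rfl⟩ := hcover w hwd
  have hΩi : Ω ⊆ C.region i := hΩ ▸ connectedComponentIn_subset _ _
  have hs₀I : s₀ ∈ Set.Ioo (s₀ - δ) (s₀ + δ) := ⟨by linarith, by linarith⟩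
  have hside : ∀ c d : ℝ, τ ∈ Set.Ioo c d →
      (∀ s ∈ Set.Ioo (s₀ - δ) (s₀ + δ), ∀ τ ∈ Set.Ioo c d, C.γ e s + τ • v ∈ C.region i) →
      ∀ τ ∈ Set.Ioo c d, C.γ e s₀ + τ • v ∈ Ω := by
    intro c d hτ h t ht
    have hpre : IsPreconnected ((fun p : ℝ × ℝ => C.γ e p.1 + p.2 • v) ''
        (Set.Ioo (s₀ - δ) (s₀ + δ) ×ˢ Set.Ioo c d)) := by
      refine (isPreconnected_Ioo.prod isPreconnected_Ioo).image _ ?_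
      exact (((C.continuous_γ e).comp continuous_fst).add
        (continuous_snd.smul continuous_const)).continuousOn
    have hsub := hpre.subset_connectedComponentIn (F := C.region i) ⟨(s, τ), ⟨hs, hτ⟩, rfl⟩ (by
      rintro _ ⟨⟨s', t'⟩, ⟨hs', ht'⟩, rfl⟩
      exact h s' hs' t' ht')
    rw [hΩ] at hwΩ ⊢
    rw [connectedComponentIn_eq hwΩ]
    exact hsub ⟨(s₀, t), ⟨hs₀I, ht⟩, rfl⟩
  have hregion : ∀ m, C.γ e s + τ • v ∈ C.region m → m = i := by
    intro m hm
    by_contra hne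
    exact Set.disjoint_left.1 (C.region_disjoint _ _ hne) hm (hΩi hwΩ)
  rcases lt_trichotomy τ 0 with h0 | h0 | h0
  · have hi := hregion _ (hright s hs τ ⟨hτ.1, h0⟩)
    refine Or.inr ⟨hi, ?_⟩
    have h := hside (-η) 0 ⟨hτ.1, h0⟩ (fun s hs τ hτ => hi ▸ hright s hs τ hτ)
    filter_upwards [Ioo_mem_nhdsGT hη] with t ht
    have := h (-t) ⟨by linarith [ht.2], by linarith [ht.1]⟩
    rwa [neg_smul, ← sub_eq_add_neg] at this
  · exfalso
    have h1 := hΩi hwΩ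
    rw [h0, zero_smul, add_zero] at h1
    exact Set.disjoint_left.1 (C.disjoint_region_carrier i) h1
      (C.γ_mem_carrier (Set.Ioo_subset_Icc_self (hI (Set.Ioo_subset_Icc_self hs))))
  · have hi := hregion _ (hleft s hs τ ⟨h0, hτ.2⟩)
    refine Or.inl ⟨hi, ?_⟩
    have h := hside 0 η ⟨h0, hτ.2⟩ (fun s hs τ hτ => hi ▸ hleft s hs τ hτ)
    filter_upwards [Ioo_mem_nhdsGT hη] with t ht
    exact h t ht

/-- The region `i` lies on only one side of the curve, and both components contain the points close
to its midpoint on that side. -/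
theorem component_eq_of_common_edge {i : Fin n} {Ω₁ Ω₂ : Set ℂ} {z₁ z₂ : ℂ}
    (h₁ : Ω₁ = connectedComponentIn (C.region i) z₁)
    (h₂ : Ω₂ = connectedComponentIn (C.region i) z₂) {e : Fin C.numEdges}
    (he₁ : C.edge e ⊆ frontier Ω₁) (he₂ : C.edge e ⊆ frontier Ω₂) : Ω₁ = Ω₂ := by
  have hcommon : ∀ w, w ∈ Ω₁ → w ∈ Ω₂ → Ω₁ = Ω₂ := by
    intro w hw1 hw2
    rw [h₁] at hw1 ⊢
    rw [h₂] at hw2 ⊢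
    rw [connectedComponentIn_eq hw1, connectedComponentIn_eq hw2]
  have hlr := C.left_ne_right e
  rcases side_subset_of_edge_subset_frontier h₁ he₁ with ⟨hi, h⟩ | ⟨hi, h⟩ <;>
    rcases side_subset_of_edge_subset_frontier h₂ he₂ with ⟨hi', h'⟩ | ⟨hi', h'⟩
  · obtain ⟨τ, h3, h4⟩ := (h.and h').exists
    exact hcommon _ h3 h4
  · exact absurd (hi.trans hi'.symm) hlr
  · exact absurd (hi'.trans hi.symm) hlr
  · obtain ⟨τ, h3, h4⟩ := (h.and h').exists
    exact hcommon _ h3 h4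

theorem exists_boundaryTriangle_of_component (hC : C.IsStationary) {i : Fin n} {Ω : Set ℂ}
    (h : C.IsBoundaryThreeComponent i Ω) :
    ∃ j k a b c, C.BoundaryTriangle i j k a b c ∧ C.edge a.1 ⊆ frontier Ω ∧
      C.edge b.1 ⊆ frontier Ω ∧ C.neighbours i Ω = {j, k} := by
  obtain ⟨⟨z, -, hΩ⟩, a, b, hab, ha, hba, ha', hb', α, β, -, -, -, -, -, hfr⟩ := h
  have hea : C.edge a.1 ⊆ frontier Ω := by
    rw [hfr]
    exact fun w hw => Or.inl (Or.inl hw)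
  have heb : C.edge b.1 ⊆ frontier Ω := by
    rw [hfr]
    exact fun w hw => Or.inl (Or.inr hw)
  have hside : ∀ e, C.edge e ⊆ frontier Ω → C.left e = i ∨ C.right e = i := by
    intro e he
    rcases side_subset_of_edge_subset_frontier hΩ he with h | h
    · exact Or.inl h.1
    · exact Or.inr h.1
  obtain ⟨j, k, c, T⟩ := exists_boundaryTriangle hC hab ha hba.symm ha' hb' (hside _ hea)
    (hside _ heb)
  refine ⟨j, k, a, b, c, T, hea, heb, ?_⟩
  ext m
  constructor
  · rintro ⟨hmi, e, he, hm⟩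
    -- The midpoint of `e` is a simple point of the graph in the open disk, so it can lie only on a
    -- side that is `e` itself, and not on the circular arc.
    have hs₀ := C.half_mem e
    have hmem := he ⟨_, Set.Ioo_subset_Icc_self hs₀, rfl⟩
    rw [hfr] at hmem
    rcases hmem with (⟨s, hs, hse⟩ | ⟨s, hs, hse⟩) | ⟨θ, -, hθ⟩
    · obtain ⟨rfl, -⟩ := C.eq_of_γ_eq hs₀ hs hse
      rcases T.sep_a.eq_or_eq hm with h | h
      · exact absurd h hmi
      · exact Or.inl h
    · obtain ⟨rfl, -⟩ := C.eq_of_γ_eq hs₀ hs hse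
      rcases T.sep_b.eq_or_eq hm with h | h
      · exact absurd h hmi
      · exact Or.inr h
    · exfalso
      have h1 := C.norm_γ_lt_one hs₀
      rw [← hθ, Complex.norm_exp_ofReal_mul_I] at h1
      exact lt_irrefl _ h1
  · rintro (rfl | rfl)
    · refine ⟨T.sep_a.ne.symm, a.1, hea, ?_⟩
      rcases T.sep_a with h | h
      · exact Or.inr h.2
      · exact Or.inl h.1
    · refine ⟨T.sep_b.ne.symm, b.1, heb, ?_⟩
      rcases T.sep_b with h | h
      · exact Or.inr h.2
      · exact Or.inl h.1

end AdmissibleGraph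

/-! ### Curves of constant curvature orthogonal to the unit circle. -/

namespace AdmissibleGraph

variable {n : ℕ} {C : AdmissibleGraph n}

theorem endSign_sq (a : C.End) : C.endSign a * C.endSign a = 1 := by
  unfold endSign; split_ifs <;> norm_num

theorem orient_sq (i : Fin n) (e : Fin C.numEdges) : C.orient i e * C.orient i e = 1 := by
  unfold orient; split_ifs <;> norm_num

theorem leftNormal_param (a : C.End) :
    C.leftNormal a.1 (C.param a) = C.endSign a • (Complex.I * C.tangent a) := by
  unfold CurveSystem.leftNormal tangent
  rw [mul_smul_comm, smul_smul, endSign_sq, one_smul]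

/-- A quantity preserved along an arc of constant curvature vanishes if the arc meets the unit
circle orthogonally. -/
theorem curv_mul_one_sub_sq (hC : C.IsStationary) {a : C.End} (ha : C.IsBoundaryEnd a) {s : ℝ}
    (hs : s ∈ Set.Icc 0 (C.len a.1)) :
    C.curv a.1 * (1 - ‖C.γ a.1 s‖ ^ 2) = 2 * inner ℝ (C.γ a.1 s) (C.leftNormal a.1 s) := by
  set G : ℝ → ℝ := fun s => C.curv a.1 * (1 - ‖C.γ a.1 s‖ ^ 2) -
    2 * inner ℝ (C.γ a.1 s) (C.leftNormal a.1 s) with hG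
  have hd : ∀ s ∈ Set.Icc 0 (C.len a.1), HasDerivAt G 0 s := by
    intro s hs
    have h1 := (C.hasDerivAt_γ a.1 s).norm_sq
    have h2 : HasDerivAt (C.leftNormal a.1) (Complex.I * iteratedDeriv 2 (C.γ a.1) s) s :=
      (C.hasDerivAt_deriv_γ a.1 s).const_mul Complex.I
    have h3 := (C.hasDerivAt_γ a.1 s).inner ℝ h2
    have h4 := ((h1.const_sub 1).const_mul (C.curv a.1)).sub (h3.const_mul 2)
    refine h4.congr_deriv ?_
    rw [C.iteratedDeriv_two_γ hs, C.leftCurv_eq_curv hC hs, C.inner_deriv_leftNormal]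
    simp [CurveSystem.leftNormal, Complex.inner]
    ring
  have hconst := constant_of_has_deriv_right_zero (f := G)
    (fun s hs => (hd s hs).continuousAt.continuousWithinAt)
    (fun s hs => (hd s ⟨hs.1, hs.2.le⟩).hasDerivWithinAt)
  -- At the boundary end `|γ| = 1`, and orthogonality makes `γ` perpendicular to the normal.
  have hend : G (C.param a) = 0 := by
    have h1 := C.inner_tangent_eq_zero hC ha
    have h2 : inner ℝ (C.endPt a) (C.leftNormal a.1 (C.param a)) =
        - (C.endSign a * inner ℝ (C.tangent a) (Complex.I * C.endPt a)) := by
      rw [leftNormal_param]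
      simp [Complex.inner]; ring
    have h3 : G (C.param a) = C.curv a.1 * (1 - ‖C.endPt a‖ ^ 2) -
      2 * inner ℝ (C.endPt a) (C.leftNormal a.1 (C.param a)) := rfl
    rw [h3, h2, h1, ha.2]
    ring
  have h0 : G s = 0 := by
    rw [hconst s hs, ← hconst _ (C.param_mem a), hend]
  exact sub_eq_zero.1 h0

theorem out_eq (a : C.End) (s : ℝ) :
    C.out a s = C.γ a.1 (if a.2 then C.len a.1 - s else s) := by
  unfold out; split_ifs <;> rfl

theorem out_len (a : C.End) : C.out a (C.len a.1) = C.endPt (C.opp a) := by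
  unfold out CurveSystem.endPt CurveSystem.opp CurveSystem.param
  rcases a with ⟨e, _ | _⟩ <;> simp

theorem one_sub_norm_le_len {a : C.End} (ha : C.IsBoundaryEnd (C.opp a)) :
    1 - ‖C.endPt a‖ ≤ C.len a.1 := by
  have hlen := C.len_pos a.1
  have hnorm : ∀ s ∈ Set.Ico 0 (C.len a.1), ‖C.outDeriv a s‖ ≤ 1 := by
    intro s hs
    unfold outDeriv
    split_ifs
    · rw [norm_neg, C.unit_speed a.1 _ ⟨by linarith [hs.2], by linarith [hs.1]⟩]
    · rw [C.unit_speed a.1 _ ⟨hs.1, hs.2.le⟩]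
  have h := norm_image_sub_le_of_norm_deriv_le_segment' (f := C.out a) (C := 1)
    (fun s _ => (C.hasDerivAt_out a s).hasDerivWithinAt) hnorm (C.len a.1) ⟨hlen.le, le_rfl⟩
  rw [out_len, C.out_zero, one_mul, sub_zero] at h
  have h1 := norm_sub_norm_le (C.endPt (C.opp a)) (C.endPt a)
  rw [ha.2] at h1
  linarith

theorem hasDerivAt_norm_out_sq (a : C.End) (s : ℝ) :
    HasDerivAt (fun s => ‖C.out a s‖ ^ 2) (2 * inner ℝ (C.out a s) (C.outDeriv a s)) s :=
  (C.hasDerivAt_out a s).norm_sq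

/-- The second derivative of `|γ|²` is `2 + 2 ⟨γ, γ''⟩`, and `⟨γ, γ''⟩ = κ ⟨γ, N⟩` is expressed by
`|γ|²` through `curv_mul_one_sub_sq`. So `|γ|²` solves a linear equation depending only on `κ²`. -/
theorem hasDerivAt_inner_out (hC : C.IsStationary) {a : C.End} (ha : C.IsBoundaryEnd (C.opp a))
    {s : ℝ} (hs : s ∈ Set.Icc 0 (C.len a.1)) :
    HasDerivAt (fun s => 2 * inner ℝ (C.out a s) (C.outDeriv a s))
      (2 + C.curv a.1 ^ 2 * (1 - ‖C.out a s‖ ^ 2)) s := by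
  set s' := if a.2 then C.len a.1 - s else s with hs'
  have hs'm : s' ∈ Set.Icc 0 (C.len a.1) := by
    rw [hs']
    split_ifs
    · exact ⟨by linarith [hs.2], by linarith [hs.1]⟩
    · exact hs
  have h1 : HasDerivAt (C.outDeriv a) (iteratedDeriv 2 (C.γ a.1) s') s := by
    rw [hs']
    unfold outDeriv
    split_ifs
    · have h := ((C.hasDerivAt_deriv_γ a.1 (C.len a.1 - s)).scomp s
        ((hasDerivAt_id s).const_sub (C.len a.1))).neg
      simp only [neg_smul, one_smul, neg_neg] at h
      exact h
    · exact C.hasDerivAt_deriv_γ a.1 s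
  have h2 := ((C.hasDerivAt_out a s).inner ℝ h1).const_mul 2
  refine h2.congr_deriv ?_
  have h3 : ‖C.outDeriv a s‖ = 1 := by
    have := C.unit_speed a.1 s' hs'm
    rw [hs'] at this
    unfold outDeriv
    split_ifs at this ⊢
    · rw [norm_neg, this]
    · exact this
  have h4 := curv_mul_one_sub_sq hC ha hs'm
  change C.curv a.1 * _ = 2 * inner ℝ (C.γ a.1 s') (C.leftNormal a.1 s') at h4
  change C.curv a.1 * (1 - ‖C.γ a.1 s'‖ ^ 2) = _ at h4
  rw [real_inner_self_eq_norm_sq, h3, out_eq, ← hs', C.iteratedDeriv_two_γ hs'm,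
    C.leftCurv_eq_curv hC hs'm, inner_smul_right]
  linear_combination (-C.curv a.1) * h4

/-- Both squared norms solve the same second order equation with the same initial data, hence agree
as long as both curves are defined; the length is the first time at which the norm is `1`. -/
theorem not_len_lt_of_same_initial (hC : C.IsStationary) {a b : C.End}
    (ha : C.IsBoundaryEnd (C.opp a)) (hb : C.IsBoundaryEnd (C.opp b))
    (hcurv : C.curv a.1 ^ 2 = C.curv b.1 ^ 2) (hnorm : ‖C.endPt a‖ = ‖C.endPt b‖)
    (hinner : inner ℝ (C.endPt a) (C.tangent a) = inner ℝ (C.endPt b) (C.tangent b)) :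
    ¬ C.len a.1 < C.len b.1 := by
  intro hlt
  have hla := C.len_pos a.1
  set D : ℝ → ℝ := fun s => ‖C.out a s‖ ^ 2 - ‖C.out b s‖ ^ 2 with hD
  set G : ℝ → ℝ := fun s => 2 * inner ℝ (C.out a s) (C.outDeriv a s) -
    2 * inner ℝ (C.out b s) (C.outDeriv b s) with hG
  have hDd : ∀ s, HasDerivAt D (G s) s := fun s =>
    (hasDerivAt_norm_out_sq a s).sub (hasDerivAt_norm_out_sq b s)
  have hGd : ∀ s ∈ Set.Icc 0 (C.len a.1), HasDerivAt G (-(C.curv a.1 ^ 2) * D s) s := by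
    intro s hs
    refine ((hasDerivAt_inner_out hC ha hs).sub
      (hasDerivAt_inner_out hC hb ⟨hs.1, hs.2.trans hlt.le⟩)).congr_deriv ?_
    rw [← hcurv, hD]
    ring
  have hD0 : D 0 = 0 := by
    simp only [hD, C.out_zero, hnorm, sub_self]
  have hG0 : G 0 = 0 := by
    simp only [hG, C.out_zero, C.outDeriv_zero, hinner, sub_self]
  -- Uniqueness through the conserved energy of `D'' = -κ² D`, where `G = D'`. For `κ = 0` it still
  -- gives `G = 0`, which suffices.
  have hE : ∀ s ∈ Set.Icc 0 (C.len a.1), G s ^ 2 + C.curv a.1 ^ 2 * D s ^ 2 = 0 := by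
    have hEd : ∀ s ∈ Set.Icc 0 (C.len a.1),
        HasDerivAt (fun s => G s ^ 2 + C.curv a.1 ^ 2 * D s ^ 2) 0 s := by
      intro s hs
      refine (((hGd s hs).pow 2).add (((hDd s).pow 2).const_mul (C.curv a.1 ^ 2))).congr_deriv ?_
      push_cast
      ring
    have hconst := constant_of_has_deriv_right_zero
      (f := fun s => G s ^ 2 + C.curv a.1 ^ 2 * D s ^ 2)
      (fun s hs => (hEd s hs).continuousAt.continuousWithinAt)
      (fun s hs => (hEd s ⟨hs.1, hs.2.le⟩).hasDerivWithinAt)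
    intro s hs
    rw [hconst s hs, hG0, hD0]
    ring
  have hGz : ∀ s ∈ Set.Icc 0 (C.len a.1), G s = 0 := by
    intro s hs
    have := hE s hs
    have h1 : 0 ≤ C.curv a.1 ^ 2 * D s ^ 2 := by positivity
    exact pow_eq_zero_iff (two_ne_zero) |>.1 (le_antisymm (by linarith) (sq_nonneg (G s)))
  have hDconst := constant_of_has_deriv_right_zero (f := D)
    (fun s _ => (hDd s).continuousAt.continuousWithinAt)
    (fun s hs => by
      have := (hDd s).hasDerivWithinAt (s := Set.Ici s)
      rwa [hGz s ⟨hs.1, hs.2.le⟩] at this)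
  have hDl := hDconst (C.len a.1) ⟨hla.le, le_rfl⟩
  rw [hD0] at hDl
  simp only [hD] at hDl
  rw [out_len, ha.2, out_eq] at hDl
  -- The shorter curve has reached the circle, while at this parameter the longer one is still in
  -- the open disk.
  have h1 := C.norm_γ_lt_one (e := b.1) (s := if b.2 then C.len b.1 - C.len a.1 else C.len a.1) (by
    split_ifs
    · exact ⟨by linarith, by linarith⟩
    · exact ⟨hla, hlt⟩)
  have h2 := norm_nonneg (C.γ b.1 (if b.2 then C.len b.1 - C.len a.1 else C.len a.1))
  nlinarith

theorem len_eq_of_same_initial (hC : C.IsStationary) {a b : C.End}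
    (ha : C.IsBoundaryEnd (C.opp a)) (hb : C.IsBoundaryEnd (C.opp b))
    (hcurv : C.curv a.1 ^ 2 = C.curv b.1 ^ 2) (hnorm : ‖C.endPt a‖ = ‖C.endPt b‖)
    (hinner : inner ℝ (C.endPt a) (C.tangent a) = inner ℝ (C.endPt b) (C.tangent b)) :
    C.len a.1 = C.len b.1 :=
  le_antisymm
    (not_lt.1 (not_len_lt_of_same_initial hC hb ha hcurv.symm hnorm.symm hinner.symm))
    (not_lt.1 (not_len_lt_of_same_initial hC ha hb hcurv hnorm hinner))

theorem curvTo_eq_orient_mul {e : Fin C.numEdges} {i j : Fin n} (h : C.Separates e i j) :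
    C.curvTo i e = C.orient i e * C.curv e := by
  have hne := C.left_ne_right e
  unfold curvTo orient
  rcases h with ⟨rfl, rfl⟩ | ⟨rfl, rfl⟩
  · simp
  · simp [hne]

theorem curvTo_sq {e : Fin C.numEdges} {i j : Fin n} (h : C.Separates e i j) :
    C.curvTo i e ^ 2 = C.curv e ^ 2 := by
  rw [curvTo_eq_orient_mul h]
  linear_combination C.curv e ^ 2 * orient_sq i e

theorem curvTo_neg {e : Fin C.numEdges} {i j : Fin n} (h : C.Separates e i j) :
    C.curvTo j e = - C.curvTo i e := by
  have hne := C.left_ne_right e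
  unfold curvTo
  rcases h with ⟨rfl, rfl⟩ | ⟨rfl, rfl⟩ <;> simp [hne]

theorem curvTo_eq_zero {e : Fin C.numEdges} {i j m : Fin n} (h : C.Separates e i j)
    (hi : m ≠ i) (hj : m ≠ j) : C.curvTo m e = 0 := by
  unfold curvTo
  rcases h with ⟨rfl, rfl⟩ | ⟨rfl, rfl⟩ <;> simp [hi.symm, hj.symm]

/-! ### Rigidity and energy of a boundary triangle. -/

namespace BoundaryTriangle

variable {i j k : Fin n} {a b c : C.End}

/-- `curv_mul_one_sub_sq` at the triple point, with the normal into `i` written as `(A + 2 B) / √3`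
in terms of the tangents of the two sides. -/
theorem curvTo_identity (hC : C.IsStationary) (T : C.BoundaryTriangle i j k a b c) :
    √3 * C.curvTo i a.1 * (1 - ‖C.endPt a‖ ^ 2) =
      2 * (inner ℝ (C.endPt a) (C.tangent a) + 2 * inner ℝ (C.endPt a) (C.tangent b)) := by
  have h1 := curv_mul_one_sub_sq hC T.boundary_a (C.param_mem a)
  change C.curv a.1 * (1 - ‖C.endPt a‖ ^ 2) =
    2 * inner ℝ (C.endPt a) (C.leftNormal a.1 (C.param a)) at h1
  rw [leftNormal_param, inner_smul_right] at h1
  have h2 := congrArg (inner ℝ (C.endPt a)) (add_two_smul_eq (C.norm_tangent a) T.inner_eq)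
  rw [inner_add_right, inner_smul_right, inner_smul_right] at h2
  rw [curvTo_eq_orient_mul T.sep_a, h2]
  have h3 := T.normal_a
  have h4 := orient_sq i a.1
  have h5 := endSign_sq a
  linear_combination √3 * C.orient i a.1 * h1 +
    2 * (inner ℝ (C.tangent b) (Complex.I * C.tangent a) *
      inner ℝ (C.endPt a) (Complex.I * C.tangent a)) * (2 * h4 * C.endSign a * C.endSign a + 2 * h5)
    - 4 * C.orient i a.1 * C.endSign a * inner ℝ (C.endPt a) (Complex.I * C.tangent a) * h3

theorem norm_sq_identity (T : C.BoundaryTriangle i j k a b c) :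
    3 * ‖C.endPt a‖ ^ 2 = 4 * (inner ℝ (C.endPt a) (C.tangent a) ^ 2 +
      inner ℝ (C.endPt a) (C.tangent a) * inner ℝ (C.endPt a) (C.tangent b) +
      inner ℝ (C.endPt a) (C.tangent b) ^ 2) := by
  have h2 := congrArg (inner ℝ (C.endPt a)) (add_two_smul_eq (C.norm_tangent a) T.inner_eq)
  rw [inner_add_right, inner_smul_right, inner_smul_right] at h2
  have h3 := sq_inner_eq (C.norm_tangent a) (C.norm_tangent b) T.inner_eq
  have h4 : ‖C.endPt a‖ ^ 2 = inner ℝ (C.endPt a) (C.tangent a) ^ 2 +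
      inner ℝ (C.endPt a) (Complex.I * C.tangent a) ^ 2 := by
    have hA := C.norm_tangent a
    have hA1 : (C.tangent a).re * (C.tangent a).re + (C.tangent a).im * (C.tangent a).im = 1 := by
      rw [← Complex.normSq_apply, Complex.normSq_eq_norm_sq, hA, one_pow]
    rw [← Complex.normSq_eq_norm_sq, Complex.normSq_apply]
    simp [Complex.inner]
    linear_combination (-(C.endPt a).re ^ 2 - (C.endPt a).im ^ 2) * hA1
  set x := inner ℝ (C.endPt a) (C.tangent a)
  set y := inner ℝ (C.endPt a) (C.tangent b)
  set d := inner ℝ (C.tangent b) (Complex.I * C.tangent a)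
  set m := inner ℝ (C.endPt a) (Complex.I * C.tangent a)
  have h5 : (x + 2 * y) ^ 2 = 3 * m ^ 2 := by
    rw [h2]; linear_combination 4 * m ^ 2 * h3
  linear_combination 3 * h4 - h5

/-- Multiply by `P = 1 - ρ²` and write everything in `x = ⟨p, A⟩`, `y = ⟨p, B⟩`. The result is at
least `2 (x + y)² + ρ² + 2 (x + y) + 2 (1 - ρ²) = 2 (x + y + 1/2)² + 3/2 - ρ²`, which is positive
since `ρ < 1`. -/
theorem energy_pos (hC : C.IsStationary) (T : C.BoundaryTriangle i j k a b c) :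
    0 < C.curvTo i a.1 ^ 2 * C.len a.1 + C.curvTo i b.1 ^ 2 * C.len b.1 +
      (C.curvTo i a.1 + C.curvTo i b.1) / √3 + 2 := by
  have h1 := T.curvTo_identity hC
  have h2 := T.swap.curvTo_identity hC
  have h3 := T.norm_sq_identity
  have h4 := one_sub_norm_le_len T.boundary_a
  have h5 := one_sub_norm_le_len T.boundary_b
  rw [T.endPt_b] at h2 h5
  have hρ1 := T.interior.2
  have hρ0 := norm_nonneg (C.endPt a)
  set ρ := ‖C.endPt a‖
  set x := inner ℝ (C.endPt a) (C.tangent a)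
  set y := inner ℝ (C.endPt a) (C.tangent b)
  set α := C.curvTo i a.1
  set β := C.curvTo i b.1
  have h33 : √3 * √3 = 3 := Real.mul_self_sqrt (by norm_num)
  have hs3 : 0 < √3 := by positivity
  set P := 1 - ρ ^ 2 with hP
  have hPpos : 0 < P := by nlinarith
  have h6 : (α + β) / √3 * P = 2 * (x + y) := by
    rw [div_mul_eq_mul_div, div_eq_iff hs3.ne']
    have h7 : √3 * ((α + β) * P) = 6 * (x + y) := by linear_combination h1 + h2
    have h8 : √3 * ((α + β) * P - 2 * (x + y) * √3) = 0 := by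
      linear_combination h7 - 2 * (x + y) * h33
    rcases mul_eq_zero.1 h8 with h9 | h9
    · exact absurd h9 hs3.ne'
    · linarith
  have h7 : 3 * (α ^ 2 + β ^ 2) * P ^ 2 = 4 * (5 * x ^ 2 + 8 * x * y + 5 * y ^ 2) := by
    have h8 : (√3 * α * P) ^ 2 + (√3 * β * P) ^ 2 =
        (2 * (x + 2 * y)) ^ 2 + (2 * (y + 2 * x)) ^ 2 := by rw [h1, h2]
    linear_combination h8 - (α ^ 2 + β ^ 2) * P ^ 2 * h33
  -- `P = (1 - ρ)(1 + ρ)` and `1 + ρ ≤ 2`, so both lengths are at least `P / 2`.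
  have h8 : P / 2 ≤ 1 - ρ := by nlinarith
  have h9 : (α ^ 2 + β ^ 2) * (P / 2) ≤ α ^ 2 * C.len a.1 + β ^ 2 * C.len b.1 := by
    nlinarith [sq_nonneg α, sq_nonneg β]
  have h10 : (α ^ 2 + β ^ 2) * (P / 2) * P = 2 * (x + y) ^ 2 + ρ ^ 2 := by
    linear_combination h7 / 6 - h3 / 3
  have h11 := mul_le_mul_of_nonneg_right h9 hPpos.le
  have h12 : 0 < (α ^ 2 * C.len a.1 + β ^ 2 * C.len b.1 + (α + β) / √3 + 2) * P := by
    have h13 : ρ ^ 2 < 1 := by nlinarith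
    nlinarith [sq_nonneg (x + y + 1 / 2)]
  exact (mul_pos_iff_of_pos_right hPpos).1 h12

/-- The curvatures depend only on the regions, and `curvTo_identity` for both sides gives `x = X P`,
`y = Y P` with `X`, `Y` common to the two triangles. Then `norm_sq_identity` becomes `3 (1 - P) = 4
W P²` with `W = X² + X Y + Y² ≥ 0`, which has only one positive solution `P`. -/
theorem initial_eq (hC : C.IsStationary) {a' b' c' : C.End} (T : C.BoundaryTriangle i j k a b c)
    (T' : C.BoundaryTriangle i j k a' b' c') :
    ‖C.endPt a‖ = ‖C.endPt a'‖ ∧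
      inner ℝ (C.endPt a) (C.tangent a) = inner ℝ (C.endPt a') (C.tangent a') := by
  have h1 := T.curvTo_identity hC
  have h2 := T.swap.curvTo_identity hC
  have h3 := T.norm_sq_identity
  have h1' := T'.curvTo_identity hC
  have h2' := T'.swap.curvTo_identity hC
  have h3' := T'.norm_sq_identity
  rw [T.endPt_b] at h2
  rw [T'.endPt_b] at h2'
  rw [← C.curvTo_congr hC T.sep_a T'.sep_a] at h1'
  rw [← C.curvTo_congr hC T.sep_b T'.sep_b] at h2'
  have hρ1 := T.interior.2
  have hρ0 := norm_nonneg (C.endPt a)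
  have hρ1' := T'.interior.2
  have hρ0' := norm_nonneg (C.endPt a')
  set ρ := ‖C.endPt a‖
  set x := inner ℝ (C.endPt a) (C.tangent a)
  set y := inner ℝ (C.endPt a) (C.tangent b)
  set ρ' := ‖C.endPt a'‖
  set x' := inner ℝ (C.endPt a') (C.tangent a')
  set y' := inner ℝ (C.endPt a') (C.tangent b')
  set α := √3 * C.curvTo i a.1
  set β := √3 * C.curvTo i b.1
  set P := 1 - ρ ^ 2 with hP
  set P' := 1 - ρ' ^ 2 with hP'
  have hPpos : 0 < P := by nlinarith
  have hPpos' : 0 < P' := by nlinarith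
  set X := (2 * β - α) / 6
  set Y := (2 * α - β) / 6
  have hx : x = X * P := by
    simp only [X]; linear_combination (h1 - 2 * h2) / 6
  have hy : y = Y * P := by
    simp only [Y]; linear_combination (h2 - 2 * h1) / 6
  have hx' : x' = X * P' := by
    simp only [X]; linear_combination (h1' - 2 * h2') / 6
  have hy' : y' = Y * P' := by
    simp only [Y]; linear_combination (h2' - 2 * h1') / 6
  have hW : 0 ≤ X ^ 2 + X * Y + Y ^ 2 := by nlinarith [sq_nonneg (X + Y), sq_nonneg X, sq_nonneg Y]
  have h4 : 3 * (1 - P) = 4 * (X ^ 2 + X * Y + Y ^ 2) * P ^ 2 := by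
    rw [hx, hy] at h3; rw [hP] at h3 ⊢; linear_combination h3
  have h4' : 3 * (1 - P') = 4 * (X ^ 2 + X * Y + Y ^ 2) * P' ^ 2 := by
    rw [hx', hy'] at h3'; rw [hP'] at h3' ⊢; linear_combination h3'
  have h5 : (P - P') * (3 + 4 * (X ^ 2 + X * Y + Y ^ 2) * (P + P')) = 0 := by
    linear_combination h4' - h4
  have h6 : P = P' := by
    rcases mul_eq_zero.1 h5 with h | h
    · linarith
    · have : 0 ≤ (X ^ 2 + X * Y + Y ^ 2) * (P + P') := by positivity
      linarith
  refine ⟨?_, by rw [hx, hx', h6]⟩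
  have h7 : ρ ^ 2 = ρ' ^ 2 := by linarith
  exact (sq_eq_sq₀ hρ0 hρ0').1 h7

theorem len_eq (hC : C.IsStationary) {a' b' c' : C.End} (T : C.BoundaryTriangle i j k a b c)
    (T' : C.BoundaryTriangle i j k a' b' c') : C.len a.1 = C.len a'.1 := by
  obtain ⟨h1, h2⟩ := T.initial_eq hC T'
  refine len_eq_of_same_initial hC T.boundary_a T'.boundary_a ?_ h1 h2
  rw [← curvTo_sq T.sep_a, ← curvTo_sq T'.sep_a, C.curvTo_congr hC T.sep_a T'.sep_a]

end BoundaryTriangle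

end AdmissibleGraph

/-! ### The index form on functions constant along each curve. -/

namespace AdmissibleGraph

variable {n : ℕ} {C : AdmissibleGraph n}

open Classical in
/-- The contribution to the index form of a function which is constant on each curve, with square
`w`. -/
theorem indexForm_const (hC : C.IsStationary) (u : Fin C.numEdges → ℝ) :
    C.indexForm (fun e _ => u e) (fun e _ => u e) =
      (∑ e, -(C.curv e ^ 2 * C.len e) * u e ^ 2)
      + (∑ a : C.End, (if C.IsInteriorEnd a then C.q a else 0) * u a.1 ^ 2)
      - ∑ a : C.End, (if C.IsBoundaryEnd a then 1 else 0) * u a.1 ^ 2 := by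
  unfold indexForm
  congr 1
  · congr 1
    · refine Finset.sum_congr rfl fun e _ => ?_
      rw [intervalIntegral.integral_congr (g := fun _ => -(C.curv e ^ 2) * u e ^ 2)]
      · rw [intervalIntegral.integral_const, smul_eq_mul]; ring
      · intro s hs
        rw [Set.uIcc_of_le (C.len_pos e).le] at hs
        simp only [deriv_const, C.leftCurv_eq_curv hC hs]
        ring
    · refine Finset.sum_congr rfl fun a _ => ?_
      split_ifs <;> ring
  · refine Finset.sum_congr rfl fun a _ => ?_
    split_ifs <;> ring

open Classical in
theorem isAdmissible_const {u : Fin C.numEdges → ℝ}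
    (h : ∀ v : ℂ, ‖v‖ < 1 → ∑ a : C.End, (if C.endPt a = v then C.endSign a * u a.1 else 0) = 0) :
    C.IsAdmissible fun e _ => u e where
  absCont e := (LipschitzWith.const (u e)).lipschitzOnWith.absolutelyContinuousOnInterval
  deriv_memLp e := by
    simp only [deriv_const']
    exact MemLp.zero
  closed _ _ := rfl
  vertex v _ hv := h v hv

/-- In the sum defining `q`, the only region touching the vertex and not adjacent to `a` is `k`; the
curve of `a` does not bound it. -/
theorem q_eq (hC : C.IsStationary) {i j k : Fin n} {a b c : C.End}
    (T : C.BoundaryTriangle i j k a b c) :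
    C.q a = (C.curvTo k b.1 + C.curvTo k c.1) / √3 := by
  classical
  have hab : a ≠ b := fun h => T.ne (congrArg Prod.fst h)
  have hinner : ∀ m : Fin n, ∑ d : C.End, (if C.endPt d = C.endPt a then
      C.curvInto m d.1 (C.param d) else 0) =
      C.curvTo m a.1 + C.curvTo m b.1 + C.curvTo m c.1 := by
    intro m
    have hfil : Finset.univ.filter (fun d => C.endPt d = C.endPt a) = {a, b, c} := by
      ext d
      simp only [Finset.mem_filter, Finset.mem_univ, true_and, Finset.mem_insert,
        Finset.mem_singleton]
      refine ⟨T.eq_or d, ?_⟩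
      rintro (rfl | rfl | rfl)
      · rfl
      · exact T.endPt_b
      · exact T.endPt_c
    rw [← Finset.sum_filter, hfil, Finset.sum_insert (by simp [hab, T.c_ne_a.symm]),
      Finset.sum_insert (by simp [T.c_ne_b.symm]), Finset.sum_singleton, ← add_assoc]
    simp only [C.curvInto_eq_curvTo hC m (C.param_mem _)]
  have hik := T.sep_b.ne
  have hjk := T.jk
  have hcond : ∀ m, (m = C.left a.1 ∨ m = C.right a.1) ↔ (m = i ∨ m = j) := by
    intro m
    rcases T.sep_a with ⟨h1, h2⟩ | ⟨h1, h2⟩ <;> rw [h1, h2]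
    exact or_comm
  unfold q
  congr 1
  rw [Finset.sum_eq_single k]
  · rw [if_neg (by rw [hcond]; simp [hik.symm, hjk.symm]), hinner,
      curvTo_eq_zero T.sep_a hik.symm hjk.symm, zero_add]
  · intro m _ hm
    split_ifs with h
    · rfl
    · rw [hcond, not_or] at h
      rw [hinner, curvTo_eq_zero T.sep_a h.1 h.2, curvTo_eq_zero T.sep_b h.1 hm,
        curvTo_eq_zero T.sep_c h.2 hm]
      ring
  · simp

namespace BoundaryTriangle

variable {i j k : Fin n} {a b c : C.End}

/-- The third curve enters once with the normal into `k` and once with the normal into `j`, so it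
cancels. -/
theorem q_add_q (hC : C.IsStationary) (T : C.BoundaryTriangle i j k a b c) :
    C.q a + C.q b = -((C.curvTo i a.1 + C.curvTo i b.1) / √3) := by
  rw [q_eq hC T, q_eq hC T.swap, curvTo_neg T.sep_b, curvTo_neg T.sep_a, curvTo_neg T.sep_c]
  ring

theorem sum_edges (T : C.BoundaryTriangle i j k a b c) (F u : Fin C.numEdges → ℝ)
    (hu : ∀ e, e ≠ a.1 → e ≠ b.1 → u e = 0) :
    ∑ e, F e * u e = F a.1 * u a.1 + F b.1 * u b.1 := by
  rw [Finset.sum_eq_add a.1 b.1 T.ne]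
  · intro e _ he
    rw [hu e he.1 he.2, mul_zero]
  · simp
  · simp

theorem sum_ends (T : C.BoundaryTriangle i j k a b c) (F : C.End → ℝ) (u : Fin C.numEdges → ℝ)
    (hu : ∀ e, e ≠ a.1 → e ≠ b.1 → u e = 0) :
    ∑ d : C.End, F d * u d.1 =
      (F a + F (C.opp a)) * u a.1 + (F b + F (C.opp b)) * u b.1 := by
  have h := T.sum_edges (fun e => F (e, true) + F (e, false)) u hu
  rw [Fintype.sum_prod_type]
  have h1 : ∀ e, ∑ x : Bool, F (e, x) * u e = (F (e, true) + F (e, false)) * u e := by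
    intro e
    rw [Fintype.sum_bool]; ring
  simp only [h1, h]
  unfold CurveSystem.opp
  congr 2
  · rcases a with ⟨e, _ | _⟩
    · exact add_comm _ _
    · rfl
  · rcases b with ⟨e, _ | _⟩
    · exact add_comm _ _
    · rfl

/-- The function equal to `1`, with respect to the normal pointing into `i`, on the two curves
bounding the component. -/
noncomputable def testFun (_ : C.BoundaryTriangle i j k a b c) (e : Fin C.numEdges) : ℝ :=
  if e = a.1 ∨ e = b.1 then C.orient i e else 0

theorem testFun_eq_zero (T : C.BoundaryTriangle i j k a b c) (e : Fin C.numEdges)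
    (ha : e ≠ a.1) (hb : e ≠ b.1) : T.testFun e = 0 := by
  simp [testFun, ha, hb]

theorem testFun_a (T : C.BoundaryTriangle i j k a b c) : T.testFun a.1 = C.orient i a.1 := by
  simp [testFun]

theorem testFun_b (T : C.BoundaryTriangle i j k a b c) : T.testFun b.1 = C.orient i b.1 := by
  simp [testFun]

theorem interior_b (T : C.BoundaryTriangle i j k a b c) : C.IsInteriorEnd b := by
  rw [IsInteriorEnd, T.endPt_b]; exact T.interior

-- Among the curves leaving the triple point, `i` is to the left of one side and to the right of the
-- other, so the two components cancel. The far ends lie on the unit circle and impose no condition.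
open Classical in
theorem sum_vertex (T : C.BoundaryTriangle i j k a b c) {v : ℂ} (hv : ‖v‖ < 1) :
    ∑ d : C.End, (if C.endPt d = v then C.endSign d * T.testFun d.1 else 0) = 0 := by
  have h := T.sum_ends (fun d => if C.endPt d = v then C.endSign d else 0) T.testFun
    T.testFun_eq_zero
  simp only [ite_mul, zero_mul] at h
  rw [h]
  have ha : C.endPt (C.opp a) ≠ v := by
    rintro rfl
    have := T.boundary_a.2
    linarith
  have hb : C.endPt (C.opp b) ≠ v := by
    rintro rfl
    have := T.boundary_b.2
    linarith
  rw [if_neg ha, if_neg hb, T.endPt_b, T.testFun_a, T.testFun_b]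
  split_ifs
  · have h1 := T.normal_a
    have h2 := T.normal_b
    have h3 : inner ℝ (C.tangent a) (Complex.I * C.tangent b) =
        - inner ℝ (C.tangent b) (Complex.I * C.tangent a) := by
      simp [Complex.inner]; ring
    have hs3 : (0 : ℝ) < √3 := by positivity
    rw [h3] at h2
    set d := inner ℝ (C.tangent b) (Complex.I * C.tangent a)
    have hd : d ≠ 0 := by
      rintro h0
      rw [h0, mul_zero] at h1
      linarith
    have h4 : d * (C.endSign a * C.orient i a.1 + C.endSign b * C.orient i b.1) = 0 := by
      linear_combination h1 - h2
    rcases mul_eq_zero.1 h4 with h5 | h5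
    · exact absurd h5 hd
    · linarith
  · ring

theorem sum_area (T : C.BoundaryTriangle i j k a b c) (m : Fin n) :
    ∑ e, ((if C.left e = m then C.len e else 0) - if C.right e = m then C.len e else 0) *
      T.testFun e = ((if i = m then 1 else 0) - if j = m then 1 else 0) * C.len a.1 +
      ((if i = m then 1 else 0) - if k = m then 1 else 0) * C.len b.1 := by
  have haux : ∀ (e : Fin C.numEdges) (j : Fin n), C.Separates e i j →
      ((if C.left e = m then C.len e else 0) - if C.right e = m then C.len e else 0) *
        C.orient i e = ((if i = m then 1 else 0) - if j = m then 1 else 0) * C.len e := by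
    intro e j h
    have hne := C.left_ne_right e
    unfold orient
    rcases h with ⟨rfl, rfl⟩ | ⟨rfl, rfl⟩
    · rw [if_pos rfl]
      split_ifs <;> ring
    · rw [if_neg hne]
      split_ifs <;> ring
  rw [T.sum_edges _ _ T.testFun_eq_zero, T.testFun_a, T.testFun_b, haux _ _ T.sep_a,
    haux _ _ T.sep_b]

open Classical in
theorem index_eq (hC : C.IsStationary) (T : C.BoundaryTriangle i j k a b c) :
    (∑ e, -(C.curv e ^ 2 * C.len e) * T.testFun e ^ 2)
      + (∑ d : C.End, (if C.IsInteriorEnd d then C.q d else 0) * T.testFun d.1 ^ 2)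
      - ∑ d : C.End, (if C.IsBoundaryEnd d then 1 else 0) * T.testFun d.1 ^ 2 =
    -(C.curvTo i a.1 ^ 2 * C.len a.1 + C.curvTo i b.1 ^ 2 * C.len b.1 +
      (C.curvTo i a.1 + C.curvTo i b.1) / √3 + 2) := by
  have hsq : ∀ e, e ≠ a.1 → e ≠ b.1 → T.testFun e ^ 2 = 0 := by
    intro e h1 h2
    rw [T.testFun_eq_zero e h1 h2]; norm_num
  have hno : ∀ d, C.IsInteriorEnd d → ¬ C.IsBoundaryEnd d := fun d h h' => by
    have := h.2
    rw [h'.2] at this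
    exact lt_irrefl _ this
  have hno' : ∀ d, C.IsBoundaryEnd d → ¬ C.IsInteriorEnd d := fun d h h' => hno d h' h
  have h1 := T.sum_edges (fun e => -(C.curv e ^ 2 * C.len e)) _ hsq
  have h2 := T.sum_ends (fun d => if C.IsInteriorEnd d then C.q d else 0) _ hsq
  have h3 := T.sum_ends (fun d => if C.IsBoundaryEnd d then 1 else 0) _ hsq
  have hone : ∀ e, C.orient i e ^ 2 = 1 := fun e => by rw [sq, orient_sq]
  rw [T.testFun_a, T.testFun_b, hone, hone] at h1 h2 h3
  rw [if_pos T.interior, if_pos T.interior_b, if_neg (hno' _ T.boundary_a),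
    if_neg (hno' _ T.boundary_b)] at h2
  rw [if_neg (hno _ T.interior), if_neg (hno _ T.interior_b), if_pos T.boundary_a,
    if_pos T.boundary_b] at h3
  rw [h1, h2, h3, curvTo_sq T.sep_a, curvTo_sq T.sep_b]
  linear_combination T.q_add_q hC

/-- Two disjoint boundary triangles of the same type make a stationary graph unstable: one of the
two is enlarged at the expense of the other. -/
theorem isUnstable (hC : C.IsStationary) {a' b' c' : C.End} (T : C.BoundaryTriangle i j k a b c)
    (T' : C.BoundaryTriangle i j k a' b' c')
    (hdisj : ∀ e, (e = a.1 ∨ e = b.1) → ¬ (e = a'.1 ∨ e = b'.1)) : C.IsUnstable := by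
  classical
  intro hstable
  set u : Fin C.numEdges → ℝ := fun e => T.testFun e - T'.testFun e with hu
  have hadm : C.IsAdmissible fun e _ => u e := by
    refine isAdmissible_const fun v hv => ?_
    have h := congrArg₂ (· - ·) (T.sum_vertex hv) (T'.sum_vertex hv)
    simp only [← Finset.sum_sub_distrib, sub_self] at h
    refine Eq.trans ?_ h
    refine Finset.sum_congr rfl fun d _ => ?_
    simp only [hu]
    split_ifs <;> ring
  have hmean : C.MeanZero fun e _ => u e := by
    intro m
    have h := congrArg₂ (· - ·) (T.sum_area m) (T'.sum_area m)
    simp only [← Finset.sum_sub_distrib] at h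
    rw [T.len_eq hC T', T.swap.len_eq hC T'.swap, sub_self] at h
    refine Eq.trans ?_ h
    refine Finset.sum_congr rfl fun e _ => ?_
    simp only [intervalIntegral.integral_const, smul_eq_mul, sub_zero, hu]
    split_ifs <;> ring
  have hQ := hstable _ hadm hmean
  rw [indexForm_const hC] at hQ
  -- The supports are disjoint, so no mixed terms occur and the index form splits.
  have hsq : ∀ e, u e ^ 2 = T.testFun e ^ 2 + T'.testFun e ^ 2 := by
    intro e
    simp only [hu]
    by_cases he : e = a.1 ∨ e = b.1
    · have h0 : T'.testFun e = 0 := if_neg (hdisj e he)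
      rw [h0]; ring
    · have h0 : T.testFun e = 0 := if_neg he
      rw [h0]; ring
  simp only [hsq, mul_add, Finset.sum_add_distrib] at hQ
  have h1 := T.index_eq hC
  have h2 := T'.index_eq hC
  have h3 := T.energy_pos hC
  have h4 := T'.energy_pos hC
  linarith

end BoundaryTriangle

end AdmissibleGraph

/-! ### The proposition. -/

theorem mainTheorem5 (n : ℕ) (C : AdmissibleGraph n) (hC : C.IsStationary) (i : Fin n)
    (Ω₁ Ω₂ : Set ℂ) (hne : Ω₁ ≠ Ω₂)
    (h₁ : C.IsBoundaryThreeComponent i Ω₁) (h₂ : C.IsBoundaryThreeComponent i Ω₂)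
    (hadj : n = 3 ∨ C.neighbours i Ω₁ = C.neighbours i Ω₂) :
    C.IsUnstable := by
  obtain ⟨j, k, a, b, c, T, hea, heb, hN⟩ :=
    AdmissibleGraph.exists_boundaryTriangle_of_component hC h₁
  obtain ⟨j', k', a', b', c', T', hea', heb', hN'⟩ :=
    AdmissibleGraph.exists_boundaryTriangle_of_component hC h₂
  obtain ⟨⟨z₁, -, hz₁⟩, -⟩ := h₁
  obtain ⟨⟨z₂, -, hz₂⟩, -⟩ := h₂
  have hdisj : ∀ e, (e = a.1 ∨ e = b.1) → ¬ (e = a'.1 ∨ e = b'.1) := by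
    intro e he he'
    refine hne (AdmissibleGraph.component_eq_of_common_edge hz₁ hz₂ (e := e) ?_ ?_)
    · rcases he with rfl | rfl
      · exact hea
      · exact heb
    · rcases he' with rfl | rfl
      · exact hea'
      · exact heb'
  have hij := T.sep_a.ne
  have hik := T.sep_b.ne
  have hjk := T.jk
  have hij' := T'.sep_a.ne
  have hik' := T'.sep_b.ne
  have hjk' := T'.jk
  have hcases : (j = j' ∧ k = k') ∨ (j = k' ∧ k = j') := by
    rcases hadj with rfl | hadj
    -- Among three indices, both `{j, k}` and `{j', k'}` are the complement of `i`.
    · omega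
    · rw [hN, hN'] at hadj
      have hj : j = j' ∨ j = k' := by
        have : j ∈ ({j', k'} : Set (Fin n)) := hadj ▸ Or.inl rfl
        simpa using this
      have hk : k = j' ∨ k = k' := by
        have : k ∈ ({j', k'} : Set (Fin n)) := hadj ▸ Or.inr rfl
        simpa using this
      rcases hj with h | h <;> rcases hk with h' | h'
      · exact absurd (h.trans h'.symm) hjk
      · exact Or.inl ⟨h, h'⟩
      · exact Or.inr ⟨h, h'⟩
      · exact absurd (h.trans h'.symm) hjk
  rcases hcases with ⟨rfl, rfl⟩ | ⟨rfl, rfl⟩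
  · exact T.isUnstable hC T' hdisj
  -- The two sides of the second triangle are exchanged so that corresponding sides separate the
  -- same regions.
  · exact T.isUnstable hC T'.swap fun e he he' => hdisj e he he'.symm
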